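/- Let $n\ge 4$, let $C$ be the Cartan matrix of type $D_n$, let $q_0,\dots,q_n$ be formal variables and $q=q_0q_1q_2^2\cdots q_{n-2}^2q_{n-1}q_n$. *Young walls.* The Young wall pattern of type $D_n$ has columns numbered $1,2,\dots$ from left to right and rows numbered $0,1,2,\dots$ from bottom to top. Rows divisible by $n-2$ consist of pairs of half-blocks, one of each of two orientations $\triangleleft,\triangledown$ in each position; the other rows consist of full blocks. Going upwards, with period $2n-4$, the rows carry the labels $0/1,\,2,\dots,n-2,\,(n-1)/n,\,n-2,\dots,2$. In a $0/1$-row the $\triangleleft$ half-blocks are labelled $1,0,1,0,\dots$ and the $\triangledown$ half-blocks $0,1,0,1,\dots$; in an $(n-1)/n$-row the $\triangleleft$ half-blocks are labelled $n,n-1,n,\dots$ and the $\triangledown$ half-blocks $n-1,n,n-1,\dots$. The $\triangleleft$ half-blocks of row $0$ are grey, all other blocks are white. A Young wall is a set $Y$ of blocks of the pattern which contains all grey half-blocks and finitely many white blocks, such that: no block lies on top of a missing block or half-block; to the left of a block of $Y$ in the same row all blocks of the same shape (and orientation) belong to $Y$; and no two full columns have the same height, a column being full if its top position is filled completely. Let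 $\mathcal Z$ be the set of Young walls, let $\mathrm{wt}_j(Y)$ be the number of white blocks and half-blocks of label $j$ in $Y$, and $\underline q^{\mathrm{wt}(Y)}=\prod_{j=0}^n q_j^{\mathrm{wt}_j(Y)}$. A bar is a connected set of white blocks (blocks that share an edge or a corner being adjacent) that contains each of the labels $0,1,n-1,n$ once and each of the labels $2,\dots,n-2$ twice. A Young wall is a core if no bar can be removed from it leaving a Young wall; $\mathcal C\subset\mathcal Z$ is the set of cores. *Abacus.* The abacus has positions $1,2,3,\dots$, and the runner $R_k$ ($1\le k\le 2n-2$) consists of the positions congruent to $k$ modulo $2n-2$. Each nonempty column of $Y$, with $\lambda$ white blocks, gives a bead at position $\lambda$. If the column is full, the bead is uncolored; otherwise $(n-1)\mid\lambda$, and the bead is white if either its top half-block is $\triangleleft$ and the number of full columns shorter than it is even, or its top half-block is $\triangledown$ and that number is odd, and black in the other cases. For $u\in\mathbb Z$ let $\kappa(u)=(a,a-1,\dots,1)$ be the 2-core partition with $a=2u$ if $u\ge0$ and $a=-2u-1$ if $u<0$. A core $Y$ has abacus coordinates $(z_1,\dots,z_n)\in\mathbb Z^n$ if, for $1\le s\le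 n-2$, $z_s$ is the number of beads on $R_s$ minus the number of beads on $R_{2n-2-s}$, and if the beads on $R_{n-1}$ and $R_{2n-2}$ are exactly the following: with $\alpha=\kappa(z_{n-1})$, $\beta=\kappa(z_n)$ (extended by zeros), one bead at position $(n-1)(\alpha_k+\beta_k)$ for every $k$ with $\alpha_k+\beta_k>0$, white if $\beta_k$ is even and black if $\beta_k$ is odd. **Theorem.** The abacus coordinates define a bijection $\mathcal C\leftrightarrow\mathbb Z^n$, and there is a bijective change of coordinates $\mathbb Z^n\to\mathbb Z^n$, $(z_1,\dots,z_n)\mapsto\bar m=(m_1,\dots,m_n)$, such that the following hold. (1) The multi-weight of the core $Y\in\mathcal C$ corresponding to $\bar m$ is $$\underline q^{\mathrm{wt}(Y)}=q_1^{m_1}\cdots q_n^{m_n}\,(q^{1/2})^{\bar m^\top C\,\bar m}.$$ In particular, for every $\bar m\in\mathbb Z^n$ all exponents on the right are non-negative integers. (2) The following sums and the product converge as formal power series in $q_0,\dots,q_n$, the product is invertible, and $$\sum_{Y\in\mathcal Z}\underline q^{\mathrm{wt}(Y)}=\frac{\sum_{\bar m\in\mathbb Z^n}q_1^{m_1}\cdots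 q_n^{m_n}(q^{1/2})^{\bar m^\top C\,\bar m}}{\prod_{m=1}^\infty(1-q^m)^{n+1}}.$$ (3) Write $z_1+\dots+z_{n-2}=2a-b$ with $a\in\mathbb Z$, $b\in\{0,1\}$, and let $c=2b-1$. Then $$\sum_{i=1}^n m_i=-\sum_{i=1}^{n-2}(n-1-i)z_i-(n-1)\,c\,(z_{n-1}+z_n)-(n-1)\,b.$$ -/

import Mathlib

namespace TypeD

/-- The shape of a block of the Young wall pattern: a full block, or one of the two triangular
half-blocks (`lhd` and `nabla`, the two orientations) which together fill one position. -/
inductive Side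
  | full
  | lhd
  | nabla

/-- A block given by its column and row (both counted from `0`) and its shape. -/
structure Block where
  col : ℕ
  row : ℕ
  side : Side

/-- The blocks of the pattern of type `D_n`: the rows divisible by `n - 2` consist of half-blocks,
two in each position, and all other rows consist of full blocks. -/
def IsBlock (n : ℕ) (b : Block) : Prop :=
  b.side = Side.full ↔ ¬ (n - 2) ∣ b.row

/-- The label of a block. Upwards, with period `2 n - 4`, the rows carry the labels
`0/1, 2, …, n-2, (n-1)/n, n-2, …, 2`. In a row of half-blocks, the half-blocks of one
orientation carry the two labels alternately. -/
def label (n : ℕ) (b : Block) : ℕ :=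
  match b.side with
  | Side.full =>
      if b.row % (2 * (n - 2)) < n - 2 then b.row % (2 * (n - 2)) + 1
      else 2 * n - 3 - b.row % (2 * (n - 2))
  | Side.lhd =>
      if b.row % (2 * (n - 2)) = 0 then (if b.col % 2 = 0 then 1 else 0)
      else (if b.col % 2 = 0 then n else n - 1)
  | Side.nabla =>
      if b.row % (2 * (n - 2)) = 0 then (if b.col % 2 = 0 then 0 else 1)
      else (if b.col % 2 = 0 then n - 1 else n)

/-- The grey half-blocks: in the bottom row, those of orientation `lhd`; so the white half-blocks
of the bottom row are labelled `0, 1, 0, 1, …` from left to right. -/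
def IsGrey (b : Block) : Prop :=
  b.row = 0 ∧ b.side = Side.lhd

/-- The column `c` of `S` is full with top row `r`: its top position, in row `r`, is completely
filled (by a full block or by both half-blocks). -/
def IsFullTop (n : ℕ) (S : Set Block) (c r : ℕ) : Prop :=
  (∀ b, IsBlock n b → b.col = c → b.row = r → b ∈ S) ∧ ∀ b ∈ S, b.col = c → b.row ≤ r

/-- The (proper) Young walls of type `D_n`. -/
@[ext]
structure YoungWall (n : ℕ) where
  carrier : Set Block
  isBlock : ∀ b ∈ carrier, IsBlock n b
  grey_mem : ∀ b, IsBlock n b → IsGrey b → b ∈ carrier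
  finite_white : {b ∈ carrier | ¬ IsGrey b}.Finite
  /-- No block is placed on top of a missing block or half-block. -/
  below_mem : ∀ b ∈ carrier, ∀ b', IsBlock n b' → b'.col = b.col → b'.row + 1 = b.row →
    b' ∈ carrier
  /-- There are no free positions to the left of a block or half-block; for half-blocks only
  those of the same orientation have to be present. -/
  left_mem : ∀ b ∈ carrier, ∀ b', IsBlock n b' → b'.col + 1 = b.col → b'.row = b.row →
    b'.side = b.side → b' ∈ carrier
  /-- No two full columns have the same height. -/
  proper : ∀ c c' r, IsFullTop n carrier c r → IsFullTop n carrier c' r → c = c'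

/-- `wt_j(Y)`, the number of white blocks and half-blocks of label `j`. -/
noncomputable def wt (n : ℕ) (Y : YoungWall n) (j : Fin (n + 1)) : ℕ :=
  Set.ncard {b ∈ Y.carrier | ¬ IsGrey b ∧ label n b = j}

/-- The multi-weight of one bar: `1` for the labels `0, 1, n - 1, n` of half-blocks, `2` for the
labels of full blocks. -/
def barWeight (n j : ℕ) : ℕ :=
  if j = 0 ∨ j = 1 ∨ j + 1 = n ∨ j = n then 1 else 2

/-- Two distinct blocks touch if their positions coincide or share an edge or a corner. -/
def touching : SimpleGraph Block where
  Adj b b' := b ≠ b' ∧ b.col ≤ b'.col + 1 ∧ b'.col ≤ b.col + 1 ∧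
    b.row ≤ b'.row + 1 ∧ b'.row ≤ b.row + 1
  symm := ⟨fun _ _ h => ⟨h.1.symm, h.2.2.1, h.2.1, h.2.2.2.2, h.2.2.2.1⟩⟩
  loopless := ⟨fun _ h => h.1 rfl⟩

/-- A bar: a connected set of white blocks and half-blocks in which each half-block label occurs
once and each full block label occurs twice. -/
def IsBar (n : ℕ) (S : Set Block) : Prop :=
  S.Finite ∧ (∀ b ∈ S, IsBlock n b ∧ ¬ IsGrey b) ∧
    (∀ j ≤ n, Set.ncard {b ∈ S | label n b = j} = barWeight n j) ∧
    (touching.induce S).Connected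

/-- A core Young wall: no bar can be removed from it so that a Young wall remains. -/
def IsCore (n : ℕ) (Y : YoungWall n) : Prop :=
  ¬ ∃ Y' : YoungWall n, Y'.carrier ⊆ Y.carrier ∧ IsBar n (Y.carrier \ Y'.carrier)

/-- The number `λ` of white blocks (full or half) in the column `c`. -/
noncomputable def columnHeight {n : ℕ} (Y : YoungWall n) (c : ℕ) : ℕ :=
  Set.ncard {b ∈ Y.carrier | ¬ IsGrey b ∧ b.col = c}

def IsFullColumn {n : ℕ} (Y : YoungWall n) (c : ℕ) : Prop :=
  ∃ r, IsFullTop n Y.carrier c r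

/-- The block of shape `s` is at the top of the column `c`. -/
def IsTopSide {n : ℕ} (Y : YoungWall n) (c : ℕ) (s : Side) : Prop :=
  ∃ r, (⟨c, r, s⟩ : Block) ∈ Y.carrier ∧ ∀ b ∈ Y.carrier, b.col = c → b.row ≤ r

/-- The number of full columns that are shorter than the column `c`. -/
noncomputable def shorterFull {n : ℕ} (Y : YoungWall n) (c : ℕ) : ℕ :=
  Set.ncard {c' | IsFullColumn Y c' ∧ columnHeight Y c' < columnHeight Y c}

inductive BeadColor
  | plain
  | white
  | black

open Classical in
/-- The colour of the bead of a nonempty column `c`; the bead is placed at the position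
`columnHeight Y c` of the abacus. -/
noncomputable def beadColor {n : ℕ} (Y : YoungWall n) (c : ℕ) : BeadColor :=
  if IsFullColumn Y c then BeadColor.plain
  else if (IsTopSide Y c Side.lhd ↔ Even (shorterFull Y c)) then BeadColor.white
  else BeadColor.black

/-- The number of beads of colour `x` at the position `p ≥ 1` of the abacus of `Y`. -/
noncomputable def beadCount {n : ℕ} (Y : YoungWall n) (p : ℕ) (x : BeadColor) : ℕ :=
  Set.ncard {c | columnHeight Y c = p ∧ beadColor Y c = x}

/-- The number of beads on the `s`-th runner, `1 ≤ s < 2 n - 2`, of the abacus of `Y`. -/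
noncomputable def runnerCount {n : ℕ} (Y : YoungWall n) (s : ℕ) : ℕ :=
  Set.ncard {c | columnHeight Y c % (2 * n - 2) = s}

/-- The 2-core partitions are the staircases `(a, a - 1, …, 1)`. The one of charge `u : ℤ` on the
`A_1`-abacus has `a = 2 u` parts if `0 ≤ u`, and `a = - 2 u - 1` parts if `u < 0`; its size is
`2 u ^ 2 + u`. This is its `k`-th part, counted from `k = 0`. -/
def twoCorePart (u : ℤ) (k : ℕ) : ℕ :=
  (if 0 ≤ u then 2 * u else - 2 * u - 1).toNat - k

/-- The colored configuration on the runners `R_{n-1}` and `R_{2n-2}` which is encoded by the pair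
of 2-core partitions `α`, `β` of charges `u`, `v`: for each `k` with `α_k + β_k > 0` it has a bead
at the position `(α_k + β_k) (n - 1)`, and this bead is white if `β_k` is even and black if
`β_k` is odd. This counts the beads of colour `x` at the position `t (n - 1)`, `t ≥ 1`. -/
noncomputable def pairBeads (u v : ℤ) (t : ℕ) : BeadColor → ℕ
  | BeadColor.plain => 0
  | BeadColor.white => Set.ncard {k | twoCorePart u k + twoCorePart v k = t ∧
      Even (twoCorePart v k)}
  | BeadColor.black => Set.ncard {k | twoCorePart u k + twoCorePart v k = t ∧
      ¬ Even (twoCorePart v k)}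

/-- The core Young wall `Y` has abacus coordinates `(z_1, …, z_n)` (where `z_i` is `z` at the
index `i - 1`). -/
def HasAbacusCoords (n : ℕ) (Y : YoungWall n) (z : Fin n → ℤ) : Prop :=
  (∀ i : Fin n, i.val + 2 < n →
    z i = (runnerCount Y (i.val + 1) : ℤ) - (runnerCount Y (2 * n - 2 - (i.val + 1)) : ℤ)) ∧
  (∀ i j : Fin n, i.val + 2 = n → j.val + 1 = n → ∀ t : ℕ, 1 ≤ t → ∀ x : BeadColor,
    beadCount Y (t * (n - 1)) x = pairBeads (z i) (z j) t x)

/-- The exponent of `q_j` in `q_1^{m_1} ⋯ q_n^{m_n} (q^{1/2})^{mᵀ C m}`, where `C` is the Cartan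
matrix of type `D_n` and `q = q_0 q_1 q_2^2 ⋯ q_{n-2}^2 q_{n-1} q_n`. -/
def thetaExponent (n : ℕ) (m : Fin n → ℤ) (j : Fin (n + 1)) : ℚ :=
  ((Fin.cases 0 m j : ℤ) : ℚ) +
    (barWeight n j : ℚ) * (((m ⬝ᵥ (CartanMatrix.D n).mulVec m : ℤ) : ℚ) / 2)

/-- The monomial with exponents `e` as a formal power series in `q_0, …, q_n`. -/
noncomputable def qMonomial (n : ℕ) (e : Fin (n + 1) → ℕ) : MvPowerSeries (Fin (n + 1)) ℤ :=
  MvPowerSeries.monomial (Finsupp.equivFunOnFinite.symm e) 1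

/-- The monomial `q_1^{m_1} ⋯ q_n^{m_n} (q^{1/2})^{mᵀ C m}` as a formal power series; the
exponents are natural numbers, which is part of the theorem. -/
noncomputable def thetaTerm (n : ℕ) (m : Fin n → ℤ) : MvPowerSeries (Fin (n + 1)) ℤ :=
  qMonomial n fun j => ⌊thetaExponent n m j⌋₊

/-- `q = q_0 q_1 q_2^2 ⋯ q_{n-2}^2 q_{n-1} q_n`. -/
noncomputable def barSeries (n : ℕ) : MvPowerSeries (Fin (n + 1)) ℤ :=
  qMonomial n fun j => barWeight n j

end TypeD

open scoped MvPowerSeries.WithPiTopology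

/-! Put `g = n - 2`, the distance between consecutive rows of half-blocks. A wall is known once the
tops of its columns are known. By properness the top rows of the full columns form a finite set; the
other columns end in half-rows `(i + 1) * g`, where they amount to an integer excess whose sign
records the label of the first of them. This gives the unconstrained description `Config`
(`equivWall`).

The beads now behave like fermions. For `s < g` the full beads in rows congruent to `s` modulo `2 *
g` are the particles, and those in rows congruent to `2 * g - 1 - s` the holes, of a Maya diagram.
An excess splits into a number of pairs and at most one positive and one negative single bead.
Single beads in the half-rows labelled `n - 1`, `n` give a further diagram, and those in the
half-rows labelled `0`, `1` another one, whose particle at level `0` is supplied by the parity of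
the number of columns. The pairs form a partition. The only relation among these data is that the
total charge is even (`even_totalCharge`, `exists_toPairs`). A Maya diagram is a charge together
with a neutral diagram, that is, a partition; so a wall is a vector of `n` charges with even sum
together with `n + 1` partitions (`equivCharges`).

The number of blocks of a given label grows with the same slope along every runner. Hence all labels
see the same total energy and differ only by linear forms in the charges. As the least energy at
charge `c` is `c (c - 1) / 2`, the exponents become a linear form `m` in the charges, plus half the
sum of the squares of the charges and the excess energy, both multiplied by the weight of a bar
(`two_mul_labelCount`). The vectors with even coordinate sum form the root lattice of type `D_n`,
and `m` gives the coordinates in a basis of simple roots, so the sum of squares is the Cartan form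
(`dotProduct_weight`, `weight_bijective`). The generating function then factors into the theta
series and `n + 1` partition series.

Removing a bar keeps the charges and lowers the excess energy by one, so walls without excess are
cores. Conversely, positive excess admits an elementary move of a particle or hole, of a
particle-hole pair, or of a pair of beads, and such a move can be realised by removing a connected
set of blocks (`not_isCore_of_totalExcess`). Cores are therefore parametrised by the charges alone.
The first `n - 2` abacus coordinates are runner charges; the last two are a linear substitution of
the two remaining charges, with a sign and a shift depending on the parity of the others
(`ofCoord`). That they describe the coloured beads by two staircases is a comparison of positions
and parities (`beadCount_eq_pairBeads`). -/

open scoped MvPowerSeries.WithPiTopology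

/-! ### Young walls as configurations of beads. -/

namespace TypeD

/-- A bead configuration: the set of top rows of the full columns, and for each row `(i + 1) * g` of
half-blocks the signed excess of one orientation over the other. -/
@[ext]
structure Config where
  full : Finset ℕ
  half : ℕ →₀ ℤ

/-- The sign change by the parity of `k`. -/
def twist (k : ℕ) (h : ℤ) : ℤ := if k % 2 = 0 then h else -h

namespace Config

variable (g : ℕ) (C : Config)

/-- Row `0` gets no excess: its `lhd` half-blocks are grey and always present, so only its `nabla`
half-blocks carry information. -/
def halfAt (r : ℕ) : ℤ := if g ∣ r ∧ r ≠ 0 then C.half (r / g - 1) else 0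

/-- The number of completely filled positions in the row `r`. -/
def inner (r : ℕ) : ℕ :=
  (C.full.filter (r ≤ ·)).card + C.half.sum fun i h => if r < (i + 1) * g then h.natAbs else 0

/-- The number of positions in the row `r` that are not empty. -/
def outer (r : ℕ) : ℕ := C.inner g r + (C.halfAt g r).natAbs

/-- The label of a half-block depends on its orientation and on the parity of its column. The first
excess half-block stands in column `inner`, so twisting by that parity makes the sign of the excess
record its label: positive for `1` or `n`, negative for `0` or `n - 1`. -/
def lhdLen (r : ℕ) : ℕ := C.inner g r + (twist (C.inner g r) (C.halfAt g r)).toNat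

def nablaLen (r : ℕ) : ℕ := C.inner g r + (-twist (C.inner g r) (C.halfAt g r)).toNat

def len (r : ℕ) : Side → ℕ
  | Side.nabla => C.nablaLen g r
  | _ => C.lhdLen g r

variable {g C}

theorem halfAt_succ_mul (hg : 0 < g) (i : ℕ) : C.halfAt g ((i + 1) * g) = C.half i := by
  unfold halfAt
  rw [if_pos ⟨Dvd.intro_left _ rfl, by positivity⟩, Nat.mul_div_cancel _ hg, Nat.add_sub_cancel]

theorem halfAt_zero : C.halfAt g 0 = 0 := by simp [halfAt]

theorem halfAt_of_not_dvd {r : ℕ} (h : ¬ g ∣ r) : C.halfAt g r = 0 := by simp [halfAt, h]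

theorem sum_half_succ (hg : 0 < g) (r : ℕ) :
    (C.half.sum fun i h => if r < (i + 1) * g then h.natAbs else 0) =
      (C.half.sum fun i h => if r + 1 < (i + 1) * g then h.natAbs else 0) +
        (C.halfAt g (r + 1)).natAbs := by
  have key : (C.half.sum fun i h => if (i + 1) * g = r + 1 then h.natAbs else 0) =
      (C.halfAt g (r + 1)).natAbs := by
    by_cases hr : g ∣ r + 1
    · obtain ⟨i, hi⟩ := hr
      obtain ⟨i, rfl⟩ : ∃ j, i = j + 1 := ⟨i - 1, by
        rcases i with _ | i
        · simp at hi
        · simp⟩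
      rw [hi, mul_comm, halfAt_succ_mul hg, Finsupp.sum]
      rw [Finset.sum_eq_single i]
      · simp
      · intro b _ hb
        rw [if_neg]
        intro h
        have := Nat.eq_of_mul_eq_mul_right hg h
        omega
      · intro h
        simpa using h
    · rw [halfAt_of_not_dvd hr, Finsupp.sum]
      apply Finset.sum_eq_zero
      intro i _
      rw [if_neg]
      intro h
      exact hr ⟨i + 1, by rw [← h, mul_comm]⟩
  rw [← key, Finsupp.sum, Finsupp.sum, Finsupp.sum, ← Finset.sum_add_distrib]
  apply Finset.sum_congr rfl
  intro i _
  split_ifs <;> omega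

/-- A filled position of row `r` either is the top of a full column or carries something in row `r +
1`. Read downwards from a high empty row, this recursion determines all row lengths; the interlacing
of `inner` and `outer` follows from it. -/
theorem inner_eq (hg : 0 < g) (r : ℕ) :
    C.inner g r = (if r ∈ C.full then 1 else 0) + C.outer g (r + 1) := by
  unfold outer inner
  rw [sum_half_succ hg]
  have : (C.full.filter (r ≤ ·)).card =
      (if r ∈ C.full then 1 else 0) + (C.full.filter (r + 1 ≤ ·)).card := by
    have h : C.full.filter (r ≤ ·) = C.full.filter (r = ·) ∪ C.full.filter (r + 1 ≤ ·) := by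
      ext x
      simp only [Finset.mem_filter, Finset.mem_union]
      have : r ≤ x ↔ r = x ∨ r + 1 ≤ x := by omega
      rw [this]; tauto
    rw [h, Finset.card_union_of_disjoint, Finset.filter_eq]
    · split_ifs <;> simp
    · rw [Finset.disjoint_filter]; intro x _ hx; omega
  omega

theorem exists_bound (g : ℕ) (C : Config) : ∃ R, (∀ x ∈ C.full, x < R) ∧
    ∀ i ∈ C.half.support, (i + 1) * g < R := by
  refine ⟨C.full.sup id + (C.half.support.sup fun i => (i + 1) * g) + 1, ?_, ?_⟩
  · intro x hx
    have := Finset.le_sup (f := id) hx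
    simp only [id] at this ⊢
    omega
  · intro i hi
    have : (i + 1) * g ≤ C.half.support.sup fun i => (i + 1) * g :=
      Finset.le_sup (f := fun i => (i + 1) * g) hi
    omega

theorem halfAt_eq_zero {R r : ℕ} (hR : ∀ i ∈ C.half.support, (i + 1) * g < R) (hr : R ≤ r) :
    C.halfAt g r = 0 := by
  unfold halfAt
  split_ifs with h
  · by_contra h0
    have := hR _ (Finsupp.mem_support_iff.2 h0)
    obtain ⟨⟨k, rfl⟩, h2⟩ := h
    have hg : 0 < g := Nat.pos_of_ne_zero (by rintro rfl; simp at h2)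
    have hk : 0 < k := Nat.pos_of_ne_zero (by rintro rfl; simp at h2)
    rw [Nat.mul_div_cancel_left _ hg, Nat.sub_add_cancel hk, mul_comm] at this
    omega
  · rfl

theorem inner_eq_zero {R r : ℕ} (hF : ∀ x ∈ C.full, x < R)
    (hR : ∀ i ∈ C.half.support, (i + 1) * g < R) (hr : R ≤ r) : C.inner g r = 0 := by
  unfold inner
  rw [Nat.add_eq_zero_iff]
  constructor
  · rw [Finset.card_eq_zero, Finset.filter_eq_empty_iff]
    intro x hx; have := hF x hx; omega
  · rw [Finsupp.sum]
    apply Finset.sum_eq_zero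
    intro i hi
    rw [if_neg]
    have := hR i hi; omega

theorem inner_le_outer (r : ℕ) : C.inner g r ≤ C.outer g r := Nat.le_add_right _ _

theorem outer_succ_le (hg : 0 < g) (r : ℕ) : C.outer g (r + 1) ≤ C.inner g r := by
  rw [inner_eq hg]; omega

theorem inner_le_outer_succ (hg : 0 < g) (r : ℕ) : C.inner g r ≤ C.outer g (r + 1) + 1 := by
  rw [inner_eq hg r]; split_ifs <;> omega

theorem mem_full_iff (hg : 0 < g) (r : ℕ) : r ∈ C.full ↔ C.outer g (r + 1) < C.inner g r := by
  rw [inner_eq hg r]; split_ifs <;> simp_all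

theorem outer_le_inner_of_lt (hg : 0 < g) {r s : ℕ} (h : r < s) : C.outer g s ≤ C.inner g r := by
  induction s, h using Nat.le_induction with
  | base => exact outer_succ_le hg r
  | succ s _ ih => exact ((outer_succ_le hg s).trans (inner_le_outer s)).trans ih

theorem twist_natAbs (k : ℕ) (h : ℤ) : (twist k h).natAbs = h.natAbs := by
  unfold twist; split_ifs <;> simp

theorem len_bounds (r : ℕ) (s : Side) : C.inner g r ≤ C.len g r s ∧ C.len g r s ≤ C.outer g r := by
  have := twist_natAbs (C.inner g r) (C.halfAt g r)
  cases s <;> simp only [len, lhdLen, nablaLen, outer] <;> omega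

theorem min_len (r : ℕ) : min (C.lhdLen g r) (C.nablaLen g r) = C.inner g r := by
  simp only [lhdLen, nablaLen]; omega

theorem max_len (r : ℕ) : max (C.lhdLen g r) (C.nablaLen g r) = C.outer g r := by
  have := twist_natAbs (C.inner g r) (C.halfAt g r)
  simp only [lhdLen, nablaLen, outer]; omega

theorem len_of_halfAt {r : ℕ} (h : C.halfAt g r = 0) (s : Side) : C.len g r s = C.inner g r := by
  cases s <;> simp [len, lhdLen, nablaLen, twist, h]

theorem lhdLen_sub_nablaLen (r : ℕ) :
    ((C.lhdLen g r : ℤ) - C.nablaLen g r) = twist (C.inner g r) (C.halfAt g r) := by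
  simp only [lhdLen, nablaLen]; omega

end Config

theorem twist_twist (k : ℕ) (h : ℤ) : twist k (twist k h) = h := by
  unfold twist; split_ifs <;> simp

theorem isBlock_iff (g : ℕ) (b : Block) : IsBlock (g + 2) b ↔ (b.side = Side.full ↔ ¬ g ∣ b.row) := by
  simp [IsBlock]

theorem finite_block_of_bound (K R : ℕ) (S : Set Block) (h : ∀ b ∈ S, b.col < K ∧ b.row < R) :
    S.Finite := by
  have hf : ((Set.Iio K ×ˢ Set.Iio R) ×ˢ ({Side.full, Side.lhd, Side.nabla} : Set Side)).Finite :=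
    ((Set.finite_Iio K).prod (Set.finite_Iio R)).prod (by simp)
  refine (hf.image fun p => (⟨p.1.1, p.1.2, p.2⟩ : Block)).subset ?_
  rintro ⟨c, r, s⟩ hb
  have := h _ hb
  refine ⟨((c, r), s), ⟨⟨this.1, this.2⟩, ?_⟩, rfl⟩
  cases s <;> simp

namespace Config

def carrier (g : ℕ) (C : Config) : Set Block :=
  {b | IsBlock (g + 2) b ∧ (IsGrey b ∨ b.col < C.len g b.row b.side)}

/-- Combined with `inner_le_outer_succ` this yields properness: at most one column is full with top
row `r`. -/
theorem isFullTop_carrier_iff {g : ℕ} (hg : 0 < g) (C : Config) (c r : ℕ) :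
    IsFullTop (g + 2) (C.carrier g) c r ↔ C.outer g (r + 1) ≤ c ∧ c < C.inner g r := by
  constructor
  · rintro ⟨h1, h2⟩
    constructor
    · by_contra hc
      push Not at hc
      obtain ⟨s, hs, hs2⟩ : ∃ s, IsBlock (g + 2) ⟨c, r + 1, s⟩ ∧ c < C.len g (r + 1) s := by
        by_cases hr : g ∣ r + 1
        · rw [← max_len] at hc
          rcases lt_max_iff.1 hc with h | h
          · exact ⟨Side.lhd, by simp [isBlock_iff, hr], h⟩
          · exact ⟨Side.nabla, by simp [isBlock_iff, hr], h⟩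
        · refine ⟨Side.full, by simp [isBlock_iff, hr], ?_⟩
          rw [outer, halfAt_of_not_dvd hr] at hc
          rw [len_of_halfAt (halfAt_of_not_dvd hr)]
          simpa using hc
      have := h2 ⟨c, r + 1, s⟩ ⟨hs, Or.inr hs2⟩ rfl
      simp at this
    · by_cases hr : g ∣ r
      · have hn := h1 ⟨c, r, Side.nabla⟩ (by simp [isBlock_iff, hr]) rfl rfl
        have hl := h1 ⟨c, r, Side.lhd⟩ (by simp [isBlock_iff, hr]) rfl rfl
        have hn2 : c < C.nablaLen g r := by simpa [carrier, IsGrey, len] using hn.2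
        rw [← min_len, lt_min_iff]
        refine ⟨?_, hn2⟩
        -- The `lhd` half-block may be present only because it is grey. This happens in row `0`,
        -- where both lengths agree with `inner`.
        rcases hl.2 with h | h
        · have h0 : r = 0 := h.1
          subst h0
          rw [show C.lhdLen g 0 = _ from len_of_halfAt halfAt_zero Side.lhd]
          rwa [show C.nablaLen g 0 = _ from len_of_halfAt halfAt_zero Side.nabla] at hn2
        · exact h
      · have hl := h1 ⟨c, r, Side.full⟩ (by simp [isBlock_iff, hr]) rfl rfl
        rw [← len_of_halfAt (halfAt_of_not_dvd hr) Side.full]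
        simpa [IsGrey] using hl.2
  · rintro ⟨h1, h2⟩
    constructor
    · rintro ⟨c', r', s⟩ hb rfl rfl
      exact ⟨hb, Or.inr (h2.trans_le (len_bounds _ _).1)⟩
    · rintro ⟨c', r', s⟩ hb rfl
      by_contra hr
      simp only [not_le] at hr
      rcases hb.2 with h | h
      · have : r' = 0 := h.1
        omega
      · have h3 := (len_bounds (C := C) (g := g) r' s).2
        have h5 : C.outer g r' ≤ C.outer g (r + 1) := by
          rcases (Nat.succ_le_of_lt hr).eq_or_lt with h6 | h6
          · rw [← h6]
          · exact (outer_le_inner_of_lt hg h6).trans (inner_le_outer _)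
        simp only at h h1
        omega

/-- The Young wall of a bead configuration. -/
def toWall (g : ℕ) (hg : 0 < g) (C : Config) : YoungWall (g + 2) where
  carrier := C.carrier g
  isBlock b hb := hb.1
  grey_mem b hb h := ⟨hb, Or.inl h⟩
  finite_white := by
    obtain ⟨R, hF, hR⟩ := exists_bound g C
    refine finite_block_of_bound (C.outer g 0) R _ ?_
    rintro ⟨c, r, s⟩ ⟨⟨_, hb⟩, hb2⟩
    have hb3 : c < C.len g r s := hb.resolve_left hb2
    have h1 := (len_bounds (C := C) (g := g) r s).2
    have h2 : C.outer g r ≤ C.outer g 0 := by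
      rcases Nat.eq_zero_or_pos r with h | h
      · rw [h]
      · exact (outer_le_inner_of_lt hg h).trans (inner_le_outer _)
    refine ⟨by simp only; omega, ?_⟩
    by_contra hr
    simp only [not_lt] at hr
    have h3 := inner_eq_zero hF hR hr
    have h4 := halfAt_eq_zero hR hr
    rw [outer, h3, h4] at h1
    simp at h1
    omega
  below_mem := by
    rintro ⟨c, r, s⟩ ⟨_, hb⟩ ⟨c', r', s'⟩ hb' h1 h2
    simp only at h1 h2
    subst h1 h2
    refine ⟨hb', Or.inr ?_⟩
    have h3 : c' < C.len g (r' + 1) s := hb.resolve_left fun h => by simpa using h.1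
    have h4 := (len_bounds (C := C) (g := g) (r' + 1) s).2
    have h5 := (len_bounds (C := C) (g := g) r' s').1
    have h6 := outer_succ_le (C := C) hg r'
    simp only
    omega
  left_mem := by
    rintro ⟨c, r, s⟩ ⟨_, hb⟩ ⟨c', r', s'⟩ hb' h1 h2 h3
    simp only at h1 h2 h3
    subst h1 h2 h3
    refine ⟨hb', hb.imp id fun h => ?_⟩
    simp only at h ⊢
    omega
  proper c c' r h h' := by
    rw [isFullTop_carrier_iff hg] at h h'
    have := inner_le_outer_succ (C := C) hg r
    omega

theorem mem_toWall {g : ℕ} {hg : 0 < g} {C : Config} {b : Block} : b ∈ (C.toWall g hg).carrier ↔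
    IsBlock (g + 2) b ∧ (IsGrey b ∨ b.col < C.len g b.row b.side) := Iff.rfl

/-- The wall shows the lengths of its rows. Their minimum and maximum are `inner` and `outer`, which
give back the full beads, and their difference is the twisted excess. -/
theorem toWall_injective (g : ℕ) (hg : 0 < g) : Function.Injective (toWall g hg) := by
  intro C C' h
  have key : ∀ r s, (s = Side.full ↔ ¬ g ∣ r) → ¬ (r = 0 ∧ s = Side.lhd) →
      C.len g r s = C'.len g r s := by
    intro r s h1 h2
    have h3 : ∀ c, c < C.len g r s ↔ c < C'.len g r s := by
      intro c
      have h4 : (⟨c, r, s⟩ : Block) ∈ (C.toWall g hg).carrier ↔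
        (⟨c, r, s⟩ : Block) ∈ (C'.toWall g hg).carrier := by rw [h]
      simpa [mem_toWall, isBlock_iff, h1, IsGrey, h2] using h4
    exact le_antisymm (not_lt.1 fun h => lt_irrefl _ ((h3 _).1 h))
      (not_lt.1 fun h => lt_irrefl _ ((h3 _).2 h))
  have key2 : ∀ r, C.lhdLen g r = C'.lhdLen g r ∧ C.nablaLen g r = C'.nablaLen g r := by
    intro r
    by_cases hr : g ∣ r
    · by_cases h0 : r = 0
      · subst h0
        have := key 0 Side.nabla (by simp) (by simp)
        rw [len_of_halfAt halfAt_zero, len_of_halfAt halfAt_zero] at this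
        simp [lhdLen, nablaLen, halfAt_zero, twist, this]
      · exact ⟨key r Side.lhd (by simp [hr]) (by simp [h0]), key r Side.nabla (by simp [hr]) (by simp)⟩
    · have := key r Side.full (by simp [hr]) (by simp)
      rw [len_of_halfAt (halfAt_of_not_dvd hr), len_of_halfAt (halfAt_of_not_dvd hr)] at this
      simp [lhdLen, nablaLen, halfAt_of_not_dvd hr, twist, this]
  have hi : ∀ r, C.inner g r = C'.inner g r := fun r => by
    rw [← min_len, ← min_len, (key2 r).1, (key2 r).2]
  have ho : ∀ r, C.outer g r = C'.outer g r := fun r => by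
    rw [← max_len, ← max_len, (key2 r).1, (key2 r).2]
  ext r
  · rw [mem_full_iff hg, mem_full_iff hg, hi, ho]
  · have h1 := lhdLen_sub_nablaLen (C := C) (g := g) ((r + 1) * g)
    have h2 := lhdLen_sub_nablaLen (C := C') (g := g) ((r + 1) * g)
    rw [(key2 _).1, (key2 _).2, h2, hi] at h1
    have := congrArg (twist (C'.inner g ((r + 1) * g))) h1
    rw [twist_twist, twist_twist, halfAt_succ_mul hg, halfAt_succ_mul hg] at this
    exact this.symm

end Config

/-- The length of the row of half-blocks or blocks of shape `s` in the row `r`. -/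
noncomputable def YoungWall.rowLen {n : ℕ} (Y : YoungWall n) (r : ℕ) (s : Side) : ℕ :=
  sInf {c | (⟨c, r, s⟩ : Block) ∉ Y.carrier}

/-- A row is closed to the left, and finiteness of the white part bounds it, so it is an initial
segment. The grey row is infinite and has to be left out. -/
theorem YoungWall.mem_iff_rowLen {n : ℕ} (Y : YoungWall n) {r : ℕ} {s : Side}
    (hs : s = Side.full ↔ ¬ (n - 2) ∣ r) (h0 : ¬ (r = 0 ∧ s = Side.lhd)) (c : ℕ) :
    (⟨c, r, s⟩ : Block) ∈ Y.carrier ↔ c < Y.rowLen r s := by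
  have hne : {c | (⟨c, r, s⟩ : Block) ∉ Y.carrier}.Nonempty := by
    by_contra hcon
    rw [Set.not_nonempty_iff_eq_empty, Set.eq_empty_iff_forall_notMem] at hcon
    simp only [Set.mem_ofPred_eq, not_not] at hcon
    have hinf : (Set.range fun c : ℕ => (⟨c, r, s⟩ : Block)).Infinite :=
      Set.infinite_range_of_injective fun a b h => by simpa using h
    refine hinf (Y.finite_white.subset ?_)
    rintro _ ⟨c, rfl⟩
    exact ⟨hcon c, h0⟩
  constructor
  · intro h
    by_contra hc
    have h1 : ∀ d c, c + d ∈ {c | (⟨c, r, s⟩ : Block) ∈ Y.carrier} → (⟨c, r, s⟩ : Block) ∈ Y.carrier := by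
      intro d
      induction d with
      | zero => intro c h; exact h
      | succ d ih =>
        intro c h
        exact ih c (Y.left_mem _ h ⟨c + d, r, s⟩ hs rfl rfl rfl)
    push Not at hc
    refine Nat.sInf_mem hne (h1 (c - Y.rowLen r s) _ ?_)
    have : sInf {c | (⟨c, r, s⟩ : Block) ∉ Y.carrier} + (c - Y.rowLen r s) = c := by
      change Y.rowLen r s + _ = c
      omega
    simpa [this] using h
  · intro h
    simpa using Nat.notMem_of_lt_sInf h

namespace Config

theorem toWall_surjective (g : ℕ) (hg : 0 < g) : Function.Surjective (toWall g hg) := by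
  classical
  intro Y
  -- The shape to be read in row `r`. In rows of full blocks, and in row `0` where only `nabla` is
  -- white, both choices of `x` read the same row, so that `a r = b r` there.
  let sd (x : Side) (r : ℕ) : Side := if g ∣ r then (if r = 0 then Side.nabla else x) else Side.full
  let a (r : ℕ) := Y.rowLen r (sd Side.lhd r)
  let b (r : ℕ) := Y.rowLen r (sd Side.nabla r)
  have mema : ∀ c r, (⟨c, r, sd Side.lhd r⟩ : Block) ∈ Y.carrier ↔ c < a r := fun c r =>
    Y.mem_iff_rowLen (by simp only [sd, Nat.add_sub_cancel]; split_ifs <;> simp_all)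
      (by simp only [sd]; split_ifs <;> simp_all) c
  have memb : ∀ c r, (⟨c, r, sd Side.nabla r⟩ : Block) ∈ Y.carrier ↔ c < b r := fun c r =>
    Y.mem_iff_rowLen (by simp only [sd, Nat.add_sub_cancel]; split_ifs <;> simp_all)
      (by simp only [sd]; split_ifs <;> simp_all) c
  have isb : ∀ c r x, x ≠ Side.full → IsBlock (g + 2) ⟨c, r, sd x r⟩ := by
    intro c r x hx
    simp only [isBlock_iff, sd]
    split_ifs <;> simp_all
  have mem_all : ∀ c r s, IsBlock (g + 2) ⟨c, r, s⟩ → ((⟨c, r, s⟩ : Block) ∈ Y.carrier ↔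
      (r = 0 ∧ s = Side.lhd) ∨ c < (if s = Side.nabla then b r else a r)) := by
    intro c r s hs
    by_cases h0 : r = 0 ∧ s = Side.lhd
    · simp only [h0, true_or, iff_true, and_self]
      exact Y.grey_mem _ (by rw [← h0.1, ← h0.2]; exact hs) ⟨rfl, rfl⟩
    · simp only [h0, false_or]
      rw [isBlock_iff] at hs
      cases s with
      | full =>
        have : ¬ g ∣ r := by simpa using hs
        have := mema c r
        simp_all [sd]
      | lhd =>
        have h1 : g ∣ r := by simpa using hs
        have h2 : r ≠ 0 := by simpa using h0
        have := mema c r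
        simp_all [sd]
      | nabla =>
        have h1 : g ∣ r := by simpa using hs
        have := memb c r
        simp_all [sd]
  have hab : ∀ r, ¬ g ∣ r ∨ r = 0 → a r = b r := by
    intro r hr
    have : sd Side.lhd r = sd Side.nabla r := by
      simp only [sd]; rcases hr with h | h <;> simp [h]
    simp only [a, b, this]
  let m (r : ℕ) := min (a r) (b r)
  let M (r : ℕ) := max (a r) (b r)
  have hMm : ∀ r, M (r + 1) ≤ m r := by
    intro r
    by_contra hcon
    push Not at hcon
    obtain ⟨x, hx, hx2⟩ : ∃ x, x ≠ Side.full ∧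
        (⟨m r, r + 1, sd x (r + 1)⟩ : Block) ∈ Y.carrier := by
      rcases lt_max_iff.1 hcon with h | h
      · exact ⟨Side.lhd, by simp, (mema _ _).2 h⟩
      · exact ⟨Side.nabla, by simp, (memb _ _).2 h⟩
    have h1 := (mema _ _).1 (Y.below_mem _ hx2 ⟨m r, r, sd Side.lhd r⟩ (isb _ _ _ (by simp)) rfl rfl)
    have h2 := (memb _ _).1 (Y.below_mem _ hx2 ⟨m r, r, sd Side.nabla r⟩ (isb _ _ _ (by simp)) rfl rfl)
    exact lt_irrefl _ (lt_min h1 h2)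
  have hmono : ∀ r s, r < s → M s ≤ m r := by
    intro r s h
    induction s, h using Nat.le_induction with
    | base => exact hMm r
    | succ s _ ih => exact ((hMm s).trans (by simp only [m, M]; omega)).trans ih
  have htop : ∀ c r, M (r + 1) ≤ c → c < m r → IsFullTop (g + 2) Y.carrier c r := by
    intro c r h1 h2
    constructor
    · rintro ⟨c', r', s⟩ hb rfl rfl
      rw [mem_all _ _ _ hb]
      right
      split_ifs <;> simp only [m] at h2 ⊢ <;> omega
    · rintro ⟨c', r', s⟩ hb rfl
      by_contra hr
      simp only [not_le] at hr
      rw [mem_all _ _ _ (Y.isBlock _ hb)] at hb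
      rcases hb with h | h
      · omega
      · have h3 : M r' ≤ M (r + 1) := by
          rcases (Nat.succ_le_of_lt hr).eq_or_lt with h6 | h6
          · exact le_of_eq (congrArg M h6.symm)
          · exact (hmono (r + 1) r' h6).trans (by simp only [m, M]; omega)
        have h4 : c' < M r' := by split_ifs at h <;> simp only [M] <;> omega
        exact absurd (h4.trans_le (h3.trans h1)) (lt_irrefl _)
  -- Otherwise two neighbouring columns would be full with the same top row `r`, contrary to
  -- properness.
  have hmM : ∀ r, m r ≤ M (r + 1) + 1 := by
    intro r
    by_contra hcon
    have := Y.proper (M (r + 1)) (M (r + 1) + 1) r (htop _ _ le_rfl (by omega))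
      (htop _ _ (by omega) (by omega))
    omega
  obtain ⟨R, hR⟩ : ∃ R, ∀ r, R ≤ r → M r = 0 := by
    have hfin : {r | 0 < M r}.Finite := by
      refine ((Y.finite_white.image Block.row).insert 0).subset ?_
      intro r hr
      by_cases h0 : r = 0
      · exact Or.inl h0
      right
      rcases lt_max_iff.1 (show 0 < max (a r) (b r) from hr) with h | h
      · exact ⟨⟨0, r, _⟩, ⟨(mema _ _).2 h, fun h => h0 h.1⟩, rfl⟩
      · exact ⟨⟨0, r, _⟩, ⟨(memb _ _).2 h, fun h => h0 h.1⟩, rfl⟩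
    obtain ⟨R, hR⟩ := hfin.bddAbove
    refine ⟨R + 1, fun r hr => ?_⟩
    by_contra h0
    have := hR (Nat.pos_of_ne_zero h0)
    omega
  let C : Config := ⟨(Finset.range R).filter fun r => M (r + 1) < m r,
    Finsupp.onFinset (Finset.range R)
      (fun i => twist (m ((i + 1) * g)) ((a ((i + 1) * g) : ℤ) - b ((i + 1) * g))) (by
        intro i hi
        rw [Finset.mem_range]
        by_contra hcon
        apply hi
        have h1 := hR ((i + 1) * g) (by nlinarith)
        simp only [M] at h1
        have h2 : a ((i + 1) * g) = 0 := by omega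
        have h3 : b ((i + 1) * g) = 0 := by omega
        simp [h2, h3, twist])⟩
  have hhalf : ∀ r, C.halfAt g r = twist (m r) ((a r : ℤ) - b r) := by
    intro r
    by_cases hr : g ∣ r ∧ r ≠ 0
    · obtain ⟨⟨i, rfl⟩, h0⟩ := hr
      obtain ⟨i, rfl⟩ : ∃ j, i = j + 1 := ⟨i - 1, by
        rcases i with _ | i
        · simp at h0
        · simp⟩
      rw [mul_comm, halfAt_succ_mul hg]
      simp [C]
    · rw [halfAt, if_neg hr, hab r (by tauto)]
      simp [twist]
  have hnat : ∀ r, m r + (C.halfAt g r).natAbs = M r := by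
    intro r
    rw [hhalf, twist_natAbs]
    simp only [m, M]
    omega
  have hfull : ∀ r, m r = (if r ∈ C.full then 1 else 0) + M (r + 1) := by
    intro r
    have h1 := hmM r
    have h2 := hMm r
    have h3 : r ∈ C.full ↔ r < R ∧ M (r + 1) < m r := by simp [C]
    split_ifs with h
    · have := (h3.1 h).2
      omega
    · rw [h3] at h
      by_cases hr : r < R
      · have : ¬ M (r + 1) < m r := fun h4 => h ⟨hr, h4⟩
        omega
      · have := hR r (by omega)
        simp only [M, m] at this h1 h2 ⊢
        omega
  have hinner : ∀ r, C.inner g r = m r := by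
    obtain ⟨R', hF', hR'⟩ := exists_bound g C
    -- Downward induction on the row, starting above both bounds where everything is empty: both
    -- sides satisfy the recursion of `inner_eq`.
    have : ∀ d r, R + R' ≤ r + d → C.inner g r = m r := by
      intro d
      induction d with
      | zero =>
        intro r hr
        rw [inner_eq_zero hF' hR' (by omega)]
        have := hR r (by omega)
        simp only [M, m] at this ⊢
        omega
      | succ d ih =>
        intro r hr
        rw [inner_eq hg, hfull, outer, ih (r + 1) (by omega), hnat]
    exact fun r => this (R + R') r (by omega)
  refine ⟨C, ?_⟩
  ext ⟨c, r, s⟩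
  by_cases hs : IsBlock (g + 2) ⟨c, r, s⟩
  · rw [mem_all _ _ _ hs, mem_toWall]
    simp only [hs, true_and, IsGrey]
    have ha : C.lhdLen g r = a r := by
      simp only [lhdLen, hinner, hhalf, twist_twist, m]; omega
    have hb : C.nablaLen g r = b r := by
      simp only [nablaLen, hinner, hhalf, twist_twist, m]; omega
    cases s <;> simp [len, ha, hb]
  · exact ⟨fun h => absurd h.1 hs, fun h => absurd (Y.isBlock _ h) hs⟩

/-- Bead configurations and Young walls are in bijection. -/
noncomputable def equivWall (g : ℕ) (hg : 0 < g) : Config ≃ YoungWall (g + 2) :=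
  Equiv.ofBijective (toWall g hg) ⟨toWall_injective g hg, toWall_surjective g hg⟩

end Config
end TypeD

/-! ### Counting the blocks of each label. -/

namespace TypeD

namespace Config

variable {g : ℕ} {C : Config}

open Classical in
/-- The number of white blocks in the row `r` which satisfy `p`. -/
noncomputable def rowCount (g : ℕ) (C : Config) (p : Block → Prop) (r : ℕ) : ℕ :=
  if g ∣ r then
    (if r = 0 then 0 else ((Finset.range (C.lhdLen g r)).filter fun c => p ⟨c, r, Side.lhd⟩).card) +
      ((Finset.range (C.nablaLen g r)).filter fun c => p ⟨c, r, Side.nabla⟩).card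
  else ((Finset.range (C.inner g r)).filter fun c => p ⟨c, r, Side.full⟩).card

theorem ncard_side (p : Block → Prop) [DecidablePred p] (r L : ℕ) (s : Side) :
    {b : Block | b.row = r ∧ b.side = s ∧ b.col < L ∧ p b}.Finite ∧
    Set.ncard {b : Block | b.row = r ∧ b.side = s ∧ b.col < L ∧ p b} =
      ((Finset.range L).filter fun c => p ⟨c, r, s⟩).card := by
  have h : {b : Block | b.row = r ∧ b.side = s ∧ b.col < L ∧ p b} =
      (fun c => (⟨c, r, s⟩ : Block)) '' ↑((Finset.range L).filter fun c => p ⟨c, r, s⟩) := by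
    ext ⟨c, r', s'⟩
    simp only [Set.mem_ofPred_eq, Set.mem_image, Finset.coe_filter, Finset.mem_range,
      Block.mk.injEq]
    constructor
    · rintro ⟨rfl, rfl, h1, h2⟩
      exact ⟨c, ⟨h1, h2⟩, rfl, rfl, rfl⟩
    · rintro ⟨c', ⟨h1, h2⟩, rfl, rfl, rfl⟩
      exact ⟨rfl, rfl, h1, h2⟩
  rw [h]
  refine ⟨(Finset.finite_toSet _).image _, ?_⟩
  rw [Set.ncard_image_of_injective _ fun a b h => by simpa using h, Set.ncard_coe_finset]

theorem ncard_row (hg : 0 < g) (p : Block → Prop) (r : ℕ) :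
    {b ∈ (C.toWall g hg).carrier | (¬ IsGrey b ∧ p b) ∧ b.row = r}.Finite ∧
    Set.ncard {b ∈ (C.toWall g hg).carrier | (¬ IsGrey b ∧ p b) ∧ b.row = r} =
      C.rowCount g p r := by
  classical
  unfold rowCount
  by_cases hr : g ∣ r
  · rw [if_pos hr]
    have h2 := ncard_side p r (C.nablaLen g r) Side.nabla
    by_cases h0 : r = 0
    · have : {b ∈ (C.toWall g hg).carrier | (¬ IsGrey b ∧ p b) ∧ b.row = r} =
        {b : Block | b.row = r ∧ b.side = Side.nabla ∧ b.col < C.nablaLen g r ∧ p b} := by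
        ext ⟨c, r', s⟩
        simp only [Set.mem_ofPred_eq, mem_toWall, isBlock_iff, IsGrey]
        constructor
        · rintro ⟨⟨h1, h2⟩, ⟨h3, h4⟩, rfl⟩
          cases s <;> simp_all [len]
        · rintro ⟨rfl, rfl, h1, h2⟩
          simp_all [len]
      rw [this, if_pos h0, zero_add]
      exact h2
    · have h1 := ncard_side p r (C.lhdLen g r) Side.lhd
      have : {b ∈ (C.toWall g hg).carrier | (¬ IsGrey b ∧ p b) ∧ b.row = r} =
        {b : Block | b.row = r ∧ b.side = Side.lhd ∧ b.col < C.lhdLen g r ∧ p b} ∪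
        {b : Block | b.row = r ∧ b.side = Side.nabla ∧ b.col < C.nablaLen g r ∧ p b} := by
        ext ⟨c, r', s⟩
        simp only [Set.mem_ofPred_eq, Set.mem_union, mem_toWall, isBlock_iff, IsGrey]
        constructor
        · rintro ⟨⟨h1, h2⟩, ⟨h3, h4⟩, rfl⟩
          cases s <;> simp_all [len]
        · rintro (⟨rfl, rfl, h1, h2⟩ | ⟨rfl, rfl, h1, h2⟩) <;> simp_all [len]
      rw [this, if_neg h0, Set.ncard_union_eq _ h1.1 h2.1, h1.2, h2.2]
      · exact ⟨h1.1.union h2.1, rfl⟩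
      · rw [Set.disjoint_left]
        rintro b hb hb'
        exact absurd (hb.2.1.symm.trans hb'.2.1) (by simp)
  · rw [if_neg hr]
    have : {b ∈ (C.toWall g hg).carrier | (¬ IsGrey b ∧ p b) ∧ b.row = r} =
      {b : Block | b.row = r ∧ b.side = Side.full ∧ b.col < C.inner g r ∧ p b} := by
      ext ⟨c, r', s⟩
      simp only [Set.mem_ofPred_eq, mem_toWall, isBlock_iff, IsGrey]
      constructor
      · rintro ⟨⟨h1, h2⟩, ⟨h3, h4⟩, rfl⟩
        have h5 : s = Side.full := h1.2 hr
        subst h5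
        have := len_of_halfAt (halfAt_of_not_dvd (C := C) hr) Side.full
        simp_all
      · rintro ⟨rfl, rfl, h1, h2⟩
        have := len_of_halfAt (halfAt_of_not_dvd (C := C) hr) Side.full
        simp_all
    rw [this]
    exact ncard_side p r _ _

theorem ncard_blocks (hg : 0 < g) (p : Block → Prop) {R : ℕ}
    (hR : ∀ r, R ≤ r → C.outer g r = 0) :
    Set.ncard {b ∈ (C.toWall g hg).carrier | ¬ IsGrey b ∧ p b} =
      ∑ r ∈ Finset.range R, C.rowCount g p r := by
  have key : ∀ S : ℕ,
      {b ∈ (C.toWall g hg).carrier | (¬ IsGrey b ∧ p b) ∧ b.row < S}.Finite ∧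
      Set.ncard {b ∈ (C.toWall g hg).carrier | (¬ IsGrey b ∧ p b) ∧ b.row < S} =
      ∑ r ∈ Finset.range S, C.rowCount g p r := by
    intro S
    induction S with
    | zero => simp
    | succ S ih =>
      have h1 := ncard_row (C := C) hg p S
      have : {b ∈ (C.toWall g hg).carrier | (¬ IsGrey b ∧ p b) ∧ b.row < S + 1} =
        {b ∈ (C.toWall g hg).carrier | (¬ IsGrey b ∧ p b) ∧ b.row < S} ∪
        {b ∈ (C.toWall g hg).carrier | (¬ IsGrey b ∧ p b) ∧ b.row = S} := by
        ext b
        simp only [Set.mem_ofPred_eq, Set.mem_union, Nat.lt_succ_iff_lt_or_eq]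
        tauto
      rw [this, Set.ncard_union_eq _ ih.1 h1.1, ih.2, h1.2, Finset.sum_range_succ]
      · exact ⟨ih.1.union h1.1, rfl⟩
      · rw [Set.disjoint_left]
        rintro b ⟨_, _, h⟩ ⟨_, _, h'⟩
        omega
  rw [← (key R).2]
  congr 1
  ext ⟨c, r, s⟩
  simp only [Set.mem_ofPred_eq]
  constructor
  · rintro ⟨h1, h2⟩
    refine ⟨h1, h2, ?_⟩
    by_contra hr
    have h3 := hR r (by omega)
    have h4 : c < C.len g r s := h1.2.resolve_left h2.1
    have h5 := (len_bounds (C := C) (g := g) r s).2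
    omega
  · rintro ⟨h1, h2, _⟩
    exact ⟨h1, h2⟩

/-- A bound for the rows that are not empty. -/
theorem exists_rowBound (g : ℕ) (C : Config) : ∃ R, (∀ x ∈ C.full, x < R) ∧
    (∀ i ∈ C.half.support, (i + 1) * g < R) ∧ ∀ r, R ≤ r → C.outer g r = 0 := by
  obtain ⟨R, hF, hR⟩ := exists_bound g C
  refine ⟨R, hF, hR, fun r hr => ?_⟩
  rw [outer, inner_eq_zero hF hR hr, halfAt_eq_zero hR hr]
  rfl

/-- Double counting by columns. A full bead at `x` fills the rows up to and including `x`, whence `x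
+ 1`; a column ending in the half-row `(i + 1) * g` fills only the rows strictly below it. -/
theorem sum_inner (P : ℕ → Prop) [DecidablePred P] {R : ℕ} (hF : ∀ x ∈ C.full, x < R)
    (hR : ∀ i ∈ C.half.support, (i + 1) * g < R) :
    ∑ r ∈ Finset.range R, (if P r then C.inner g r else 0) =
      ∑ x ∈ C.full, Nat.count P (x + 1) +
        C.half.sum fun i h => h.natAbs * Nat.count P ((i + 1) * g) := by
  have h1 : ∀ r, (if P r then C.inner g r else 0) =
      ∑ x ∈ C.full, (if P r ∧ r < x + 1 then 1 else 0) +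
      ∑ i ∈ C.half.support, (C.half i).natAbs * (if P r ∧ r < (i + 1) * g then 1 else 0) := by
    intro r
    by_cases hP : P r
    · simp only [hP, if_true, true_and, inner, Finsupp.sum, Finset.card_filter,
        Nat.lt_succ_iff, mul_ite, mul_one, mul_zero]
    · simp [hP]
  have h2 : ∀ N, N ≤ R → ∑ r ∈ Finset.range R, (if P r ∧ r < N then 1 else 0) = Nat.count P N := by
    intro N hN
    rw [Nat.count_eq_card_filter_range, Finset.card_filter, ← Finset.sum_subset
      (Finset.range_subset_range.2 hN)]
    · apply Finset.sum_congr rfl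
      intro r hr
      simp [Finset.mem_range.1 hr]
    · intro r _ hr
      rw [if_neg]
      intro h
      exact hr (Finset.mem_range.2 h.2)
  simp only [h1, Finset.sum_add_distrib]
  rw [Finset.sum_comm, Finset.sum_comm (s := Finset.range R), Finsupp.sum]
  congr 1
  · apply Finset.sum_congr rfl
    intro x hx
    exact h2 _ (hF x hx)
  · apply Finset.sum_congr rfl
    intro i hi
    rw [← Finset.mul_sum, h2 _ (hR i hi).le]

theorem sum_halfAt {A : Type*} [AddCommMonoid A] (hg : 0 < g) (f : ℕ → ℤ → A)
    (hf : ∀ r, f r 0 = 0) {R : ℕ} (hR : ∀ i ∈ C.half.support, (i + 1) * g < R) :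
    ∑ r ∈ Finset.range R, f r (C.halfAt g r) = C.half.sum fun i h => f ((i + 1) * g) h := by
  rw [Finsupp.sum]
  symm
  apply Finset.sum_of_injOn (fun i => (i + 1) * g)
  · intro a _ b _ h
    have := Nat.eq_of_mul_eq_mul_right hg h
    omega
  · intro i hi
    simpa using hR i hi
  · intro r _ hr
    by_cases h0 : C.halfAt g r = 0
    · rw [h0, hf]
    · exfalso
      apply hr
      have h1 : g ∣ r ∧ r ≠ 0 := by
        by_contra h; exact h0 (if_neg h)
      obtain ⟨⟨k, rfl⟩, h2⟩ := h1
      rcases k with _ | k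
      · simp at h2
      refine ⟨k, ?_, mul_comm _ _⟩
      rw [mul_comm, halfAt_succ_mul hg] at h0
      simpa using h0
  · intro i _
    rw [halfAt_succ_mul hg]

theorem inner_zero (hg : 0 < g) : C.inner g 0 = C.full.card + C.half.sum fun _ h => h.natAbs := by
  unfold inner
  simp [hg]

/-- The label sign of the topmost excess block. -/
def _root_.TypeD.oddSign (h : ℤ) : ℤ := if h % 2 = 0 then 0 else h.sign

/-- Labels alternate along a half-row and the two orientations start with opposite labels. So this
difference of parities is what the row contributes to the difference of two label counts. -/
theorem len_parity (r : ℕ) : ((C.lhdLen g r % 2 : ℕ) : ℤ) - ((C.nablaLen g r % 2 : ℕ) : ℤ) =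
    oddSign (C.halfAt g r) := by
  simp only [lhdLen, nablaLen, oddSign, twist]
  generalize C.inner g r = k
  generalize C.halfAt g r = h
  rcases lt_trichotomy h 0 with h0 | h0 | h0
  · rw [Int.sign_eq_neg_one_of_neg h0]
    split_ifs <;> omega
  · subst h0; simp
  · rw [Int.sign_eq_one_of_pos h0]
    split_ifs <;> omega

end Config

theorem card_filter_even (L : ℕ) : ((Finset.range L).filter fun c => c % 2 = 0).card = (L + 1) / 2 := by
  induction L with
  | zero => simp
  | succ L ih =>
    rw [Finset.range_add_one, Finset.filter_insert]
    split_ifs with h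
    · rw [Finset.card_insert_of_notMem (by simp), ih]; omega
    · rw [ih]; omega

theorem card_filter_odd (L : ℕ) : ((Finset.range L).filter fun c => ¬ c % 2 = 0).card = L / 2 := by
  have := Finset.card_filter_add_card_filter_not (s := Finset.range L) (fun c => c % 2 = 0)
  rw [card_filter_even, Finset.card_range] at this
  omega

theorem count_mod_eq {m v : ℕ} (hv : v < m) (N : ℕ) :
    Nat.count (fun r => r % m = v) N = N / m + if v < N % m then 1 else 0 := by
  have h := Nat.count_modEq_card (r := m) N (Nat.zero_lt_of_lt hv) v
  rw [Nat.mod_eq_of_lt hv] at h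
  rw [← h]
  congr 1
  ext r
  rw [Nat.ModEq, Nat.mod_eq_of_lt hv]
theorem count_mod_eq_succ {m v : ℕ} (hv : v < m) (N : ℕ) :
    Nat.count (fun r => r % m = v) (N + 1) = N / m + if v ≤ N % m then 1 else 0 := by
  rw [Nat.count_succ, count_mod_eq hv]
  split_ifs <;> omega

theorem count_mod_eq_mul {g v : ℕ} (hv : v < 2 * g) (k : ℕ) :
    Nat.count (fun r => r % (2 * g) = v) (k * g) = k / 2 + if v < g then k % 2 else 0 := by
  have hg : 0 < g := by omega
  rw [count_mod_eq hv, Nat.mul_div_mul_right _ _ hg, Nat.mul_mod_mul_right]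
  rcases Nat.mod_two_eq_zero_or_one k with h | h <;> simp [h]

theorem dvd_iff_mod_two_mul {g : ℕ} (hg : 0 < g) (r : ℕ) :
    g ∣ r ↔ r % (2 * g) = 0 ∨ r % (2 * g) = g := by
  rw [Nat.dvd_iff_mod_eq_zero, ← Nat.mod_mod_of_dvd r (Dvd.intro_left 2 rfl : g ∣ 2 * g)]
  have := Nat.mod_lt r (show 0 < 2 * g by omega)
  generalize r % (2 * g) = y at *
  constructor
  · intro h
    obtain ⟨k, rfl⟩ := Nat.dvd_of_mod_eq_zero h
    have : k < 2 := by
      by_contra hk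
      push Not at hk
      nlinarith
    interval_cases k <;> simp
  · rintro (rfl | rfl) <;> simp

namespace Config

variable {g : ℕ} {C : Config}

theorem rowCount_full (hg : 2 ≤ g) {j : ℕ} (hj : 2 ≤ j) (hj' : j ≤ g) (r : ℕ) :
    C.rowCount g (fun b => label (g + 2) b = j) r =
      (if r % (2 * g) = j - 1 then C.inner g r else 0) +
        if r % (2 * g) = 2 * g + 1 - j then C.inner g r else 0 := by
  classical
  have hlt := Nat.mod_lt r (show 0 < 2 * g by omega)
  unfold rowCount
  by_cases hr : g ∣ r
  · rw [if_pos hr]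
    have h0 := (dvd_iff_mod_two_mul (by omega) r).1 hr
    have h1 : ∀ c, ¬ label (g + 2) ⟨c, r, Side.lhd⟩ = j := by
      intro c
      simp only [label, Nat.add_sub_cancel]
      split_ifs <;> omega
    have h2 : ∀ c, ¬ label (g + 2) ⟨c, r, Side.nabla⟩ = j := by
      intro c
      simp only [label, Nat.add_sub_cancel]
      split_ifs <;> omega
    simp only [h1, h2]
    rw [if_neg (by omega : ¬ r % (2 * g) = j - 1), if_neg (by omega : ¬ r % (2 * g) = 2 * g + 1 - j)]
    simp
  · rw [if_neg hr]
    have h0 := mt (dvd_iff_mod_two_mul (by omega) r).2 hr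
    have h1 : ∀ c, label (g + 2) ⟨c, r, Side.full⟩ = j ↔
        r % (2 * g) = j - 1 ∨ r % (2 * g) = 2 * g + 1 - j := by
      intro c
      simp only [label, Nat.add_sub_cancel]
      split_ifs <;> omega
    simp only [h1, Finset.filter_const]
    by_cases h2 : r % (2 * g) = j - 1
    · rw [if_pos (Or.inl h2), if_pos h2, if_neg (by omega)]
      simp
    · by_cases h3 : r % (2 * g) = 2 * g + 1 - j
      · rw [if_pos (Or.inr h3), if_neg h2, if_pos h3]
        simp
      · simp [h2, h3]

theorem rowCount_half (hg : 2 ≤ g) (j : ℕ) (x : ℕ) (hx : x = 0 ∧ (j = 0 ∨ j = 1) ∨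
      x = g ∧ (j = g + 1 ∨ j = g + 2)) (r : ℕ) :
    C.rowCount g (fun b => label (g + 2) b = j) r =
      if r % (2 * g) = x then
        if j = 0 ∨ j = g + 1 then
          (if r = 0 then 0 else C.lhdLen g r / 2) + (C.nablaLen g r + 1) / 2
        else (if r = 0 then 0 else (C.lhdLen g r + 1) / 2) + C.nablaLen g r / 2
      else 0 := by
  classical
  have hlt := Nat.mod_lt r (show 0 < 2 * g by omega)
  unfold rowCount
  by_cases hr : g ∣ r
  · rw [if_pos hr]
    have h0 := (dvd_iff_mod_two_mul (by omega) r).1 hr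
    by_cases h3 : r % (2 * g) = x
    · rw [if_pos h3]
      by_cases h4 : j = 0 ∨ j = g + 1
      · rw [if_pos h4]
        have h1 : ∀ c, label (g + 2) ⟨c, r, Side.lhd⟩ = j ↔ ¬ c % 2 = 0 := by
          intro c
          simp only [label, Nat.add_sub_cancel]
          split_ifs <;> omega
        have h2 : ∀ c, label (g + 2) ⟨c, r, Side.nabla⟩ = j ↔ c % 2 = 0 := by
          intro c
          simp only [label, Nat.add_sub_cancel]
          split_ifs <;> omega
        simp only [h1, h2, card_filter_even, card_filter_odd]
      · rw [if_neg h4]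
        have h1 : ∀ c, label (g + 2) ⟨c, r, Side.lhd⟩ = j ↔ c % 2 = 0 := by
          intro c
          simp only [label, Nat.add_sub_cancel]
          split_ifs <;> omega
        have h2 : ∀ c, label (g + 2) ⟨c, r, Side.nabla⟩ = j ↔ ¬ c % 2 = 0 := by
          intro c
          simp only [label, Nat.add_sub_cancel]
          split_ifs <;> omega
        simp only [h1, h2, card_filter_even, card_filter_odd]
    · rw [if_neg h3]
      have h1 : ∀ c, ¬ label (g + 2) ⟨c, r, Side.lhd⟩ = j := by
        intro c
        simp only [label, Nat.add_sub_cancel]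
        split_ifs <;> omega
      have h2 : ∀ c, ¬ label (g + 2) ⟨c, r, Side.nabla⟩ = j := by
        intro c
        simp only [label, Nat.add_sub_cancel]
        split_ifs <;> omega
      simp [h1, h2]
  · rw [if_neg hr]
    have h0 := mt (dvd_iff_mod_two_mul (by omega) r).2 hr
    rw [if_neg (by omega)]
    have h1 : ∀ c, ¬ label (g + 2) ⟨c, r, Side.full⟩ = j := by
      intro c
      simp only [label, Nat.add_sub_cancel]
      split_ifs <;> omega
    simp [h1]

/-- The number of blocks of a given label. -/
noncomputable def labelCount (g : ℕ) (hg : 0 < g) (C : Config) (j : ℕ) : ℕ :=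
  Set.ncard {b ∈ (C.toWall g hg).carrier | ¬ IsGrey b ∧ label (g + 2) b = j}

theorem wt_toWall {hg : 0 < g} (j : Fin (g + 2 + 1)) :
    wt (g + 2) (C.toWall g hg) j = C.labelCount g hg j := rfl

/-- The contribution of the half-rows to the sizes. -/
def halfSize (C : Config) : ℕ := C.half.sum fun i h => (i + 1) * h.natAbs

/-- Between two consecutive half-rows each label from `2` to `n - 2` is met exactly once. Hence the
excess in the half-row `i` contributes `i + 1` per column, whatever the label, which is `halfSize`.
-/
theorem labelCount_full (hg : 2 ≤ g) {j : ℕ} (hj : 2 ≤ j) (hj' : j ≤ g) :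
    C.labelCount g (by omega) j =
      ∑ x ∈ C.full, (2 * (x / (2 * g)) + (if j - 1 ≤ x % (2 * g) then 1 else 0) +
        if 2 * g + 1 - j ≤ x % (2 * g) then 1 else 0) + C.halfSize := by
  obtain ⟨R, hF, hR, h0⟩ := exists_rowBound g C
  rw [labelCount, ncard_blocks _ _ h0]
  simp only [rowCount_full hg hj hj', Finset.sum_add_distrib (s := Finset.range R)]
  rw [sum_inner _ hF hR, sum_inner _ hF hR, add_add_add_comm, ← Finset.sum_add_distrib,
    ← Finsupp.sum_add]
  congr 1
  · apply Finset.sum_congr rfl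
    intro x _
    rw [count_mod_eq_succ (by omega), count_mod_eq_succ (by omega)]
    omega
  · unfold halfSize
    apply Finsupp.sum_congr
    intro i _
    rw [count_mod_eq_mul (by omega), count_mod_eq_mul (by omega), if_pos (by omega),
      if_neg (by omega), ← mul_add, mul_comm]
    congr 1
    omega

theorem mul_mod_two_mul (hg : 0 < g) (k : ℕ) : (k * g % (2 * g) = 0 ↔ k % 2 = 0) ∧
    (k * g % (2 * g) = g ↔ k % 2 = 1) := by
  rw [Nat.mul_mod_mul_right]
  rcases Nat.mod_two_eq_zero_or_one k with h | h <;> simp [h] <;> omega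

theorem labelCount_zero_add_one (hg : 2 ≤ g) :
    C.labelCount g (by omega) 0 + C.labelCount g (by omega) 1 =
      ∑ x ∈ C.full, (2 * (x / (2 * g)) + 1) + C.halfSize := by
  obtain ⟨R, hF, hR, h0⟩ := exists_rowBound g C
  have hF' : ∀ x ∈ C.full, x < R + 1 := fun x hx => (hF x hx).trans (by omega)
  have hR' : ∀ i ∈ C.half.support, (i + 1) * g < R + 1 := fun i hi => (hR i hi).trans (by omega)
  have h0' : ∀ r, R + 1 ≤ r → C.outer g r = 0 := fun r hr => h0 r (by omega)
  -- Adding `inner g 0` restores the missing grey half-blocks, so that row `0` is counted like every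
  -- other row labelled `0/1`.
  have key : C.labelCount g (by omega) 0 + C.labelCount g (by omega) 1 + C.inner g 0 =
      2 * (∑ x ∈ C.full, (x / (2 * g) + 1) +
        C.half.sum fun i h => h.natAbs * ((i + 1) / 2 + (i + 1) % 2)) +
      C.half.sum fun i h => if (i + 1) % 2 = 0 then h.natAbs else 0 := by
    have e1 := sum_inner (C := C) (fun r => r % (2 * g) = 0) hF' hR'
    have e2 := sum_halfAt (C := C) (by omega : 0 < g)
      (fun r h => if r % (2 * g) = 0 then h.natAbs else 0) (by simp) hR'
    simp only [count_mod_eq_succ (show 0 < 2 * g by omega), zero_le, if_true,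
      count_mod_eq_mul (show 0 < 2 * g by omega), if_pos (show 0 < g by omega)] at e1
    simp only [(mul_mod_two_mul (show 0 < g by omega) _).1] at e2
    rw [← e1, ← e2, labelCount, labelCount, ncard_blocks _ _ h0', ncard_blocks _ _ h0']
    have e3 : C.inner g 0 = ∑ r ∈ Finset.range (R + 1), if r = 0 then C.inner g r else 0 := by
      simp
    rw [e3, Finset.mul_sum, ← Finset.sum_add_distrib, ← Finset.sum_add_distrib,
      ← Finset.sum_add_distrib]
    apply Finset.sum_congr rfl
    intro r _
    rw [rowCount_half hg 0 0 (by omega), rowCount_half hg 1 0 (by omega),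
      if_pos (by omega : 0 = 0 ∨ 0 = g + 1), if_neg (by omega : ¬ (1 = 0 ∨ 1 = g + 1))]
    by_cases hr : r % (2 * g) = 0
    · have h1 := min_len (C := C) (g := g) r
      have h2 := max_len (C := C) (g := g) r
      unfold outer at h2
      simp only [hr, if_true]
      by_cases hr0 : r = 0
      · subst hr0
        rw [halfAt_zero] at h2 ⊢
        simp only [if_true, Int.natAbs_zero] at h2 ⊢
        omega
      · simp only [hr0, if_false]
        omega
    · have : r ≠ 0 := by rintro rfl; simp at hr
      simp [hr, this]
  rw [inner_zero (by omega)] at key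
  have e4 : 2 * (∑ x ∈ C.full, (x / (2 * g) + 1)) =
      ∑ x ∈ C.full, (2 * (x / (2 * g)) + 1) + C.full.card := by
    rw [Finset.mul_sum, Finset.card_eq_sum_ones, ← Finset.sum_add_distrib]
    apply Finset.sum_congr rfl
    intro x _; ring
  have e5 : 2 * (C.half.sum fun i h => h.natAbs * ((i + 1) / 2 + (i + 1) % 2)) +
      (C.half.sum fun i h => if (i + 1) % 2 = 0 then h.natAbs else 0) =
      C.halfSize + C.half.sum fun _ h => h.natAbs := by
    unfold halfSize
    simp only [Finsupp.sum]
    rw [Finset.mul_sum, ← Finset.sum_add_distrib, ← Finset.sum_add_distrib]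
    apply Finset.sum_congr rfl
    intro i _
    generalize (C.half i).natAbs = y
    rcases Nat.even_or_odd' i with ⟨k, rfl | rfl⟩
    · rw [if_neg (by omega), show (2 * k + 1) / 2 = k by omega,
        show (2 * k + 1) % 2 = 1 by omega]
      ring
    · rw [if_pos (by omega), show (2 * k + 1 + 1) / 2 = k + 1 by omega,
        show (2 * k + 1 + 1) % 2 = 0 by omega]
      ring
  omega

theorem labelCount_last_add (hg : 2 ≤ g) :
    C.labelCount g (by omega) (g + 1) + C.labelCount g (by omega) (g + 2) =
      ∑ x ∈ C.full, (2 * (x / (2 * g)) + 2 * if g ≤ x % (2 * g) then 1 else 0) + C.halfSize := by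
  obtain ⟨R, hF, hR, h0⟩ := exists_rowBound g C
  have key : C.labelCount g (by omega) (g + 1) + C.labelCount g (by omega) (g + 2) =
      2 * (∑ x ∈ C.full, (x / (2 * g) + if g ≤ x % (2 * g) then 1 else 0) +
        C.half.sum fun i h => h.natAbs * ((i + 1) / 2)) +
      C.half.sum fun i h => if (i + 1) % 2 = 1 then h.natAbs else 0 := by
    have e1 := sum_inner (C := C) (fun r => r % (2 * g) = g) hF hR
    have e2 := sum_halfAt (C := C) (by omega : 0 < g)
      (fun r h => if r % (2 * g) = g then h.natAbs else 0) (by simp) hR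
    simp only [count_mod_eq_succ (show g < 2 * g by omega),
      count_mod_eq_mul (show g < 2 * g by omega), lt_irrefl, if_false, add_zero] at e1
    simp only [(mul_mod_two_mul (show 0 < g by omega) _).2] at e2
    rw [← e1, ← e2, labelCount, labelCount, ncard_blocks _ _ h0, ncard_blocks _ _ h0]
    rw [Finset.mul_sum, ← Finset.sum_add_distrib, ← Finset.sum_add_distrib]
    apply Finset.sum_congr rfl
    intro r _
    rw [rowCount_half hg (g + 1) g (by omega), rowCount_half hg (g + 2) g (by omega),
      if_pos (by omega : g + 1 = 0 ∨ g + 1 = g + 1), if_neg (by omega : ¬ (g + 2 = 0 ∨ g + 2 = g + 1))]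
    by_cases hr : r % (2 * g) = g
    · have h1 := min_len (C := C) (g := g) r
      have h2 := max_len (C := C) (g := g) r
      unfold outer at h2
      have hr0 : r ≠ 0 := by rintro rfl; simp at hr; omega
      simp only [hr, if_true, hr0, if_false]
      omega
    · simp [hr]
  have e4 : 2 * (∑ x ∈ C.full, (x / (2 * g) + if g ≤ x % (2 * g) then 1 else 0)) =
      ∑ x ∈ C.full, (2 * (x / (2 * g)) + 2 * if g ≤ x % (2 * g) then 1 else 0) := by
    rw [Finset.mul_sum]
    apply Finset.sum_congr rfl
    intro x _; ring
  have e5 : 2 * (C.half.sum fun i h => h.natAbs * ((i + 1) / 2)) +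
      (C.half.sum fun i h => if (i + 1) % 2 = 1 then h.natAbs else 0) = C.halfSize := by
    unfold halfSize
    simp only [Finsupp.sum]
    rw [Finset.mul_sum, ← Finset.sum_add_distrib]
    apply Finset.sum_congr rfl
    intro i _
    generalize (C.half i).natAbs = y
    rcases Nat.even_or_odd' i with ⟨k, rfl | rfl⟩
    · rw [if_pos (by omega), show (2 * k + 1) / 2 = k by omega]
      ring
    · rw [if_neg (by omega), show (2 * k + 1 + 1) / 2 = k + 1 by omega]
      ring
  omega

/-- The labels `0` and `1` occur in row `0` and in the rows `(i + 1) * g` with `i` odd. The latter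
contribute as in `len_parity`; row `0` has only `nabla` half-blocks among its white ones and
contributes the parity of its length. -/
theorem labelCount_zero_sub_one (hg : 2 ≤ g) :
    (C.labelCount g (by omega) 0 : ℤ) - C.labelCount g (by omega) 1 =
      ((C.inner g 0 % 2 : ℕ) : ℤ) - C.half.sum fun i h => if i % 2 = 1 then oddSign h else 0 := by
  obtain ⟨R, hF, hR, h0⟩ := exists_rowBound g C
  have hR' : ∀ i ∈ C.half.support, (i + 1) * g < R + 1 := fun i hi => (hR i hi).trans (by omega)
  have h0' : ∀ r, R + 1 ≤ r → C.outer g r = 0 := fun r hr => h0 r (by omega)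
  have e2 := sum_halfAt (C := C) (by omega : 0 < g)
    (fun r h => if r % (2 * g) = 0 then oddSign h else 0) (by simp [oddSign]) hR'
  simp only [(mul_mod_two_mul (show 0 < g by omega) _).1] at e2
  have e3 : ((C.inner g 0 % 2 : ℕ) : ℤ) =
      ∑ r ∈ Finset.range (R + 1), if r = 0 then ((C.inner g r % 2 : ℕ) : ℤ) else 0 := by
    simp
  have e4 : (C.half.sum fun i h => if i % 2 = 1 then oddSign h else 0) =
      C.half.sum fun i h => if (i + 1) % 2 = 0 then oddSign h else 0 := by
    apply Finsupp.sum_congr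
    intro i _
    have : i % 2 = 1 ↔ (i + 1) % 2 = 0 := by omega
    simp only [this]
  rw [e4, ← e2, e3, labelCount, labelCount, ncard_blocks _ _ h0', ncard_blocks _ _ h0']
  push_cast
  rw [← Finset.sum_sub_distrib, ← Finset.sum_sub_distrib]
  apply Finset.sum_congr rfl
  intro r _
  rw [rowCount_half hg 0 0 (by omega), rowCount_half hg 1 0 (by omega),
    if_pos (by omega : 0 = 0 ∨ 0 = g + 1), if_neg (by omega : ¬ (1 = 0 ∨ 1 = g + 1))]
  have hp := len_parity (C := C) (g := g) r
  by_cases hr : r % (2 * g) = 0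
  · simp only [hr, if_true]
    by_cases hr0 : r = 0
    · subst hr0
      have h1 := len_of_halfAt (halfAt_zero (C := C) (g := g)) Side.nabla
      simp only [len] at h1
      rw [halfAt_zero]
      simp only [if_true, h1, oddSign]
      omega
    · simp only [hr0, if_false]
      omega
  · have : r ≠ 0 := by rintro rfl; simp at hr
    simp [hr, this]

theorem labelCount_last_sub (hg : 2 ≤ g) :
    (C.labelCount g (by omega) (g + 2) : ℤ) - C.labelCount g (by omega) (g + 1) =
      C.half.sum fun i h => if i % 2 = 0 then oddSign h else 0 := by
  obtain ⟨R, hF, hR, h0⟩ := exists_rowBound g C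
  have e2 := sum_halfAt (C := C) (by omega : 0 < g)
    (fun r h => if r % (2 * g) = g then oddSign h else 0) (by simp [oddSign]) hR
  simp only [(mul_mod_two_mul (show 0 < g by omega) _).2] at e2
  have e4 : (C.half.sum fun i h => if i % 2 = 0 then oddSign h else 0) =
      C.half.sum fun i h => if (i + 1) % 2 = 1 then oddSign h else 0 := by
    apply Finsupp.sum_congr
    intro i _
    have : i % 2 = 0 ↔ (i + 1) % 2 = 1 := by omega
    simp only [this]
  rw [e4, ← e2, labelCount, labelCount, ncard_blocks _ _ h0, ncard_blocks _ _ h0]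
  push_cast
  rw [← Finset.sum_sub_distrib]
  apply Finset.sum_congr rfl
  intro r _
  rw [rowCount_half hg (g + 1) g (by omega), rowCount_half hg (g + 2) g (by omega),
    if_pos (by omega : g + 1 = 0 ∨ g + 1 = g + 1), if_neg (by omega : ¬ (g + 2 = 0 ∨ g + 2 = g + 1))]
  have hp := len_parity (C := C) (g := g) r
  by_cases hr : r % (2 * g) = g
  · have hr0 : r ≠ 0 := by rintro rfl; simp at hr; omega
    simp only [hr, if_true, hr0, if_false]
    omega
  · simp [hr]

end Config
end TypeD

/-! ### Maya diagrams: charge, energy and shift. -/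

namespace TypeD

/-- A pair of finite sets of natural numbers, thought of as the sets of particles and holes of a
Maya diagram. -/
abbrev MayaPair := Finset ℕ × Finset ℕ

namespace MayaPair

def charge (p : MayaPair) : ℤ := (p.1.card : ℤ) - p.2.card

/-- The particle `i` occupies the level `i`, while the hole `i` is an unoccupied level `-(i + 1)`.
-/
def energy (p : MayaPair) : ℕ := ∑ i ∈ p.1, i + ∑ i ∈ p.2, (i + 1)

def up (A : Finset ℕ) : Finset ℕ := A.map (addRightEmbedding 1)

noncomputable def down (A : Finset ℕ) : Finset ℕ := A.preimage Nat.succ (Nat.succ_injective.injOn)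

@[simp] theorem succ_mem_up {A : Finset ℕ} {i : ℕ} : i + 1 ∈ up A ↔ i ∈ A := by simp [up]

@[simp] theorem zero_notMem_up {A : Finset ℕ} : 0 ∉ up A := by simp [up]

@[simp] theorem mem_down {A : Finset ℕ} {i : ℕ} : i ∈ down A ↔ i + 1 ∈ A := by simp [down]

theorem ext_zero_succ {A B : Finset ℕ} (h0 : 0 ∈ A ↔ 0 ∈ B) (h : ∀ i, i + 1 ∈ A ↔ i + 1 ∈ B) :
    A = B := by
  ext i
  cases i
  · exact h0
  · exact h _

theorem up_down (A : Finset ℕ) : A = if 0 ∈ A then insert 0 (up (down A)) else up (down A) := by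
  apply ext_zero_succ <;> split_ifs with h <;> simp [h]

theorem sum_up (A : Finset ℕ) (f : ℕ → ℕ) : ∑ i ∈ up A, f i = ∑ i ∈ A, f (i + 1) := by
  simp [up]

theorem card_up (A : Finset ℕ) : (up A).card = A.card := by simp [up]

theorem sum_eq_down (A : Finset ℕ) (f : ℕ → ℕ) :
    ∑ i ∈ A, f i = (if 0 ∈ A then f 0 else 0) + ∑ i ∈ down A, f (i + 1) := by
  conv_lhs => rw [up_down A]
  split_ifs with h
  · rw [Finset.sum_insert (by simp), sum_up]
  · rw [sum_up, zero_add]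

theorem card_eq_down (A : Finset ℕ) : A.card = (if 0 ∈ A then 1 else 0) + (down A).card := by
  simp only [Finset.card_eq_sum_ones]
  exact sum_eq_down A fun _ => 1

/-- The shift of a Maya diagram. -/
noncomputable def shift : Equiv.Perm MayaPair where
  -- Level `-1` moves to level `0`, and it is occupied exactly when `0` is not a hole.
  toFun p := (if 0 ∈ p.2 then up p.1 else insert 0 (up p.1), down p.2)
  invFun p := (down p.1, if 0 ∈ p.1 then up p.2 else insert 0 (up p.2))
  left_inv p := by
    refine Prod.ext (ext_zero_succ ?_ fun i => ?_) (ext_zero_succ ?_ fun i => ?_) <;>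
    simp only [mem_down] <;> split_ifs <;> simp_all
  right_inv p := by
    refine Prod.ext (ext_zero_succ ?_ fun i => ?_) (ext_zero_succ ?_ fun i => ?_) <;>
    simp only [mem_down] <;> split_ifs <;> simp_all

theorem charge_shift (p : MayaPair) : charge (shift p) = charge p + 1 := by
  have h := card_eq_down p.2
  simp only [charge, shift, Equiv.coe_fn_mk]
  split_ifs at h ⊢ with h0
  · rw [card_up]; omega
  · rw [Finset.card_insert_of_notMem (by simp), card_up]; omega

/-- Each particle gains one unit and each hole loses one. The hole that reaches level `0` disappears
with energy `0`, and a new particle there costs nothing. -/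
theorem energy_shift (p : MayaPair) : (energy (shift p) : ℤ) = energy p + charge p := by
  have h := card_eq_down p.2
  have h2 := sum_eq_down p.2 (fun i => i + 1)
  have h3 : ∑ i ∈ down p.2, (i + 1 + 1) = ∑ i ∈ down p.2, (i + 1) + (down p.2).card := by
    rw [Finset.sum_add_distrib (f := fun i => i + 1), Finset.card_eq_sum_ones]
  have h4 : ∑ i ∈ p.1, (i + 1) = ∑ i ∈ p.1, i + p.1.card := by
    rw [Finset.sum_add_distrib, Finset.card_eq_sum_ones]
  have h5 : ∑ i ∈ (shift p).1, i = ∑ i ∈ p.1, (i + 1) := by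
    simp only [shift, Equiv.coe_fn_mk]
    split_ifs
    · rw [sum_up]
    · rw [Finset.sum_insert (by simp), sum_up, zero_add]
  have h6 : (shift p).2 = down p.2 := rfl
  unfold energy charge
  rw [h5, h6]
  split_ifs at h h2 <;> omega

theorem charge_zpow_shift (c : ℤ) (p : MayaPair) : charge ((shift ^ c) p) = charge p + c := by
  induction c using Int.induction_on with
  | zero => simp
  | succ i ih =>
    rw [add_comm, zpow_one_add, Equiv.Perm.mul_apply, charge_shift, ih]; ring
  | pred i ih =>
    have h := charge_shift ((shift ^ (-(i : ℤ) - 1)) p)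
    rw [← Equiv.Perm.mul_apply, ← zpow_one_add, show (1 : ℤ) + (-i - 1) = -i by ring, ih] at h
    linarith

theorem energy_zpow_shift (c : ℤ) (p : MayaPair) :
    2 * (energy ((shift ^ c) p) : ℤ) = 2 * energy p + 2 * c * charge p + c * (c - 1) := by
  induction c using Int.induction_on with
  | zero => simp
  | succ i ih =>
    rw [add_comm, zpow_one_add, Equiv.Perm.mul_apply, energy_shift, charge_zpow_shift, mul_add, ih]
    ring
  | pred i ih =>
    have h := energy_shift ((shift ^ (-(i : ℤ) - 1)) p)
    rw [← Equiv.Perm.mul_apply, ← zpow_one_add, show (1 : ℤ) + (-i - 1) = -i by ring,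
      charge_zpow_shift] at h
    rw [h] at ih
    linarith

/-- The Maya diagrams of charge `0`. -/
abbrev Neutral := {p : MayaPair // charge p = 0}

/-- A Maya diagram is given by its charge and by a neutral diagram. -/
noncomputable def equivCharge : MayaPair ≃ ℤ × Neutral where
  toFun p := (charge p, ⟨(shift ^ (-charge p)) p, by rw [charge_zpow_shift]; ring⟩)
  invFun x := (shift ^ x.1) x.2.1
  left_inv p := by
    simp only
    rw [← Equiv.Perm.mul_apply, ← zpow_add]
    simp
  right_inv x := by
    obtain ⟨c, x, hx⟩ := x
    have h : charge ((shift ^ c) x) = c := by rw [charge_zpow_shift, hx, zero_add]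
    refine Prod.ext h (Subtype.ext ?_)
    simp only [h]
    rw [← Equiv.Perm.mul_apply, ← zpow_add]
    simp

/-- The energy above that of the vacuum of the same charge. -/
noncomputable def excess (p : MayaPair) : ℕ := energy (equivCharge p).2.1

/-- Shifting a neutral diagram to charge `c` adds `c (c - 1) / 2`, the energy of the vacuum of that
charge. The factor two avoids the division. -/
theorem two_mul_energy (p : MayaPair) :
    2 * (energy p : ℤ) = 2 * excess p + charge p * (charge p - 1) := by
  have h := energy_zpow_shift (charge p) (equivCharge p).2.1
  have h2 : (shift ^ charge p) (equivCharge p).2.1 = p := equivCharge.symm_apply_apply p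
  rw [h2, (equivCharge p).2.2, mul_zero, add_zero] at h
  exact h

theorem zpow_shift_empty (c : ℤ) :
    (shift ^ c) ((∅, ∅) : MayaPair) = (Finset.range c.toNat, Finset.range (-c).toNat) := by
  have key : ∀ c : ℤ, shift (Finset.range c.toNat, Finset.range (-c).toNat) =
      (Finset.range (c + 1).toNat, Finset.range (-(c + 1)).toNat) := by
    intro c
    refine Prod.ext (ext_zero_succ ?_ fun i => ?_) (ext_zero_succ ?_ fun i => ?_) <;>
    simp only [shift, Equiv.coe_fn_mk, mem_down, Finset.mem_range] <;> (try split_ifs) <;>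
    simp <;> omega
  induction c using Int.induction_on with
  | zero => simp
  | succ i ih =>
    rw [add_comm, zpow_one_add, Equiv.Perm.mul_apply, ih, key, add_comm]
  | pred i ih =>
    apply shift.injective
    rw [← Equiv.Perm.mul_apply, ← zpow_one_add, show (1 : ℤ) + (-i - 1) = -i by ring, ih, key]
    norm_num

theorem eq_empty_of_energy_eq_zero {p : MayaPair} (hc : charge p = 0) (h : energy p = 0) :
    p = (∅, ∅) := by
  have h2 : p.2 = ∅ := by
    by_contra hne
    obtain ⟨i, hi⟩ := Finset.nonempty_iff_ne_empty.2 hne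
    have := Finset.single_le_sum (f := fun i => i + 1) (fun _ _ => Nat.zero_le _) hi
    unfold energy at h
    omega
  have h1 : p.1 = ∅ := by
    rw [charge, h2] at hc
    simpa using hc
  exact Prod.ext h1 h2

theorem eq_of_excess_eq_zero {p : MayaPair} (h : excess p = 0) :
    p = (Finset.range (charge p).toNat, Finset.range (-charge p).toNat) := by
  have h1 := eq_empty_of_energy_eq_zero (equivCharge p).2.2 h
  have h2 : (shift ^ charge p) (equivCharge p).2.1 = p := equivCharge.symm_apply_apply p
  rw [h1, zpow_shift_empty] at h2
  exact h2.symm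

theorem eq_range_of_initial {A : Finset ℕ} (h : ∀ i, i + 1 ∈ A → i ∈ A) :
    A = Finset.range A.card := by
  have h1 : ∀ i d, i + d ∈ A → i ∈ A := by
    intro i d
    induction d with
    | zero => exact id
    | succ d ih => exact fun hd => ih (h _ hd)
  symm
  apply Finset.eq_of_superset_of_card_ge
  · intro i hi
    rw [Finset.mem_range]
    have : Finset.range (i + 1) ⊆ A := by
      intro k hk
      have hk' : k ≤ i := by simpa [Nat.lt_succ_iff] using hk
      exact h1 k (i - k) (by rwa [Nat.add_sub_cancel' hk'])
    have := Finset.card_le_card this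
    rw [Finset.card_range] at this
    omega
  · simp

theorem two_mul_sum_range (n : ℕ) : 2 * ((∑ i ∈ Finset.range n, i : ℕ) : ℤ) = n * (n - 1) := by
  induction n with
  | zero => simp
  | succ n ih => rw [Finset.sum_range_succ, Nat.cast_add, mul_add, ih]; push_cast; ring

/-- A diagram of positive excess admits an elementary move. -/
theorem exists_move {p : MayaPair} (h : excess p ≠ 0) :
    (∃ i, i + 1 ∈ p.1 ∧ i ∉ p.1) ∨ (∃ i, i + 1 ∈ p.2 ∧ i ∉ p.2) ∨ (0 ∈ p.1 ∧ 0 ∈ p.2) := by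
  by_contra hcon
  push Not at hcon
  obtain ⟨h1, h2, h3⟩ := hcon
  -- With no move available both sets are initial segments and one of them is empty. The energy is
  -- then that of the vacuum, so the excess is `0`.
  have e1 := eq_range_of_initial h1
  have e2 := eq_range_of_initial h2
  have key := two_mul_energy p
  unfold energy charge at key
  by_cases h0 : 0 ∈ p.1
  · have : p.2 = ∅ := by
      have := h3 h0
      rw [e2] at this ⊢
      simpa using this
    rw [this, e1] at key
    have h5 := two_mul_sum_range p.1.card
    simp only [Finset.card_range, Finset.sum_empty, Finset.card_empty] at key h5
    push_cast at key h5
    apply h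
    have : (p.1.card : ℤ) - 0 = p.1.card := by ring
    rw [this] at key
    linarith
  · have : p.1 = ∅ := by
      rw [e1] at h0 ⊢
      simpa using h0
    rw [this, e2] at key
    have h5 := two_mul_sum_range p.2.card
    simp only [Finset.card_range, Finset.sum_empty, Finset.card_empty,
      Finset.sum_add_distrib] at key h5
    push_cast at key h5
    simp only [Finset.sum_const, Finset.card_range] at key
    apply h
    have : (0 : ℤ) - p.2.card = - p.2.card := by ring
    rw [this] at key
    simp at key
    linarith

end MayaPair

/-- The quotients of the elements of `S` which are congruent to `y` modulo `m`. -/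
def residue (m y : ℕ) (S : Finset ℕ) : Finset ℕ := (S.filter (· % m = y)).image (· / m)

theorem mem_residue {m y : ℕ} (hy : y < m) {S : Finset ℕ} {i : ℕ} :
    i ∈ residue m y S ↔ m * i + y ∈ S := by
  simp only [residue, Finset.mem_image, Finset.mem_filter]
  constructor
  · rintro ⟨x, ⟨h1, rfl⟩, rfl⟩
    rwa [Nat.div_add_mod]
  · intro h
    refine ⟨_, ⟨h, ?_⟩, ?_⟩
    · rw [Nat.mul_add_mod, Nat.mod_eq_of_lt hy]
    · rw [Nat.mul_add_div (by omega), Nat.div_eq_of_lt hy, add_zero]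

theorem sum_residue {A : Type*} [AddCommMonoid A] {m : ℕ} (hm : 0 < m) (S : Finset ℕ)
    (w : ℕ → A) : ∑ x ∈ S, w x = ∑ y ∈ Finset.range m, ∑ i ∈ residue m y S, w (m * i + y) := by
  rw [← Finset.sum_fiberwise_of_maps_to (t := Finset.range m) (g := (· % m))
    fun x _ => Finset.mem_range.2 (Nat.mod_lt x hm)]
  apply Finset.sum_congr rfl
  intro y hy
  rw [Finset.mem_range] at hy
  symm
  apply Finset.sum_nbij' (fun i => m * i + y) (· / m)
  · intro i hi
    rw [Finset.mem_filter]
    exact ⟨(mem_residue hy).1 hi, by rw [Nat.mul_add_mod, Nat.mod_eq_of_lt hy]⟩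
  · intro x hx
    exact Finset.mem_image_of_mem _ hx
  · intro i _
    rw [Nat.mul_add_div (by omega), Nat.div_eq_of_lt hy, add_zero]
  · intro x hx
    rw [Finset.mem_filter] at hx
    rw [← hx.2, Nat.div_add_mod]
  · intro _ _; rfl

theorem exists_of_residues {m : ℕ} (hm : 0 < m) (F : ℕ → Finset ℕ) :
    ∃ S : Finset ℕ, ∀ y < m, residue m y S = F y := by
  refine ⟨(Finset.range m).biUnion fun y => (F y).image (m * · + y), fun y hy => ?_⟩
  ext i
  rw [mem_residue hy]
  simp only [Finset.mem_biUnion, Finset.mem_range, Finset.mem_image]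
  constructor
  · rintro ⟨y', hy', i', hi', h⟩
    have h1 := congrArg (· % m) h
    have h2 := congrArg (· / m) h
    simp only [Nat.mul_add_mod, Nat.mod_eq_of_lt hy, Nat.mod_eq_of_lt hy', Nat.mul_add_div hm,
      Nat.div_eq_of_lt hy, Nat.div_eq_of_lt hy', add_zero] at h1 h2
    subst h1 h2
    exact hi'
  · intro h
    exact ⟨y, hy, i, h, rfl⟩

theorem eq_of_residues {m : ℕ} (hm : 0 < m) {S S' : Finset ℕ}
    (h : ∀ y < m, residue m y S = residue m y S') : S = S' := by
  ext x
  rw [← Nat.div_add_mod x m, ← mem_residue (Nat.mod_lt x hm), ← mem_residue (Nat.mod_lt x hm),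
    h _ (Nat.mod_lt x hm)]

/-- Pairs the residue `s` with its mirror image `2 * g - 1 - s`; the two will be the particles and
the holes of one diagram. -/
theorem sum_range_two_mul {A : Type*} [AddCommMonoid A] (g : ℕ) (f : ℕ → A) :
    ∑ y ∈ Finset.range (2 * g), f y = ∑ s : Fin g, (f s + f (2 * g - 1 - s)) := by
  rw [Fin.sum_univ_eq_sum_range fun s => f s + f (2 * g - 1 - s), Finset.sum_add_distrib, two_mul,
    Finset.sum_range_add]
  congr 1
  rw [← Finset.sum_range_reflect]
  apply Finset.sum_congr rfl
  intro s hs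
  rw [Finset.mem_range] at hs
  congr 1
  omega

end TypeD

/-! ### The Maya diagrams of a configuration. -/

namespace TypeD

/-- The number of pairs of beads in a group of excess `h`. -/
def pairNum (h : ℤ) : ℕ :=
  if h % 2 = 0 then (if 0 ≤ h then h.natAbs / 2 else h.natAbs / 2 - 1) else h.natAbs / 2

/-- An excess `h` is traded for a number `k` of pairs and two bits such that `|h|` is `2 k` plus the
two bits and `oddSign h` is their difference. The single beads thus obey an exclusion rule, as
particles and holes do, and the pairs are unrestricted. Even values are nonnegative when no bit is
set and negative when both are. -/
def HasPos (h : ℤ) : Prop := h % 2 = 0 ∧ h < 0 ∨ h % 2 ≠ 0 ∧ 0 < h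

def HasNeg (h : ℤ) : Prop := h < 0

instance (h : ℤ) : Decidable (HasPos h) := by unfold HasPos; infer_instance

instance (h : ℤ) : Decidable (HasNeg h) := by unfold HasNeg; infer_instance

/-- The excess with a given number of pairs and given single beads. -/
def ofParts (p m : Prop) [Decidable p] [Decidable m] (k : ℕ) : ℤ :=
  if p then (if m then -(2 * k + 2) else 2 * k + 1) else (if m then -(2 * k + 1) else 2 * k)

theorem ofParts_self (h : ℤ) : ofParts (HasPos h) (HasNeg h) (pairNum h) = h := by
  unfold ofParts
  have hk : (h % 2 = 0 ∧ 0 ≤ h ∧ pairNum h = h.natAbs / 2) ∨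
      (h % 2 = 0 ∧ h < 0 ∧ pairNum h = h.natAbs / 2 - 1) ∨
      (h % 2 ≠ 0 ∧ pairNum h = h.natAbs / 2) := by
    unfold pairNum
    split_ifs <;> omega
  by_cases h1 : HasPos h <;> by_cases h2 : HasNeg h <;> simp only [h1, h2, if_true, if_false] <;>
  unfold HasPos at h1 <;> unfold HasNeg at h2 <;> omega

theorem hasPos_ofParts (p m : Prop) [Decidable p] [Decidable m] (k : ℕ) :
    HasPos (ofParts p m k) ↔ p := by
  unfold ofParts HasPos
  split_ifs with h1 h2 h2 <;> simp only [h1, iff_true, iff_false] <;> omega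

theorem hasNeg_ofParts (p m : Prop) [Decidable p] [Decidable m] (k : ℕ) :
    HasNeg (ofParts p m k) ↔ m := by
  unfold ofParts HasNeg
  split_ifs with h1 h2 h2 <;> simp only [h2, iff_true, iff_false] <;> omega

theorem pairNum_ofParts (p m : Prop) [Decidable p] [Decidable m] (k : ℕ) :
    pairNum (ofParts p m k) = k := by
  unfold ofParts pairNum
  split_ifs <;> omega

theorem natAbs_eq_parts (h : ℤ) : h.natAbs =
    2 * pairNum h + (if HasPos h then 1 else 0) + if HasNeg h then 1 else 0 := by
  unfold pairNum
  by_cases h1 : HasPos h <;> by_cases h2 : HasNeg h <;> simp only [h1, h2, if_true, if_false] <;>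
  unfold HasPos at h1 <;> unfold HasNeg at h2 <;> split_ifs <;> omega

theorem oddSign_eq_parts (h : ℤ) : oddSign h =
    (if HasPos h then 1 else 0) - if HasNeg h then 1 else 0 := by
  unfold oddSign HasPos HasNeg
  rcases lt_trichotomy h 0 with h0 | h0 | h0
  · rw [Int.sign_eq_neg_one_of_neg h0]
    split_ifs <;> omega
  · subst h0; simp
  · rw [Int.sign_eq_one_of_pos h0]
    split_ifs <;> omega

theorem pairNum_zero : pairNum 0 = 0 := rfl

theorem not_hasPos_zero : ¬ HasPos 0 := by unfold HasPos; omega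

theorem not_hasNeg_zero : ¬ HasNeg 0 := by unfold HasNeg; omega

namespace Config

open MayaPair

variable (g : ℕ) (C : Config)

/-- The number of nonempty columns. -/
def size : ℕ := C.full.card + C.half.sum fun _ h => h.natAbs

def posSet : Finset ℕ := C.half.support.filter fun i => HasPos (C.half i)

def negSet : Finset ℕ := C.half.support.filter fun i => HasNeg (C.half i)

theorem mem_posSet {i : ℕ} : i ∈ C.posSet ↔ HasPos (C.half i) := by
  simp only [posSet, Finset.mem_filter, Finsupp.mem_support_iff, and_iff_right_iff_imp]
  intro h h0
  rw [h0] at h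
  exact not_hasPos_zero h

theorem mem_negSet {i : ℕ} : i ∈ C.negSet ↔ HasNeg (C.half i) := by
  simp only [negSet, Finset.mem_filter, Finsupp.mem_support_iff, and_iff_right_iff_imp]
  intro h h0
  rw [h0] at h
  exact not_hasNeg_zero h

/-- The Maya diagram of the full beads on the runners `s + 1` and `2 g + 1 - s`. -/
def runnerPair (s : ℕ) : MayaPair :=
  (residue (2 * g) s C.full, residue (2 * g) (2 * g - 1 - s) C.full)

/-- The Maya diagram of the half-rows labelled `n - 1` and `n`. -/
def oddPair : MayaPair := (residue 2 0 C.posSet, residue 2 0 C.negSet)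

/-- The Maya diagram of the half-rows labelled `0` and `1`. -/
def evenPair : MayaPair :=
  -- The particle `i` belongs to the row `2 * g * i`. Row `0` has no excess of its own, so the
  -- parity of the number of columns acts as the particle at level `0`, and the negative single
  -- beads start at level `1`.
  (if C.size % 2 = 1 then insert 0 (up (residue 2 1 C.negSet)) else up (residue 2 1 C.negSet),
    residue 2 1 C.posSet)

noncomputable def pairNums : ℕ →₀ ℕ := C.half.mapRange pairNum pairNum_zero

def totalCharge : ℤ := ∑ s : Fin g, charge (C.runnerPair g s) + charge C.evenPair + charge C.oddPair

noncomputable def totalEnergy : ℕ := ∑ s : Fin g, energy (C.runnerPair g s) + energy C.evenPair +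
  energy C.oddPair + C.pairNums.sum fun i k => (i + 1) * k

variable {g C}

theorem sum_full {A : Type*} [AddCommMonoid A] (hg : 0 < g) (w : ℕ → A) : ∑ x ∈ C.full, w x =
    ∑ s : Fin g, (∑ i ∈ (C.runnerPair g s).1, w (2 * g * i + s) +
      ∑ i ∈ (C.runnerPair g s).2, w (2 * g * i + (2 * g - 1 - s))) := by
  rw [sum_residue (show 0 < 2 * g by omega), sum_range_two_mul]
  rfl

theorem sum_half_parts {A : Type*} [AddCommMonoid A] (f : ℕ → A) (f' : ℕ → A) (w : ℕ → ℕ → A)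
    (hw : ∀ i, w i 0 = 0) :
    (C.half.sum fun i h => w i (pairNum h) + (if HasPos h then f i else 0) +
      if HasNeg h then f' i else 0) =
      C.pairNums.sum w + ∑ i ∈ C.posSet, f i + ∑ i ∈ C.negSet, f' i := by
  rw [pairNums, Finsupp.sum_mapRange_index hw]
  simp only [Finsupp.sum, posSet, negSet, Finset.sum_filter, Finset.sum_add_distrib]

theorem card_evenPair : (C.evenPair.1.card : ℤ) = C.size % 2 + (residue 2 1 C.negSet).card := by
  unfold evenPair
  split_ifs with h
  · rw [Finset.card_insert_of_notMem (by simp), card_up]; push_cast; omega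
  · rw [card_up]; omega

/-- The half-row `i` costs `i + 1`. For `i = 2 j + 1` this is twice the energy of the particle `j +
1` or of the hole `j`. For `i = 2 j` it is one more than twice the energy of the particle `j` and
one less than twice that of the hole `j`, which produces the charge. -/
theorem halfSize_eq : (C.halfSize : ℤ) =
    2 * (C.pairNums.sum fun i k => (i + 1) * k : ℕ) + 2 * energy C.evenPair +
      2 * energy C.oddPair + charge C.oddPair := by
  have h1 : C.halfSize = (C.pairNums.sum fun i k => (i + 1) * (2 * k)) +
      ∑ i ∈ C.posSet, (i + 1) + ∑ i ∈ C.negSet, (i + 1) := by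
    rw [← sum_half_parts _ _ _ (by simp), halfSize]
    apply Finsupp.sum_congr
    intro i _
    conv_lhs => rw [natAbs_eq_parts]
    split_ifs <;> ring
  have h2 : (C.pairNums.sum fun i k => (i + 1) * (2 * k)) =
      2 * C.pairNums.sum fun i k => (i + 1) * k := by
    simp only [Finsupp.sum]
    rw [Finset.mul_sum]
    exact Finset.sum_congr rfl fun i _ => by ring
  rw [sum_residue Nat.two_pos C.posSet, sum_residue Nat.two_pos C.negSet] at h1
  simp only [Finset.sum_range_succ, Finset.sum_range_zero, zero_add, add_zero] at h1
  have h3 : energy C.evenPair = ∑ i ∈ residue 2 1 C.negSet, (i + 1) +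
      ∑ i ∈ residue 2 1 C.posSet, (i + 1) := by
    unfold energy evenPair
    congr 1
    split_ifs
    · rw [Finset.sum_insert (by simp), sum_up, zero_add]
    · rw [sum_up]
  have h4 : ∀ S : Finset ℕ, ∑ i ∈ S, (2 * i + 1 + 1) = 2 * ∑ i ∈ S, (i + 1) := fun S => by
    rw [Finset.mul_sum]
    exact Finset.sum_congr rfl fun i _ => by ring
  have h5 : ∀ S : Finset ℕ, ∑ i ∈ S, (2 * i + 1) = 2 * ∑ i ∈ S, i + S.card := fun S => by
    rw [Finset.sum_add_distrib, Finset.mul_sum, Finset.card_eq_sum_ones]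
  have h6 : ∀ S : Finset ℕ, ∑ i ∈ S, (i + 1) = ∑ i ∈ S, i + S.card := fun S => by
    rw [Finset.sum_add_distrib, Finset.card_eq_sum_ones]
  rw [h3, h1, h2, h4, h4, h5, h5]
  unfold energy charge oddPair
  simp only
  have h7 := h6 (residue 2 0 C.negSet)
  push_cast at h7 ⊢
  linarith

theorem sum_oddSign_even : (C.half.sum fun i h => if i % 2 = 1 then oddSign h else 0) =
    C.size % 2 - charge C.evenPair := by
  have h1 := sum_half_parts (C := C) (fun i => if i % 2 = 1 then (1 : ℤ) else 0)
    (fun i => if i % 2 = 1 then (-1 : ℤ) else 0) (fun _ _ => 0) (by simp)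
  have h2 : (C.half.sum fun i h => if i % 2 = 1 then oddSign h else 0) =
      C.half.sum fun i h => 0 + (if HasPos h then (if i % 2 = 1 then (1 : ℤ) else 0) else 0) +
      if HasNeg h then (if i % 2 = 1 then (-1 : ℤ) else 0) else 0 := by
    apply Finsupp.sum_congr
    intro i _
    rw [oddSign_eq_parts]
    split_ifs <;> rfl
  rw [h2, h1, sum_residue Nat.two_pos C.posSet, sum_residue Nat.two_pos C.negSet]
  have h4 : ∀ i, (2 * i + 1) % 2 = 1 := fun i => by omega
  simp only [Finset.sum_range_succ, Finset.sum_range_zero, zero_add, h4, if_true]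
  unfold charge
  rw [card_evenPair]
  simp [evenPair]
  ring

theorem sum_oddSign_odd : (C.half.sum fun i h => if i % 2 = 0 then oddSign h else 0) =
    charge C.oddPair := by
  have h1 := sum_half_parts (C := C) (fun i => if i % 2 = 0 then (1 : ℤ) else 0)
    (fun i => if i % 2 = 0 then (-1 : ℤ) else 0) (fun _ _ => 0) (by simp)
  have h2 : (C.half.sum fun i h => if i % 2 = 0 then oddSign h else 0) =
      C.half.sum fun i h => 0 + (if HasPos h then (if i % 2 = 0 then (1 : ℤ) else 0) else 0) +
      if HasNeg h then (if i % 2 = 0 then (-1 : ℤ) else 0) else 0 := by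
    apply Finsupp.sum_congr
    intro i _
    rw [oddSign_eq_parts]
    split_ifs <;> rfl
  rw [h2, h1, sum_residue Nat.two_pos C.posSet, sum_residue Nat.two_pos C.negSet]
  have h4 : ∀ i, (2 * i + 1) % 2 ≠ 0 := fun i => by omega
  simp only [Finset.sum_range_succ, Finset.sum_range_zero, zero_add, h4, if_false,
    Finset.sum_const_zero]
  unfold charge oddPair
  simp [sub_eq_add_neg]

/-- A count that has slope `2` along both runners, with initial values adding up to `2`, sees the
diagram only through energy and charge. The label enters through `α` alone. -/
theorem sum_pair (p : MayaPair) (f f' : ℕ → ℕ) (α : ℤ) (hf : ∀ i, (f i : ℤ) = 2 * i + α)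
    (hf' : ∀ i, (f' i : ℤ) = 2 * i + 2 - α) :
    ((∑ i ∈ p.1, f i + ∑ i ∈ p.2, f' i : ℕ) : ℤ) = 2 * energy p + α * charge p := by
  unfold energy charge
  push_cast
  simp only [hf, hf', Finset.sum_add_distrib, Finset.sum_sub_distrib, Finset.sum_const,
    nsmul_eq_mul, ← Finset.mul_sum]
  ring

theorem sum_full_pairs (hg : 0 < g) (w : ℕ → ℕ) (α : ℕ → ℤ)
    (h1 : ∀ s < g, ∀ i, (w (2 * g * i + s) : ℤ) = 2 * i + α s)
    (h2 : ∀ s < g, ∀ i, (w (2 * g * i + (2 * g - 1 - s)) : ℤ) = 2 * i + 2 - α s) :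
    ((∑ x ∈ C.full, w x : ℕ) : ℤ) = 2 * (∑ s : Fin g, energy (C.runnerPair g s) : ℕ) +
      ∑ s : Fin g, α s * charge (C.runnerPair g s) := by
  rw [sum_full hg]
  push_cast
  rw [Finset.mul_sum, ← Finset.sum_add_distrib]
  apply Finset.sum_congr rfl
  intro s _
  rw [← sum_pair _ _ _ _ (h1 s s.2) (h2 s s.2)]
  push_cast
  rfl

theorem two_mul_div_mod {g y : ℕ} (hy : y < 2 * g) (i : ℕ) :
    (2 * g * i + y) / (2 * g) = i ∧ (2 * g * i + y) % (2 * g) = y := by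
  rw [Nat.mul_add_div (by omega), Nat.div_eq_of_lt hy, Nat.mul_add_mod, Nat.mod_eq_of_lt hy]
  simp

theorem labelCount_full_eq (hg : 2 ≤ g) {j : ℕ} (hj : 2 ≤ j) (hj' : j ≤ g) :
    (C.labelCount g (by omega) j : ℤ) = 2 * C.totalEnergy g + charge C.oddPair +
      ∑ s : Fin g, (if j - 1 ≤ (s : ℕ) then 1 else 0) * charge (C.runnerPair g s) := by
  rw [labelCount_full hg hj hj', Nat.cast_add, halfSize_eq,
    sum_full_pairs (g := g) (by omega) _ (fun s => if j - 1 ≤ s then 1 else 0)]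
  · unfold totalEnergy
    push_cast
    ring
  · intro s hs i
    rw [(two_mul_div_mod (show s < 2 * g by omega) i).1,
      (two_mul_div_mod (show s < 2 * g by omega) i).2]
    split_ifs <;> push_cast <;> omega
  · intro s hs i
    rw [(two_mul_div_mod (show 2 * g - 1 - s < 2 * g by omega) i).1,
      (two_mul_div_mod (show 2 * g - 1 - s < 2 * g by omega) i).2]
    split_ifs <;> push_cast <;> omega

theorem labelCount_zero_add_one_eq (hg : 2 ≤ g) :
    (C.labelCount g (by omega) 0 : ℤ) + C.labelCount g (by omega) 1 =
      2 * C.totalEnergy g + charge C.oddPair + ∑ s : Fin g, charge (C.runnerPair g s) := by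
  rw [← Nat.cast_add, labelCount_zero_add_one hg, Nat.cast_add, halfSize_eq,
    sum_full_pairs (g := g) (by omega) _ (fun _ => 1)]
  · unfold totalEnergy
    push_cast
    simp only [one_mul]
    ring
  · intro s hs i
    rw [(two_mul_div_mod (show s < 2 * g by omega) i).1]
    push_cast; ring
  · intro s hs i
    rw [(two_mul_div_mod (show 2 * g - 1 - s < 2 * g by omega) i).1]
    push_cast; ring

theorem labelCount_last_add_eq (hg : 2 ≤ g) :
    (C.labelCount g (by omega) (g + 1) : ℤ) + C.labelCount g (by omega) (g + 2) =
      2 * C.totalEnergy g + charge C.oddPair := by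
  rw [← Nat.cast_add, labelCount_last_add hg, Nat.cast_add, halfSize_eq,
    sum_full_pairs (g := g) (by omega) _ (fun _ => 0)]
  · unfold totalEnergy
    push_cast
    simp only [zero_mul, Finset.sum_const_zero]
    ring
  · intro s hs i
    rw [(two_mul_div_mod (show s < 2 * g by omega) i).1,
      (two_mul_div_mod (show s < 2 * g by omega) i).2, if_neg (by omega)]
    push_cast; ring
  · intro s hs i
    rw [(two_mul_div_mod (show 2 * g - 1 - s < 2 * g by omega) i).1,
      (two_mul_div_mod (show 2 * g - 1 - s < 2 * g by omega) i).2, if_pos (by omega)]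
    push_cast; ring

theorem labelCount_zero_sub_one_eq (hg : 2 ≤ g) :
    (C.labelCount g (by omega) 0 : ℤ) - C.labelCount g (by omega) 1 = charge C.evenPair := by
  rw [labelCount_zero_sub_one hg, sum_oddSign_even, inner_zero (by omega), size]
  push_cast
  ring

theorem labelCount_last_sub_eq (hg : 2 ≤ g) :
    (C.labelCount g (by omega) (g + 2) : ℤ) - C.labelCount g (by omega) (g + 1) =
      charge C.oddPair := by
  rw [labelCount_last_sub hg, sum_oddSign_odd]

/-- The energy above that of the vacuum with the same charges. -/
noncomputable def totalExcess (g : ℕ) (C : Config) : ℕ :=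
  ∑ s : Fin g, excess (C.runnerPair g s) + excess C.evenPair + excess C.oddPair +
    C.pairNums.sum fun i k => (i + 1) * k

theorem two_mul_totalEnergy : 2 * (C.totalEnergy g : ℤ) = 2 * C.totalExcess g +
    ∑ s : Fin g, charge (C.runnerPair g s) * (charge (C.runnerPair g s) - 1) +
    charge C.evenPair * (charge C.evenPair - 1) + charge C.oddPair * (charge C.oddPair - 1) := by
  unfold totalEnergy totalExcess
  push_cast
  simp only [mul_add, Finset.mul_sum, two_mul_energy, Finset.sum_add_distrib]
  ring

/-- Modulo `2` the charges count all full and single beads, that is the number of columns, together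
with the particle at level `0` of `evenPair`, which is again the parity of that number. -/
theorem even_totalCharge (hg : 0 < g) : Even (C.totalCharge g) := by
  have h1 : C.full.card = ∑ s : Fin g, ((C.runnerPair g s).1.card + (C.runnerPair g s).2.card) := by
    simp only [Finset.card_eq_sum_ones]
    exact sum_full hg _
  have h2 : (C.half.sum fun _ h => h.natAbs) = (C.pairNums.sum fun _ k => 2 * k) +
      C.posSet.card + C.negSet.card := by
    rw [Finset.card_eq_sum_ones, Finset.card_eq_sum_ones, ← sum_half_parts _ _ _ (by simp)]
    apply Finsupp.sum_congr
    intro i _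
    exact natAbs_eq_parts _
  have h3 : (C.pairNums.sum fun _ k => 2 * k) = 2 * C.pairNums.sum fun _ k => k := by
    simp only [Finsupp.sum, Finset.mul_sum]
  have h4 : ∀ S : Finset ℕ, S.card = (residue 2 0 S).card + (residue 2 1 S).card := by
    intro S
    have := sum_residue Nat.two_pos S (fun _ => 1)
    simp only [← Finset.card_eq_sum_ones] at this
    simpa only [Finset.sum_range_succ, Finset.sum_range_zero, zero_add] using this
  have h5 : ((∑ s : Fin g, charge (C.runnerPair g s) : ℤ)) =
      C.full.card - 2 * ∑ s : Fin g, ((C.runnerPair g s).2.card : ℤ) := by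
    rw [h1, Finset.mul_sum]
    push_cast
    rw [← Finset.sum_sub_distrib]
    apply Finset.sum_congr rfl
    intro s _
    unfold charge
    ring
  have h6 := card_evenPair (C := C)
  have h7 := h4 C.posSet
  have h8 := h4 C.negSet
  have h9 : C.evenPair.2.card = (residue 2 1 C.posSet).card := rfl
  have h10 : C.oddPair.1.card = (residue 2 0 C.posSet).card := rfl
  have h11 : C.oddPair.2.card = (residue 2 0 C.negSet).card := rfl
  rw [Int.even_iff, totalCharge, h5]
  unfold charge
  unfold size at h6
  omega

/-- The Maya diagrams of a configuration. -/
noncomputable def toPairs (g : ℕ) (C : Config) :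
    (Fin g → MayaPair) × MayaPair × MayaPair × (ℕ →₀ ℕ) :=
  (fun s => C.runnerPair g s, C.evenPair, C.oddPair, C.pairNums)

theorem toPairs_injective (hg : 0 < g) : Function.Injective (toPairs g) := by
  intro C C' h
  simp only [toPairs, Prod.mk.injEq] at h
  obtain ⟨h1, h2, h3, h4⟩ := h
  have hfull : C.full = C'.full := by
    apply eq_of_residues (show 0 < 2 * g by omega)
    intro y hy
    by_cases hyg : y < g
    · exact congrArg Prod.fst (congrFun h1 ⟨y, hyg⟩)
    · have := congrArg Prod.snd (congrFun h1 ⟨2 * g - 1 - y, by omega⟩)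
      simp only [runnerPair] at this
      rwa [show 2 * g - 1 - (2 * g - 1 - y) = y by omega] at this
  have hpos : C.posSet = C'.posSet := by
    apply eq_of_residues Nat.two_pos
    intro y hy
    interval_cases y
    · exact congrArg Prod.fst h3
    · exact congrArg Prod.snd h2
  have hneg : C.negSet = C'.negSet := by
    apply eq_of_residues Nat.two_pos
    intro y hy
    interval_cases y
    · exact congrArg Prod.snd h3
    · have h5 := congrArg Prod.fst h2
      ext i
      have h6 : ∀ C : Config, i + 1 ∈ C.evenPair.1 ↔ i ∈ residue 2 1 C.negSet := by
        intro C
        unfold evenPair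
        simp only
        split_ifs <;> simp
      rw [← h6, ← h6, h5]
  ext i
  · rw [hfull]
  · have e1 : HasPos (C.half i) ↔ HasPos (C'.half i) := by rw [← mem_posSet, ← mem_posSet, hpos]
    have e2 : HasNeg (C.half i) ↔ HasNeg (C'.half i) := by rw [← mem_negSet, ← mem_negSet, hneg]
    have e3 : pairNum (C.half i) = pairNum (C'.half i) := DFunLike.congr_fun h4 i
    rw [← ofParts_self (C.half i), ← ofParts_self (C'.half i), e3]
    simp only [e1, e2]

theorem exists_toPairs (hg : 0 < g) (F : Fin g → MayaPair) (p q : MayaPair) (k : ℕ →₀ ℕ)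
    (h : Even (∑ s, charge (F s) + charge p + charge q)) : ∃ C, toPairs g C = (F, p, q, k) := by
  classical
  obtain ⟨S, hS⟩ := exists_of_residues (show 0 < 2 * g by omega) fun y =>
    if hy : y < g then (F ⟨y, hy⟩).1 else
      if hy' : 2 * g - 1 - y < g then (F ⟨2 * g - 1 - y, hy'⟩).2 else ∅
  obtain ⟨P, hP⟩ := exists_of_residues Nat.two_pos fun y => if y = 0 then q.1 else p.2
  obtain ⟨M, hM⟩ := exists_of_residues Nat.two_pos fun y => if y = 0 then q.2 else down p.1
  let C : Config := ⟨S, Finsupp.onFinset (P ∪ M ∪ k.support)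
    (fun i => ofParts (i ∈ P) (i ∈ M) (k i)) (by
      intro i hi
      contrapose! hi
      simp only [Finset.mem_union, not_or, Finsupp.mem_support_iff, not_not] at hi
      simp [ofParts, hi])⟩
  have hhalf : ∀ i, C.half i = ofParts (i ∈ P) (i ∈ M) (k i) := fun i => rfl
  have hpos : C.posSet = P := by
    ext i
    rw [mem_posSet, hhalf, hasPos_ofParts]
  have hneg : C.negSet = M := by
    ext i
    rw [mem_negSet, hhalf, hasNeg_ofParts]
  have hk : C.pairNums = k := by
    ext i
    exact pairNum_ofParts _ _ _
  have hF : ∀ s : Fin g, C.runnerPair g s = F s := by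
    intro s
    have := s.2
    refine Prod.ext ?_ ?_
    · exact (hS s (by omega)).trans (by simp)
    · refine (hS (2 * g - 1 - s) (by omega)).trans ?_
      have e : 2 * g - 1 - (2 * g - 1 - (s : ℕ)) = s := by omega
      simp only [e]
      rw [dif_neg (by omega), dif_pos s.2]
  have hq : C.oddPair = q := by
    refine Prod.ext ?_ ?_
    · simp only [oddPair, hpos, hP 0 Nat.two_pos, if_true]
    · simp only [oddPair, hneg, hM 0 Nat.two_pos, if_true]
  have hp2 : C.evenPair.2 = p.2 := by
    simp only [evenPair, hpos, hP 1 one_lt_two]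
    simp
  have hM1 : residue 2 1 C.negSet = down p.1 := by
    rw [hneg, hM 1 one_lt_two]; simp
  have hp1 : C.evenPair.1 = p.1 := by
    have hev := even_totalCharge (C := C) hg
    have hc : C.totalCharge g = ∑ s, charge (F s) + charge C.evenPair + charge q := by
      simp only [totalCharge, hF, hq]
    have h6 := card_evenPair (C := C)
    rw [hM1] at h6
    have h7 := card_eq_down p.1
    rw [hc] at hev
    rw [Int.even_iff] at hev h
    unfold charge at hev h
    rw [hp2] at hev
    -- Only the occupation of level `0` could not be prescribed. It comes out right because both
    -- total charges are even and everything else agrees.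
    have key : C.size % 2 = 1 ↔ 0 ∈ p.1 := by
      split_ifs at h7 with h0
      · simp only [h0, iff_true]; omega
      · simp only [h0, iff_false]; omega
    conv_rhs => rw [up_down p.1]
    simp only [evenPair, hM1, key]
  refine ⟨C, ?_⟩
  simp only [toPairs, hq, hk, Prod.mk.injEq, and_true]
  exact ⟨funext hF, Prod.ext hp1 hp2⟩

end Config
end TypeD

/-! ### Generating functions of Maya diagrams and partitions. -/

namespace TypeD

section GeneratingFunction

open MvPowerSeries Filter

variable {σ ι κ : Type*}

/-- The weight function `w` takes every value finitely often. -/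
def FiniteFibers {β : Type*} (w : ι → β) : Prop := ∀ e, {i | w i = e}.Finite

theorem FiniteFibers.comp_injective {β : Type*} {w : ι → β} (hw : FiniteFibers w) {f : κ → ι}
    (hf : Function.Injective f) : FiniteFibers (w ∘ f) :=
  fun e => (hw e).preimage hf.injOn

theorem FiniteFibers.of_le {f : ι → ℕ} (h : ∀ N, {i | f i ≤ N}.Finite) : FiniteFibers f :=
  fun e => (h e).subset fun _ hi => le_of_eq hi

theorem FiniteFibers.add [DecidableEq σ] {w : ι → σ →₀ ℕ} {w' : κ → σ →₀ ℕ} (hw : FiniteFibers w)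
    (hw' : FiniteFibers w') : FiniteFibers fun x : ι × κ => w x.1 + w' x.2 := by
  intro e
  refine ((Finset.HasAntidiagonal.antidiagonal e).finite_toSet.biUnion
    fun p _ => (hw p.1).prod (hw' p.2)).subset ?_
  rintro ⟨i, j⟩ h
  simp only [Set.mem_iUnion]
  exact ⟨(w i, w' j), by simpa using h, rfl, rfl⟩

theorem FiniteFibers.add_nat {w : ι → ℕ} {w' : κ → ℕ} (hw : FiniteFibers w)
    (hw' : FiniteFibers w') : FiniteFibers fun x : ι × κ => w x.1 + w' x.2 := by
  intro e
  refine ((Finset.HasAntidiagonal.antidiagonal e).finite_toSet.biUnion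
    fun p _ => (hw p.1).prod (hw' p.2)).subset ?_
  rintro ⟨i, j⟩ h
  simp only [Set.mem_iUnion]
  exact ⟨(w i, w' j), by simpa using h, rfl, rfl⟩

/-- The generating function of the weight function `w`. -/
noncomputable def genFun (w : ι → σ →₀ ℕ) : MvPowerSeries σ ℤ := ∑' i, monomial (w i) 1

theorem FiniteFibers.summable {w : ι → σ →₀ ℕ} (hw : FiniteFibers w) :
    Summable fun i => monomial (w i) (1 : ℤ) := by
  classical
  rw [MvPowerSeries.WithPiTopology.summable_iff_summable_coeff]
  intro d
  apply summable_of_hasFiniteSupport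
  refine (hw d).subset fun i hi => ?_
  by_contra h
  apply hi
  simp only [coeff_monomial]
  rw [if_neg]
  exact fun h' => h h'.symm

theorem genFun_equiv (e : ι ≃ κ) (w : κ → σ →₀ ℕ) : genFun (fun i => w (e i)) = genFun w :=
  e.tsum_eq fun i => monomial (w i) (1 : ℤ)

theorem genFun_add_const {w : ι → σ →₀ ℕ} (hw : FiniteFibers w) (v : σ →₀ ℕ) :
    genFun (fun i => v + w i) = monomial v 1 * genFun w := by
  unfold genFun
  rw [← hw.summable.tsum_mul_left]
  simp only [monomial_mul_monomial, one_mul]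

theorem genFun_prod {w : ι → σ →₀ ℕ} {w' : κ → σ →₀ ℕ} (hw : FiniteFibers w)
    (hw' : FiniteFibers w') :
    genFun (fun x : ι × κ => w x.1 + w' x.2) = genFun w * genFun w' := by
  classical
  unfold genFun
  rw [hw.summable.tsum_mul_tsum hw'.summable]
  · simp only [monomial_mul_monomial, one_mul]
  · simpa only [monomial_mul_monomial, one_mul] using (hw.add hw').summable

theorem genFun_split {w : ι → σ →₀ ℕ} (hw : FiniteFibers w) (p : ι → Prop) :
    genFun w = genFun (fun i : {i // p i} => w i) + genFun (fun i : {i // ¬ p i} => w i) := by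
  classical
  rw [← genFun_equiv (Equiv.sumCompl p) w]
  exact Summable.tsum_sum (f := fun i => monomial (w (Equiv.sumCompl p i)) (1 : ℤ))
    (hw.comp_injective Subtype.val_injective).summable
    (hw.comp_injective Subtype.val_injective).summable

variable {v : σ →₀ ℕ}

theorem FiniteFibers.smul {f : ι → ℕ} (hf : FiniteFibers f) (hv : v ≠ 0) :
    FiniteFibers fun i => f i • v := by
  obtain ⟨x, hx⟩ := Finsupp.ne_iff.1 hv
  intro e
  refine (hf (e x / v x)).subset ?_
  intro i hi
  simp only [Set.mem_ofPred_eq] at hi ⊢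
  rw [← hi]
  simp only [Finsupp.smul_apply, smul_eq_mul]
  rw [Nat.mul_div_cancel _ (Nat.pos_of_ne_zero hx)]

/-- The product of the factors `1 - Q ^ (k + 1)` for `k < c`. -/
noncomputable def partialProd (v : σ →₀ ℕ) (c : ℕ) : MvPowerSeries σ ℤ :=
  ∏ k ∈ Finset.range c, (1 - (monomial v 1) ^ (k + 1))

theorem multipliable_one_sub (hv : v ≠ 0) :
    Multipliable fun k : ℕ => (1 : MvPowerSeries σ ℤ) - (monomial v 1) ^ (k + 1) := by
  have h : Tendsto (fun k : ℕ => (-(monomial v (1 : ℤ)) ^ (k + 1)).order) atTop (nhds ⊤) := by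
    rw [ENat.tendsto_nhds_top_iff_natCast_lt]
    intro n
    rw [eventually_atTop]
    refine ⟨n, fun k hk => ?_⟩
    rw [order_neg, monomial_pow, one_pow, order_monomial_of_ne_zero one_ne_zero, map_nsmul,
      smul_eq_mul]
    have h1 : 1 ≤ v.degree := by
      rw [Nat.one_le_iff_ne_zero, Ne, Finsupp.degree_eq_zero_iff]
      exact hv
    have : n < (k + 1) * v.degree := by nlinarith
    exact_mod_cast this
  simpa [sub_eq_add_neg] using
    MvPowerSeries.WithPiTopology.multipliable_one_add_of_tendsto_order_atTop_nhds_top h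

/-- A fixed coefficient of `Q ^ c * J` vanishes as soon as `c` exceeds one of its exponents in the
support of `v`. So the products with the partial products converge to `1` coefficientwise, and
limits are unique. -/
theorem mul_tprod_eq_one (hv : v ≠ 0) {W : MvPowerSeries σ ℤ}
    (h : ∀ c, ∃ J, W * partialProd v c = 1 + (monomial v 1) ^ c * J) :
    W * ∏' k : ℕ, ((1 : MvPowerSeries σ ℤ) - (monomial v 1) ^ (k + 1)) = 1 := by
  have h1 := ((multipliable_one_sub hv).tendsto_prod_tprod_nat).const_mul W
  have h2 : Tendsto (fun c => W * partialProd v c) atTop (nhds 1) := by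
    rw [MvPowerSeries.WithPiTopology.tendsto_iff_coeff_tendsto]
    intro d
    apply tendsto_const_nhds.congr'
    obtain ⟨x, hx⟩ := Finsupp.ne_iff.1 hv
    rw [EventuallyEq, eventually_atTop]
    refine ⟨d x + 1, fun c hc => ?_⟩
    obtain ⟨J, hJ⟩ := h c
    rw [hJ, map_add, monomial_pow, one_pow, coeff_monomial_mul, if_neg, add_zero]
    intro hle
    have h3 := hle x
    simp only [Finsupp.smul_apply, smul_eq_mul] at h3
    have h4 : 1 ≤ v x := Nat.one_le_iff_ne_zero.2 hx
    nlinarith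
  exact tendsto_nhds_unique h1 h2

theorem genFun_smul_ge {f : ι → ℕ} (hf : FiniteFibers f) (hv : v ≠ 0) {c : ℕ} (hc : ∀ i, c ≤ f i) :
    ∃ J, genFun (fun i => f i • v) = (monomial v 1) ^ c * J := by
  have h : FiniteFibers fun i => f i - c := fun e => (hf (e + c)).subset fun i hi => by
    simp only [Set.mem_ofPred_eq] at hi ⊢
    have := hc i
    omega
  refine ⟨genFun fun i => (f i - c) • v, ?_⟩
  rw [monomial_pow, one_pow, ← genFun_add_const (h.smul hv)]
  congr 1
  ext1 i
  rw [← add_smul, Nat.add_sub_cancel' (hc i)]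

theorem genFun_unique [Unique ι] (w : ι → σ →₀ ℕ) : genFun w = monomial (w default) 1 := by
  unfold genFun
  rw [tsum_eq_single default]
  intro i hi
  exact absurd (Subsingleton.elim _ _) hi

open MayaPair

theorem finite_sum_le (N c : ℕ) : {A : Finset ℕ | ∑ i ∈ A, (i + c) ≤ N}.Finite := by
  refine (Finset.finite_toSet (Finset.range (N + 1)).powerset).subset ?_
  intro A hA
  simp only [Set.mem_ofPred_eq, Finset.coe_powerset, Set.mem_preimage, Set.mem_powerset_iff,
    Finset.coe_subset] at hA ⊢
  intro i hi
  have := Finset.single_le_sum (f := fun i => i + c) (fun _ _ => Nat.zero_le _) hi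
  rw [Finset.mem_range]
  omega

abbrev CardSet (c : ℕ) := {A : Finset ℕ // A.card = c}

def cardSetSum {c : ℕ} (A : CardSet c) : ℕ := ∑ i ∈ A.1, i

theorem finiteFibers_cardSetSum (c : ℕ) : FiniteFibers (cardSetSum (c := c)) := by
  apply FiniteFibers.of_le
  intro N
  refine ((finite_sum_le N 0).preimage Subtype.val_injective.injOn).subset ?_
  intro A hA
  exact hA

noncomputable def equivCardSetZero (c : ℕ) : CardSet c ≃ {A : CardSet (c + 1) // 0 ∈ A.1} where
  toFun A := ⟨⟨insert 0 (up A.1), by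
    rw [Finset.card_insert_of_notMem (by simp), card_up, A.2]⟩, by simp⟩
  invFun A := ⟨down A.1.1, by
    have := card_eq_down A.1.1
    rw [if_pos A.2, A.1.2] at this
    omega⟩
  left_inv A := by
    apply Subtype.ext
    ext i
    simp
  right_inv A := by
    apply Subtype.ext
    apply Subtype.ext
    have := A.2
    apply ext_zero_succ <;> simp [this]

noncomputable def equivCardSetSucc (c : ℕ) : CardSet c ≃ {A : CardSet c // ¬ 0 ∈ A.1} where
  toFun A := ⟨⟨up A.1, by rw [card_up, A.2]⟩, by simp⟩
  invFun A := ⟨down A.1.1, by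
    have := card_eq_down A.1.1
    rw [if_neg A.2, A.1.2] at this
    omega⟩
  left_inv A := by
    apply Subtype.ext
    ext i
    simp
  right_inv A := by
    apply Subtype.ext
    apply Subtype.ext
    have := A.2
    apply ext_zero_succ <;> simp [this]

/-- Split by whether `0` belongs to the set, drop it if so, and lower the remaining elements by one.
With `F c` for the series this reads `F (c + 1) = Q ^ c * F c + Q ^ (c + 1) * F (c + 1)`. -/
theorem genFun_cardSet (hv : v ≠ 0) (c : ℕ) :
    genFun (fun A : CardSet c => cardSetSum A • v) * partialProd v c =
      (monomial v 1) ^ (∑ i ∈ Finset.range c, i) := by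
  induction c with
  | zero =>
    have : Unique (CardSet 0) := ⟨⟨⟨∅, rfl⟩⟩, fun A => Subtype.ext (Finset.card_eq_zero.1 A.2)⟩
    rw [genFun_unique]
    rw [show (default : CardSet 0) = ⟨∅, rfl⟩ from Subsingleton.elim _ _]
    simp [partialProd, cardSetSum]
  | succ c ih =>
    have h1 := genFun_split ((finiteFibers_cardSetSum (c + 1)).smul hv) (fun A => 0 ∈ A.1)
    have e1 : ∀ A, cardSetSum (equivCardSetZero c A).1 = c + cardSetSum A := by
      intro A
      simp only [cardSetSum, equivCardSetZero, Equiv.coe_fn_mk]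
      rw [Finset.sum_insert (by simp), sum_up, Finset.sum_add_distrib, Finset.sum_const, A.2]
      simp [add_comm]
    have e2 : ∀ A, cardSetSum (equivCardSetSucc (c + 1) A).1 = (c + 1) + cardSetSum A := by
      intro A
      simp only [cardSetSum, equivCardSetSucc, Equiv.coe_fn_mk]
      rw [sum_up, Finset.sum_add_distrib, Finset.sum_const, A.2]
      simp [add_comm]
    rw [← genFun_equiv (equivCardSetZero c), ← genFun_equiv (equivCardSetSucc (c + 1))] at h1
    simp only [e1, e2, add_smul] at h1
    rw [genFun_add_const ((finiteFibers_cardSetSum c).smul hv)] at h1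
    -- The previous rewriting also broke up the multiple `(c + 1) • v`; it is put together again.
    simp only [← add_smul (c) 1 v] at h1
    rw [genFun_add_const ((finiteFibers_cardSetSum (c + 1)).smul hv)] at h1
    have p1 : ∀ k : ℕ, monomial (k • v) (1 : ℤ) = (monomial v 1) ^ k := fun k => by
      rw [monomial_pow, one_pow]
    rw [p1, p1] at h1
    rw [partialProd, Finset.prod_range_succ, Finset.sum_range_succ,
      pow_add _ (∑ i ∈ Finset.range c, i) c, ← ih, partialProd]
    have h2 : genFun (fun A : CardSet (c + 1) => cardSetSum A • v) * (1 - monomial v 1 ^ (c + 1)) =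
        monomial v 1 ^ c * genFun (fun A : CardSet c => cardSetSum A • v) := by
      linear_combination h1
    linear_combination (∏ k ∈ Finset.range c, (1 - (monomial v (1 : ℤ)) ^ (k + 1))) * h2

def neutralEnergy (x : Neutral) : ℕ := energy x.1

theorem finiteFibers_neutralEnergy : FiniteFibers neutralEnergy := by
  apply FiniteFibers.of_le
  intro N
  refine (((finite_sum_le N 0).prod (finite_sum_le N 1)).preimage
    Subtype.val_injective.injOn).subset ?_
  intro x hx
  simp only [neutralEnergy, energy, Set.mem_ofPred_eq] at hx
  refine ⟨?_, ?_⟩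
  · simp only [Set.mem_ofPred_eq, add_zero]; omega
  · simp only [Set.mem_ofPred_eq]; omega

theorem mem_zpow_shift_snd (c : ℕ) (p : MayaPair) (i : ℕ) :
    i ∈ ((shift ^ (c : ℤ)) p).2 ↔ i + c ∈ p.2 := by
  induction c generalizing i with
  | zero => simp
  | succ c ih =>
    rw [Nat.cast_succ, add_comm (c : ℤ), zpow_one_add, Equiv.Perm.mul_apply]
    change i ∈ down _ ↔ _
    rw [mem_down, ih, add_assoc, add_comm 1 c]

/-- A neutral diagram all of whose holes have index below `c` loses them all after `c` shifts and
becomes a set of `c` particles. This plays the role of bounding the number of parts of a partition.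
-/
noncomputable def equivNeutralCardSet (c : ℕ) :
    CardSet c ≃ {x : Neutral // ((shift ^ (c : ℤ)) x.1).2 = ∅} where
  toFun A := ⟨⟨(shift ^ (-c : ℤ)) (A.1, ∅), by
    rw [charge_zpow_shift, charge, A.2]; simp⟩, by
      rw [← Equiv.Perm.mul_apply, ← zpow_add]; simp⟩
  invFun x := ⟨((shift ^ (c : ℤ)) x.1.1).1, by
    have h := charge_zpow_shift c x.1.1
    rw [x.1.2, charge, x.2] at h
    simpa using h⟩
  left_inv A := by
    apply Subtype.ext
    simp only
    rw [← Equiv.Perm.mul_apply, ← zpow_add]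
    simp
  right_inv x := by
    apply Subtype.ext
    apply Subtype.ext
    simp only
    have : (((shift ^ (c : ℤ)) x.1.1).1, ∅) = (shift ^ (c : ℤ)) x.1.1 := Prod.ext rfl x.2.symm
    rw [this, ← Equiv.Perm.mul_apply, ← zpow_add]
    simp

theorem monomial_one_ne_zero (v : σ →₀ ℕ) : (monomial v (1 : ℤ)) ≠ 0 := by
  classical
  intro h
  have := congrArg (coeff v) h
  rw [coeff_monomial, if_pos rfl, map_zero] at this
  exact one_ne_zero this

/-- The generating function of the neutral Maya diagrams, i.e. of the partitions. -/
theorem genFun_neutral_mul_tprod (hv : v ≠ 0) :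
    genFun (fun x : Neutral => neutralEnergy x • v) *
      ∏' k : ℕ, ((1 : MvPowerSeries σ ℤ) - (monomial v 1) ^ (k + 1)) = 1 := by
  apply mul_tprod_eq_one hv
  intro c
  -- Diagrams with a hole of index at least `c` have energy at least `c`, so they only enter the
  -- multiple of `Q ^ c`. The others are counted by `genFun_cardSet`, up to the energy of the vacuum
  -- of charge `c`.
  have h1 := genFun_split (finiteFibers_neutralEnergy.smul hv)
    (fun x => ((shift ^ (c : ℤ)) x.1).2 = ∅)
  obtain ⟨J, hJ⟩ := genFun_smul_ge (v := v) (c := c)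
    (f := fun x : {x : Neutral // ¬ ((shift ^ (c : ℤ)) x.1).2 = ∅} => neutralEnergy x)
    (finiteFibers_neutralEnergy.comp_injective Subtype.val_injective) hv (by
      intro x
      obtain ⟨i, hi⟩ := Finset.nonempty_iff_ne_empty.2 x.2
      rw [mem_zpow_shift_snd] at hi
      have := Finset.single_le_sum (f := fun i => i + 1) (fun _ _ => Nat.zero_le _) hi
      simp only [neutralEnergy, energy]
      omega)
  rw [hJ, ← genFun_equiv (equivNeutralCardSet c)] at h1
  have h2 : ∀ A, cardSetSum A = ∑ i ∈ Finset.range c, i +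
      neutralEnergy (equivNeutralCardSet c A).1 := by
    intro A
    have h3 := energy_zpow_shift c (equivNeutralCardSet c A).1.1
    rw [(equivNeutralCardSet c A).1.2] at h3
    have h4 : (shift ^ (c : ℤ)) (equivNeutralCardSet c A).1.1 = (A.1, ∅) := by
      simp only [equivNeutralCardSet, Equiv.coe_fn_mk]
      rw [← Equiv.Perm.mul_apply, ← zpow_add]
      simp
    rw [h4] at h3
    have h5 := two_mul_sum_range c
    have h6 : energy (A.1, ∅) = cardSetSum A := by simp [energy, cardSetSum]
    rw [h6] at h3
    have h7 : (cardSetSum A : ℤ) = (∑ i ∈ Finset.range c, i : ℕ) +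
      (energy (equivNeutralCardSet c A).1.1 : ℤ) := by linarith
    exact_mod_cast h7
  have h3 := genFun_cardSet hv c
  simp only [h2, add_smul] at h3
  rw [genFun_add_const] at h3
  · have p1 : ∀ k : ℕ, monomial (k • v) (1 : ℤ) = (monomial v 1) ^ k := fun k => by
      rw [monomial_pow, one_pow]
    rw [p1, mul_assoc] at h3
    have h4 := mul_left_cancel₀ (pow_ne_zero _ (monomial_one_ne_zero v)) (h3.trans (mul_one _).symm)
    refine ⟨J * partialProd v c, ?_⟩
    rw [h1, add_mul, h4]
    ring
  · have h5 := finiteFibers_neutralEnergy.smul hv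
    exact h5.comp_injective (Subtype.val_injective.comp (equivNeutralCardSet c).injective)

/-- The weight of a sequence of multiplicities. -/
def multWeight (j : ℕ) (k : ℕ →₀ ℕ) : ℕ := k.sum fun i x => (i + 1 + j) * x

theorem le_multWeight {j : ℕ} {k : ℕ →₀ ℕ} {i : ℕ} (hi : k i ≠ 0) : (i + 1 + j) * k i ≤ multWeight j k :=
  Finset.single_le_sum (f := fun i => (i + 1 + j) * k i) (fun _ _ => Nat.zero_le _)
    (Finsupp.mem_support_iff.2 hi)

theorem finiteFibers_multWeight (j : ℕ) : FiniteFibers (multWeight j) := by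
  apply FiniteFibers.of_le
  intro N
  let K : ℕ →₀ ℕ := Finsupp.onFinset (Finset.range N) (fun i => if i < N then N else 0) (by
    intro i hi
    simp only [ne_eq, ite_eq_right_iff, Classical.not_imp] at hi
    exact Finset.mem_range.2 hi.1)
  refine (Set.finite_Iic K).subset ?_
  intro k hk
  rw [Set.mem_Iic]
  intro i
  by_cases hi : k i = 0
  · rw [hi]; exact Nat.zero_le _
  · have h1 := (le_multWeight (j := j) hi).trans hk
    have h2 : 1 ≤ k i := Nat.one_le_iff_ne_zero.2 hi
    have h3 : i < N := by nlinarith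
    have h4 : K i = N := if_pos h3
    rw [h4]
    nlinarith

noncomputable def equivTail : (ℕ →₀ ℕ) ≃ {k : ℕ →₀ ℕ // k 0 = 0} where
  toFun k := ⟨k.embDomain (addRightEmbedding 1), by
    rw [Finsupp.embDomain_of_notMem_range]
    simp⟩
  invFun k := k.1.comapDomain (· + 1) (add_left_injective 1).injOn
  left_inv k := by
    ext i
    rw [Finsupp.comapDomain_apply]
    exact Finsupp.embDomain_apply_self (addRightEmbedding 1) k i
  right_inv k := by
    apply Subtype.ext
    ext i
    rcases i with _ | i
    · simp only [k.2]
      rw [Finsupp.embDomain_of_notMem_range]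
      simp
    · exact Finsupp.embDomain_apply_self (addRightEmbedding 1) _ i

noncomputable def equivAddSingle : (ℕ →₀ ℕ) ≃ {k : ℕ →₀ ℕ // ¬ k 0 = 0} where
  toFun k := ⟨Finsupp.single 0 1 + k, by simp⟩
  invFun k := k.1 - Finsupp.single 0 1
  left_inv k := by simp
  right_inv k := by
    apply Subtype.ext
    simp only
    apply add_tsub_cancel_of_le
    rw [Finsupp.single_le_iff]
    exact Nat.one_le_iff_ne_zero.2 k.2

/-- Either the smallest admitted part `j + 1` does not occur, or one copy of it can be removed. The
factor on the left therefore eliminates that part. -/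
theorem genFun_multWeight (hv : v ≠ 0) (j : ℕ) :
    genFun (fun k => multWeight j k • v) * (1 - monomial v 1 ^ (j + 1)) =
      genFun (fun k => multWeight (j + 1) k • v) := by
  have h1 := genFun_split ((finiteFibers_multWeight j).smul hv) (fun k => k 0 = 0)
  have e1 : ∀ k, multWeight j (equivTail k).1 = multWeight (j + 1) k := by
    intro k
    simp only [multWeight, equivTail, Equiv.coe_fn_mk, Finsupp.sum_embDomain]
    apply Finsupp.sum_congr
    intro i _
    simp only [addRightEmbedding_apply]
    ring
  have e2 : ∀ k, multWeight j (equivAddSingle k).1 = (j + 1) + multWeight j k := by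
    intro k
    simp only [multWeight, equivAddSingle, Equiv.coe_fn_mk]
    rw [Finsupp.sum_add_index' (by simp) (by intros; ring), Finsupp.sum_single_index (by simp)]
    ring
  rw [← genFun_equiv equivTail, ← genFun_equiv equivAddSingle] at h1
  simp only [e1, e2] at h1
  simp only [add_smul (j + 1)] at h1
  rw [genFun_add_const ((finiteFibers_multWeight j).smul hv)] at h1
  have p1 : ∀ k : ℕ, monomial (k • v) (1 : ℤ) = (monomial v 1) ^ k := fun k => by
    rw [monomial_pow, one_pow]
  rw [p1] at h1
  linear_combination h1

theorem genFun_multWeight_mul_tprod (hv : v ≠ 0) :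
    genFun (fun k => multWeight 0 k • v) *
      ∏' k : ℕ, ((1 : MvPowerSeries σ ℤ) - (monomial v 1) ^ (k + 1)) = 1 := by
  apply mul_tprod_eq_one hv
  intro c
  have h1 : genFun (fun k => multWeight 0 k • v) * partialProd v c =
      genFun (fun k => multWeight c k • v) := by
    induction c with
    | zero => simp [partialProd]
    | succ c ih =>
      rw [← genFun_multWeight hv, ← ih, partialProd, partialProd, Finset.prod_range_succ, mul_assoc]
  rw [h1, genFun_split ((finiteFibers_multWeight c).smul hv) (fun k => k = 0), genFun_unique]
  obtain ⟨J, hJ⟩ := genFun_smul_ge (v := v) (c := c)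
    (f := fun k : {k : ℕ →₀ ℕ // ¬ k = 0} => multWeight c k)
    ((finiteFibers_multWeight c).comp_injective Subtype.val_injective) hv (by
      intro k
      obtain ⟨i, hi⟩ := Finsupp.ne_iff.1 k.2
      have h2 := le_multWeight (j := c) hi
      have h3 : 1 ≤ k.1 i := Nat.one_le_iff_ne_zero.2 hi
      nlinarith)
  refine ⟨J, ?_⟩
  rw [hJ]
  congr 1
  have : multWeight c (default : {k : ℕ →₀ ℕ // k = 0}).1 = 0 := by
    rw [(default : {k : ℕ →₀ ℕ // k = 0}).2]
    simp [multWeight]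
  rw [this, zero_smul]
  rfl

theorem genFun_pi {f : ι → ℕ} (hf : FiniteFibers f) (hv : v ≠ 0) (m : ℕ) :
    FiniteFibers (fun x : Fin m → ι => ∑ i, f (x i)) ∧
    genFun (fun x : Fin m → ι => (∑ i, f (x i)) • v) = genFun (fun i => f i • v) ^ m := by
  induction m with
  | zero =>
    refine ⟨fun _ => Set.toFinite _, ?_⟩
    rw [genFun_unique]
    simp
  | succ m ih =>
    have h1 : ∀ x : ι × (Fin m → ι), ∑ i, f (Fin.consEquiv (fun _ => ι) x i) =
        f x.1 + ∑ i, f (x.2 i) := by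
      intro x
      simp [Fin.sum_univ_succ, Fin.consEquiv]
    have h2 := hf.add_nat ih.1
    refine ⟨fun e => ?_, ?_⟩
    · refine ((h2 e).image (Fin.consEquiv fun _ => ι)).subset ?_
      intro x hx
      refine ⟨(Fin.consEquiv fun _ => ι).symm x, ?_, Equiv.apply_symm_apply _ _⟩
      simp only [Set.mem_ofPred_eq] at hx ⊢
      rw [← hx, ← h1, Equiv.apply_symm_apply]
    · rw [← genFun_equiv (Fin.consEquiv fun _ => ι)]
      simp only [h1, add_smul]
      rw [genFun_prod (w := fun i => f i • v) (w' := fun x : Fin m → ι => (∑ i, f (x i)) • v)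
        (hf.smul hv) (ih.1.smul hv), ih.2, pow_succ']

end GeneratingFunction
end TypeD

/-! ### Elementary moves are removals of bars. -/

namespace TypeD

open MayaPair

/-- The changes of a row `(k, h)` with `k` completely filled positions and half-block excess `h`
to a smaller row, in which the removed blocks are close to each other. -/
def RowDrop (k : ℕ) (h : ℤ) (k' : ℕ) (h' : ℤ) : Prop :=
  k' + (twist k' h').toNat ≤ k + (twist k h).toNat ∧
  k' + (-twist k' h').toNat ≤ k + (-twist k h).toNat ∧
  (k + h.natAbs ≤ k' + 2 ∨
    (k' + (-twist k' h').toNat = k + (-twist k h).toNat ∧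
      k + (twist k h).toNat ≤ k' + (twist k' h').toNat + 2) ∨
    (k' + (twist k' h').toNat = k + (twist k h).toNat ∧
      k + (-twist k h).toNat ≤ k' + (-twist k' h').toNat + 2))

theorem rowDrop_refl (k : ℕ) (h : ℤ) : RowDrop k h k h := by
  unfold RowDrop twist
  split_ifs <;> omega

theorem rowDrop_one (k : ℕ) (h : ℤ) (hh : h.natAbs ≤ 1) : RowDrop (k + 1) h k h := by
  unfold RowDrop twist
  split_ifs <;> omega

theorem rowDrop_two (k : ℕ) : RowDrop (k + 2) 0 k 0 := by
  unfold RowDrop twist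
  split_ifs <;> omega

theorem rowDrop_single (k : ℕ) (h : ℤ) (hh : h.natAbs = 1) : RowDrop k h k 0 := by
  unfold RowDrop twist
  split_ifs <;> omega

/-- For `η = -σ` the two beads become an excess of `2 σ`. The value `-2 σ` would have the same size,
but its half-blocks would stick out of the old row on the side where it was shorter. -/
theorem rowDrop_merge (k : ℕ) (η σ : ℤ) (hσ : σ = 1 ∨ σ = -1) (hη : η = 0 ∨ η = -σ) :
    RowDrop (k + 1) η k (σ - η) := by
  unfold RowDrop twist
  split_ifs <;> omega

theorem rowDrop_pair_top (k : ℕ) (h h' : ℤ) (hh : 2 ≤ h ∧ h' = h - 2 ∨ h ≤ -2 ∧ h' = h + 2) :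
    RowDrop k h k h' := by
  unfold RowDrop twist
  split_ifs <;> omega

theorem rowDrop_pair_bottom (k : ℕ) (h h' : ℤ) (hh : 0 ≤ h ∧ h' = h + 2 ∨ h < 0 ∧ h' = h - 2) :
    RowDrop (k + 2) h k h' := by
  unfold RowDrop twist
  split_ifs <;> omega

namespace Config

variable {g : ℕ} {C C' : Config}

theorem exists_len_eq_inner (r : ℕ) : ∃ s, (s = Side.full ↔ ¬ g ∣ r) ∧ ¬ (r = 0 ∧ s = Side.lhd) ∧
    C.len g r s = C.inner g r := by
  by_cases hr : g ∣ r
  · by_cases h0 : r = 0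
    · exact ⟨Side.nabla, by simp [hr], by simp, len_of_halfAt (by rw [h0, halfAt_zero]) _⟩
    · have h := min_len (C := C) (g := g) r
      rcases le_total (C.lhdLen g r) (C.nablaLen g r) with h1 | h1
      · exact ⟨Side.lhd, by simp [hr], by simp [h0], by rw [← h, min_eq_left h1]; rfl⟩
      · exact ⟨Side.nabla, by simp [hr], by simp, by rw [← h, min_eq_right h1]; rfl⟩
  · exact ⟨Side.full, by simp [hr], by simp, len_of_halfAt (halfAt_of_not_dvd hr) _⟩

theorem exists_len_eq_outer (r : ℕ) : ∃ s, (s = Side.full ↔ ¬ g ∣ r) ∧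
    C.len g r s = C.outer g r := by
  by_cases hr : g ∣ r
  · have h := max_len (C := C) (g := g) r
    rcases le_total (C.lhdLen g r) (C.nablaLen g r) with h1 | h1
    · exact ⟨Side.nabla, by simp [hr], by rw [← h, max_eq_right h1]; rfl⟩
    · exact ⟨Side.lhd, by simp [hr], by rw [← h, max_eq_left h1]; rfl⟩
  · refine ⟨Side.full, by simp [hr], ?_⟩
    rw [len_of_halfAt (halfAt_of_not_dvd hr), outer, halfAt_of_not_dvd hr]
    simp

theorem mem_diff (hg : 0 < g) (c r : ℕ) (s : Side) :
    (⟨c, r, s⟩ : Block) ∈ (C.toWall g hg).carrier \ (C'.toWall g hg).carrier ↔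
      (s = Side.full ↔ ¬ g ∣ r) ∧ ¬ (r = 0 ∧ s = Side.lhd) ∧ C'.len g r s ≤ c ∧ c < C.len g r s := by
  simp only [Set.mem_sdiff, mem_toWall, isBlock_iff, IsGrey]
  by_cases h1 : s = Side.full ↔ ¬ g ∣ r <;> by_cases h2 : r = 0 ∧ s = Side.lhd <;>
  simp [h1, h2]
  exact and_comm

/-- A criterion for the removability of a bar, in terms of the lengths of the rows. -/
theorem not_isCore_of_rowDrop (hg : 0 < g) {r₀ r₁ : ℕ} (h01 : r₀ < r₁)
    (hw : ∀ j ≤ g + 2, C.labelCount g hg j = C'.labelCount g hg j + barWeight (g + 2) j)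
    (hdrop : ∀ r, RowDrop (C.inner g r) (C.halfAt g r) (C'.inner g r) (C'.halfAt g r))
    (hout : ∀ r, r < r₀ ∨ r₁ < r → C'.inner g r = C.inner g r ∧ C'.halfAt g r = C.halfAt g r)
    (hin : ∀ r, r₀ ≤ r → r < r₁ → C'.inner g r < C.inner g r)
    (hot : ∀ r, r₀ < r → r ≤ r₁ → C'.outer g r < C.outer g r) :
    ¬ IsCore (g + 2) (C.toWall g hg) := by
  set S := (C.toWall g hg).carrier \ (C'.toWall g hg).carrier with hS
  have hle : ∀ r s, C'.len g r s ≤ C.len g r s := by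
    intro r s
    have := hdrop r
    cases s
    · exact this.1
    · exact this.1
    · exact this.2.1
  have hsub : (C'.toWall g hg).carrier ⊆ (C.toWall g hg).carrier := by
    rintro ⟨c, r, s⟩ ⟨h1, h2⟩
    exact ⟨h1, h2.imp id fun h => lt_of_lt_of_le h (hle _ _)⟩
  have hgrey : ∀ b ∈ S, ¬ IsGrey b := by
    intro b hb h
    exact hb.2 ((C'.toWall g hg).grey_mem b ((C.toWall g hg).isBlock b hb.1) h)
  have hrow : ∀ b ∈ S, r₀ ≤ b.row ∧ b.row ≤ r₁ := by
    rintro ⟨c, r, s⟩ hb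
    rw [hS, mem_diff] at hb
    by_contra hcon
    obtain ⟨h1, h2⟩ := hout r (by simp only at hcon; omega)
    have : C'.len g r s = C.len g r s := by
      cases s <;> simp only [len, lhdLen, nablaLen, h1, h2]
    omega
  -- The last clause of `RowDrop` confines the blocks removed from one row to two neighbouring
  -- columns, so any two of them touch.
  have hthin : ∀ b ∈ S, ∀ b' ∈ S, b.row = b'.row → b.col ≤ b'.col + 1 := by
    rintro ⟨c, r, s⟩ hb ⟨c', r', s'⟩ hb' hr
    simp only at hr
    subst hr
    rw [hS, mem_diff] at hb hb'
    obtain ⟨_, _, h1, h2⟩ := hb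
    obtain ⟨_, _, h1', h2'⟩ := hb'
    simp only
    rcases (hdrop r).2.2 with h | h | h
    · have e1 := (len_bounds (C := C) (g := g) r s).2
      have e2 := (len_bounds (C := C') (g := g) r s').1
      unfold outer at e1
      omega
    · cases s <;> cases s' <;> simp only [len, lhdLen, nablaLen] at h1 h2 h1' h2' <;> omega
    · cases s <;> cases s' <;> simp only [len, lhdLen, nablaLen] at h1 h2 h1' h2' <;> omega
  have hinner : ∀ r, r₀ ≤ r → r < r₁ → ∃ b ∈ S, b.row = r ∧ b.col + 1 = C.inner g r := by
    intro r h1 h2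
    obtain ⟨s, hs, hs0, hs1⟩ := exists_len_eq_inner (C := C') (g := g) r
    have h3 := hin r h1 h2
    have h4 := (len_bounds (C := C) (g := g) r s).1
    refine ⟨⟨C.inner g r - 1, r, s⟩, ?_, rfl, by simp only; omega⟩
    rw [hS, mem_diff]
    exact ⟨hs, hs0, by omega, by omega⟩
  have houter : ∀ r, r₀ < r → r ≤ r₁ → ∃ b ∈ S, b.row = r ∧ b.col + 1 = C.outer g r := by
    intro r h1 h2
    obtain ⟨s, hs, hs1⟩ := exists_len_eq_outer (C := C) (g := g) r
    have h3 := hot r h1 h2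
    have h4 := (len_bounds (C := C') (g := g) r s).2
    refine ⟨⟨C.outer g r - 1, r, s⟩, ?_, rfl, by simp only; omega⟩
    rw [hS, mem_diff]
    exact ⟨hs, by omega, by omega, by omega⟩
  have hreach : ∀ (b b' : Block) (hb : b ∈ S) (hb' : b' ∈ S), b.row = b'.row →
      (touching.induce S).Reachable ⟨b, hb⟩ ⟨b', hb'⟩ := by
    intro b b' hb hb' hr
    by_cases hbb : b = b'
    · subst hbb
      exact SimpleGraph.Reachable.refl _
    · apply SimpleGraph.Adj.reachable
      have : touching.Adj b b' :=
        ⟨hbb, hthin b hb b' hb' hr, hthin b' hb' b hb hr.symm, by omega, by omega⟩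
      exact this
  obtain ⟨b₀, hb₀, hb₀r, -⟩ := hinner r₀ le_rfl h01
  have hconn : ∀ d, ∀ b (hb : b ∈ S), b.row = r₀ + d →
      (touching.induce S).Reachable ⟨b₀, hb₀⟩ ⟨b, hb⟩ := by
    intro d
    induction d with
    | zero =>
      intro b hb hr
      exact hreach _ _ _ _ (by omega)
    | succ d ih =>
      intro b hb hr
      have hr1 := (hrow b hb).2
      -- The last filled position of a row and the last nonempty position of the next row both lose
      -- a block. Their columns differ by at most one since `outer (r + 1) ≤ inner r ≤ outer (r + 1)
      -- + 1`, so removed blocks of consecutive rows are linked.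
      obtain ⟨b₁, hb₁, hb₁r, hb₁c⟩ := hinner (r₀ + d) (by omega) (by omega)
      obtain ⟨b₂, hb₂, hb₂r, hb₂c⟩ := houter (r₀ + d + 1) (by omega) (by omega)
      refine ((ih b₁ hb₁ hb₁r).trans ?_).trans (hreach b₂ b hb₂ hb (by omega))
      apply SimpleGraph.Adj.reachable
      have e1 := inner_le_outer_succ (C := C) hg (r₀ + d)
      have e2 := outer_succ_le (C := C) hg (r₀ + d)
      have : touching.Adj b₁ b₂ :=
        ⟨fun h => by rw [h] at hb₁r; omega, by omega, by omega, by omega, by omega⟩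
      exact this
  rw [IsCore, not_not]
  refine ⟨C'.toWall g hg, hsub, ?_, ?_, ?_, ?_⟩
  · exact (C.toWall g hg).finite_white.subset fun b hb => ⟨hb.1, hgrey b hb⟩
  · exact fun b hb => ⟨(C.toWall g hg).isBlock b hb.1, hgrey b hb⟩
  · intro j hj
    have h1 : {b ∈ S | label (g + 2) b = j} =
        {b ∈ (C.toWall g hg).carrier | ¬ IsGrey b ∧ label (g + 2) b = j} \
        {b ∈ (C'.toWall g hg).carrier | ¬ IsGrey b ∧ label (g + 2) b = j} := by
      ext b
      simp only [Set.mem_sdiff, Set.mem_ofPred_eq]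
      constructor
      · rintro ⟨h1, h2⟩
        exact ⟨⟨h1.1, hgrey b h1, h2⟩, fun h => h1.2 h.1⟩
      · rintro ⟨⟨h1, h2, h3⟩, h4⟩
        exact ⟨⟨h1, fun h => h4 ⟨h, h2, h3⟩⟩, h3⟩
    have h2 := hw j hj
    unfold labelCount at h2
    have h3 : {b ∈ (C'.toWall g hg).carrier | ¬ IsGrey b ∧ label (g + 2) b = j} ⊆
        {b ∈ (C.toWall g hg).carrier | ¬ IsGrey b ∧ label (g + 2) b = j} :=
      fun b hb => ⟨hsub hb.1, hb.2⟩
    have h4 : {b ∈ (C'.toWall g hg).carrier | ¬ IsGrey b ∧ label (g + 2) b = j}.Finite :=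
      (C'.toWall g hg).finite_white.subset fun b hb => ⟨hb.1, hb.2.1⟩
    rw [h1, Set.ncard_sdiff h3 h4, h2]
    omega
  · rw [SimpleGraph.connected_iff_exists_forall_reachable]
    refine ⟨⟨b₀, hb₀⟩, ?_⟩
    rintro ⟨b, hb⟩
    exact hconn (b.row - r₀) b hb (by have := (hrow b hb).1; omega)

/-- The changes of a configuration by which the multi-weight drops by that of a bar. -/
theorem labelCount_eq_add_barWeight (hg : 2 ≤ g)
    (hS : ∀ f : ℕ → ℕ, (∀ x, f (x + 2 * g) = f x + 2) → (∀ x < g, f x + f (2 * g - 1 - x) = 2) →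
      ∑ x ∈ C.full, f x + C.halfSize = ∑ x ∈ C'.full, f x + C'.halfSize + 2)
    (hD : ((C.inner g 0 % 2 : ℕ) : ℤ) - (C.half.sum fun i h => if i % 2 = 1 then oddSign h else 0) =
      ((C'.inner g 0 % 2 : ℕ) : ℤ) - (C'.half.sum fun i h => if i % 2 = 1 then oddSign h else 0))
    (hB : (C.half.sum fun i h => if i % 2 = 0 then oddSign h else 0) =
      C'.half.sum fun i h => if i % 2 = 0 then oddSign h else 0) (j : ℕ) (hj : j ≤ g + 2) :
    C.labelCount g (by omega) j = C'.labelCount g (by omega) j + barWeight (g + 2) j := by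
  rw [← labelCount_zero_sub_one hg, ← labelCount_zero_sub_one hg] at hD
  rw [← labelCount_last_sub hg, ← labelCount_last_sub hg] at hB
  have hadd : ∀ x, (x + 2 * g) / (2 * g) = x / (2 * g) + 1 := fun x =>
    Nat.add_div_right x (by omega)
  have hmod : ∀ x, (x + 2 * g) % (2 * g) = x % (2 * g) := fun x => Nat.add_mod_right _ _
  have hsmall : ∀ x < g, x / (2 * g) = 0 ∧ (2 * g - 1 - x) / (2 * g) = 0 ∧ x % (2 * g) = x ∧
      (2 * g - 1 - x) % (2 * g) = 2 * g - 1 - x := fun x hx =>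
    ⟨Nat.div_eq_of_lt (by omega), Nat.div_eq_of_lt (by omega), Nat.mod_eq_of_lt (by omega),
      Nat.mod_eq_of_lt (by omega)⟩
  -- The counts of the labels `2, …, n - 2` and the joint counts of `0, 1` and of `n - 1, n` all
  -- have the form treated by `hS`, so each drops by two. The invariance of the differences in `hD`
  -- and `hB` then splits the joint drops evenly.
  have h1 := hS (fun x => 2 * (x / (2 * g)) + 1) (fun x => by rw [hadd]; ring) (fun x hx => by
    obtain ⟨e1, e2, -, -⟩ := hsmall x hx
    rw [e1, e2])
  rw [← labelCount_zero_add_one hg, ← labelCount_zero_add_one hg] at h1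
  have h2 := hS (fun x => 2 * (x / (2 * g)) + 2 * if g ≤ x % (2 * g) then 1 else 0)
    (fun x => by rw [hadd, hmod]; ring) (fun x hx => by
    obtain ⟨e1, e2, e3, e4⟩ := hsmall x hx
    rw [e1, e2, e3, e4, if_neg (by omega), if_pos (by omega)])
  rw [← labelCount_last_add hg, ← labelCount_last_add hg] at h2
  unfold barWeight
  by_cases hj2 : 2 ≤ j ∧ j ≤ g
  · have h3 := hS (fun x => 2 * (x / (2 * g)) + (if j - 1 ≤ x % (2 * g) then 1 else 0) +
        if 2 * g + 1 - j ≤ x % (2 * g) then 1 else 0)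
      (fun x => by rw [hadd, hmod]; ring) (fun x hx => by
      obtain ⟨e1, e2, e3, e4⟩ := hsmall x hx
      rw [e1, e2, e3, e4]
      split_ifs <;> omega)
    rw [← labelCount_full hg hj2.1 hj2.2, ← labelCount_full hg hj2.1 hj2.2] at h3
    rw [if_neg (by omega), h3]
  · rw [if_pos (by omega)]
    obtain rfl | rfl | rfl | rfl : j = 0 ∨ j = 1 ∨ j = g + 1 ∨ j = g + 2 := by omega
    all_goals omega

theorem inner_mk (F : Finset ℕ) (H : ℕ →₀ ℤ) (r : ℕ) : inner g ⟨F, H⟩ r =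
    (F.filter (r ≤ ·)).card + H.sum fun i h => if r < (i + 1) * g then h.natAbs else 0 := rfl

theorem card_filter_insert {F : Finset ℕ} {x : ℕ} (hx : x ∉ F) (r : ℕ) :
    ((insert x F).filter (r ≤ ·)).card = (F.filter (r ≤ ·)).card + if r ≤ x then 1 else 0 := by
  rw [Finset.filter_insert]
  split_ifs
  · rw [Finset.card_insert_of_notMem (by simp [hx])]
  · rfl

theorem sum_update {A : Type*} [AddCommMonoid A] (H : ℕ →₀ ℤ) (i : ℕ) (y : ℤ) (w : ℕ → ℤ → A)
    (hw : ∀ i, w i 0 = 0) : (H.update i y).sum w + w i (H i) = H.sum w + w i y := by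
  classical
  rw [← Finsupp.add_sum_erase' H i w hw, ← Finsupp.add_sum_erase' (H.update i y) i w hw]
  have h1 : (H.update i y).erase i = H.erase i := by
    ext j
    by_cases hj : j = i
    · simp [hj]
    · simp [Finsupp.erase_ne hj]
  rw [h1]
  simp only [Finsupp.coe_update, Function.update_self]
  abel

theorem inner_update (F : Finset ℕ) (H : ℕ →₀ ℤ) (i : ℕ) (y : ℤ) (r : ℕ) :
    inner g ⟨F, H.update i y⟩ r + (if r < (i + 1) * g then (H i).natAbs else 0) =
      inner g ⟨F, H⟩ r + if r < (i + 1) * g then y.natAbs else 0 := by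
  have := sum_update H i y (fun i h => if r < (i + 1) * g then h.natAbs else 0) (by simp)
  rw [inner_mk, inner_mk]
  omega

theorem halfAt_update (hg : 0 < g) (F : Finset ℕ) (H : ℕ →₀ ℤ) (i : ℕ) (y : ℤ) (r : ℕ) :
    halfAt g ⟨F, H.update i y⟩ r = if r = (i + 1) * g then y else halfAt g ⟨F, H⟩ r := by
  by_cases hr : g ∣ r ∧ r ≠ 0
  · obtain ⟨⟨k, rfl⟩, h0⟩ := hr
    obtain ⟨k, rfl⟩ : ∃ j, k = j + 1 := ⟨k - 1, by
      rcases k with _ | k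
      · simp at h0
      · simp⟩
    rw [mul_comm, halfAt_succ_mul hg, halfAt_succ_mul hg]
    by_cases hk : k = i
    · subst hk; simp
    · rw [if_neg]
      · simp [hk]
      · intro h
        have := Nat.eq_of_mul_eq_mul_right hg h
        omega
  · have : r ≠ (i + 1) * g := by
      rintro rfl
      exact hr ⟨Dvd.intro_left _ rfl, by positivity⟩
    rw [if_neg this, halfAt, halfAt, if_neg hr, if_neg hr]

theorem halfAt_mk (F F' : Finset ℕ) (H : ℕ →₀ ℤ) (r : ℕ) :
    halfAt g ⟨F, H⟩ r = halfAt g ⟨F', H⟩ r := rfl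

theorem natAbs_halfAt_le (h : ∀ i, (C.half i).natAbs ≤ 1) (r : ℕ) : (C.halfAt g r).natAbs ≤ 1 := by
  unfold halfAt
  split_ifs
  · exact h _
  · simp

/-- A bead of a full column moves down its runner. -/
theorem not_isCore_of_full (hg : 2 ≤ g) (h1 : ∀ i, (C.half i).natAbs ≤ 1) {x : ℕ}
    (hx : x + 2 * g ∈ C.full) (hx' : x ∉ C.full) : ¬ IsCore (g + 2) (C.toWall g (by omega)) := by
  obtain ⟨F, H⟩ := C
  simp only at h1 hx hx'
  obtain ⟨F', hF', rfl⟩ : ∃ F', x + 2 * g ∉ F' ∧ F = insert (x + 2 * g) F' :=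
    ⟨F.erase (x + 2 * g), by simp, (Finset.insert_erase hx).symm⟩
  have hxF : x ∉ F' := fun h => hx' (Finset.mem_insert_of_mem h)
  have hi : ∀ r, inner g ⟨insert (x + 2 * g) F', H⟩ r =
      inner g ⟨insert x F', H⟩ r + if x < r ∧ r ≤ x + 2 * g then 1 else 0 := by
    intro r
    rw [inner_mk, inner_mk, card_filter_insert hF', card_filter_insert hxF]
    split_ifs <;> omega
  have hh := natAbs_halfAt_le (g := g) (C := ⟨insert (x + 2 * g) F', H⟩) h1
  refine not_isCore_of_rowDrop (C' := ⟨insert x F', H⟩) (by omega)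
    (show x + 1 < x + 2 * g by omega) ?_ ?_ ?_ ?_ ?_
  · refine labelCount_eq_add_barWeight hg ?_ ?_ rfl
    · intro f hf _
      have : halfSize ⟨insert (x + 2 * g) F', H⟩ = halfSize ⟨insert x F', H⟩ := rfl
      simp only [Finset.sum_insert hF', Finset.sum_insert hxF, hf, this]
      ring
    · rw [hi, if_neg (by omega)]
      rfl
  · intro r
    rw [hi]
    split_ifs
    · exact rowDrop_one _ _ (hh r)
    · exact rowDrop_refl _ _
  · intro r hr
    rw [hi, if_neg (by omega)]
    exact ⟨rfl, rfl⟩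
  · intro r h2 h3
    rw [hi, if_pos (by omega)]
    omega
  · intro r h2 h3
    have e : halfAt g ⟨insert (x + 2 * g) F', H⟩ r = halfAt g ⟨insert x F', H⟩ r := rfl
    unfold outer
    rw [hi, if_pos (by omega), e]
    omega

/-- Two beads on opposite runners annihilate. -/
theorem not_isCore_of_opposite (hg : 2 ≤ g) (h1 : ∀ i, (C.half i).natAbs ≤ 1) {x : ℕ} (hxg : x < g)
    (hx : x ∈ C.full) (hy : 2 * g - 1 - x ∈ C.full) :
    ¬ IsCore (g + 2) (C.toWall g (by omega)) := by
  obtain ⟨F, H⟩ := C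
  simp only at h1 hx hy
  set y := 2 * g - 1 - x with hyd
  obtain ⟨F₁, hF₁, rfl⟩ : ∃ F', x ∉ F' ∧ F = insert x F' :=
    ⟨F.erase x, by simp, (Finset.insert_erase hx).symm⟩
  have hy' : y ∈ F₁ := by
    rcases Finset.mem_insert.1 hy with h | h
    · omega
    · exact h
  obtain ⟨F', hF', rfl⟩ : ∃ F', y ∉ F' ∧ F₁ = insert y F' :=
    ⟨F₁.erase y, by simp, (Finset.insert_erase hy').symm⟩
  have hi : ∀ r, inner g ⟨insert x (insert y F'), H⟩ r =
      inner g ⟨F', H⟩ r + (if r ≤ x then 1 else 0) + if r ≤ y then 1 else 0 := by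
    intro r
    rw [inner_mk, inner_mk, card_filter_insert hF₁, card_filter_insert hF']
    split_ifs <;> omega
  have hh := natAbs_halfAt_le (g := g) (C := ⟨insert x (insert y F'), H⟩) h1
  refine not_isCore_of_rowDrop (C' := ⟨F', H⟩) (by omega)
    (show 0 < y by omega) ?_ ?_ ?_ ?_ ?_
  · refine labelCount_eq_add_barWeight hg ?_ ?_ rfl
    · intro f _ hf
      have : halfSize ⟨insert x (insert y F'), H⟩ = halfSize ⟨F', H⟩ := rfl
      have h2 := hf x hxg
      rw [← hyd] at h2
      simp only [Finset.sum_insert hF₁, Finset.sum_insert hF', this]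
      omega
    · rw [hi, if_pos (by omega), if_pos (by omega), Nat.add_assoc, Nat.add_mod_right]
  · intro r
    rw [hi]
    -- Below `x` a row loses two positions. Since `r ≤ x < g`, such a row carries no excess.
    by_cases h2 : r ≤ x
    · have h3 : halfAt g ⟨insert x (insert y F'), H⟩ r = 0 := by
        rcases Nat.eq_zero_or_pos r with rfl | h0
        · exact halfAt_zero
        · exact halfAt_of_not_dvd (Nat.not_dvd_of_pos_of_lt h0 (by omega))
      rw [if_pos h2, if_pos (by omega), h3, halfAt_mk F' (insert x (insert y F')), h3]
      exact rowDrop_two _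
    · rw [if_neg h2, add_zero]
      split_ifs
      · exact rowDrop_one _ _ (hh r)
      · exact rowDrop_refl _ _
  · intro r hr
    rw [hi, if_neg (by omega), if_neg (by omega)]
    exact ⟨rfl, rfl⟩
  · intro r h2 h3
    rw [hi, if_pos (show r ≤ y by omega)]
    omega
  · intro r h2 h3
    have e : halfAt g ⟨insert x (insert y F'), H⟩ r = halfAt g ⟨F', H⟩ r := rfl
    unfold outer
    rw [hi, if_pos (show r ≤ y by omega), e]
    omega

theorem halfAt_of_between {k r : ℕ} (h1 : k * g < r) (h2 : r < (k + 1) * g) : C.halfAt g r = 0 := by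
  apply halfAt_of_not_dvd
  rintro ⟨m, rfl⟩
  rw [mul_comm] at h1 h2
  have h3 : k < m := lt_of_mul_lt_mul_left h1 (Nat.zero_le g)
  have h4 : m < k + 1 := lt_of_mul_lt_mul_right h2 (Nat.zero_le g)
  omega

theorem halfSize_update (F : Finset ℕ) (H : ℕ →₀ ℤ) (i : ℕ) (y : ℤ) :
    halfSize ⟨F, H.update i y⟩ + (i + 1) * (H i).natAbs = halfSize ⟨F, H⟩ + (i + 1) * y.natAbs :=
  sum_update H i y (fun i h => (i + 1) * h.natAbs) (by simp)

theorem sum_oddSign_update (b : ℕ) (H : ℕ →₀ ℤ) (i : ℕ) (y : ℤ) :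
    ((H.update i y).sum fun i h => if i % 2 = b then oddSign h else 0) +
      (if i % 2 = b then oddSign (H i) else 0) =
    (H.sum fun i h => if i % 2 = b then oddSign h else 0) + if i % 2 = b then oddSign y else 0 :=
  sum_update H i y (fun i h => if i % 2 = b then oddSign h else 0) (by simp [oddSign])

theorem oddSign_shift {h h' : ℤ} (hh : 2 ≤ h ∧ h' = h - 2 ∨ h ≤ -2 ∧ h' = h + 2) :
    oddSign h' = oddSign h := by
  unfold oddSign
  rcases hh with ⟨h1, rfl⟩ | ⟨h1, rfl⟩
  · split_ifs <;> try omega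
    · rw [Int.sign_eq_one_of_pos (by omega), Int.sign_eq_one_of_pos (by omega)]
  · split_ifs <;> try omega
    · rw [Int.sign_eq_neg_one_of_neg (by omega), Int.sign_eq_neg_one_of_neg (by omega)]

/-- Two beads at the same place move down together. -/
theorem not_isCore_of_pair (hg : 2 ≤ g) {i : ℕ} (hi2 : 2 ≤ (C.half i).natAbs) :
    ¬ IsCore (g + 2) (C.toWall g (by omega)) := by
  obtain ⟨F, H⟩ := C
  simp only at hi2
  -- Two beads leave: the excess moves two steps towards `0`, which does not affect `oddSign`.
  obtain ⟨h', hh'⟩ : ∃ h', 2 ≤ H i ∧ h' = H i - 2 ∨ H i ≤ -2 ∧ h' = H i + 2 := by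
    rcases le_total 0 (H i) with h | h
    · exact ⟨H i - 2, by omega⟩
    · exact ⟨H i + 2, by omega⟩
  have e1 := fun r => inner_update (g := g) F H i h' r
  have e2 := fun r => halfAt_update (by omega : 0 < g) F H i h' r
  have e3 := halfSize_update F H i h'
  have e4 := fun b => sum_oddSign_update b H i h'
  have e5 := oddSign_shift hh'
  have e6 : (H i).natAbs = h'.natAbs + 2 := by omega
  rw [e6] at e3
  -- From the lowest half-row the pair leaves the abacus altogether. Otherwise it joins the half-row
  -- below, whose excess moves two steps away from `0`.
  rcases i with _ | i
  · simp only [zero_add, one_mul] at e1 e2 e3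
    refine not_isCore_of_rowDrop (C' := ⟨F, H.update 0 h'⟩) (by omega)
      (show 0 < g by omega) ?_ ?_ ?_ ?_ ?_
    · refine labelCount_eq_add_barWeight hg ?_ ?_ ?_
      · intro f _ _
        simp only
        omega
      · have h1 := e1 0
        have h2 := e4 1
        rw [if_pos (by omega), if_pos (by omega)] at h1
        rw [e5] at h2
        simp only
        omega
      · have h2 := e4 0
        rw [e5] at h2
        simp only
        omega
    · intro r
      have h1 := e1 r
      rw [e2]
      rcases lt_trichotomy r g with h | h | h
      · rw [if_pos h, if_pos h] at h1
        have h3 : halfAt g ⟨F, H⟩ r = 0 := by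
          rcases Nat.eq_zero_or_pos r with rfl | h0
          · exact halfAt_zero
          · exact halfAt_of_not_dvd (Nat.not_dvd_of_pos_of_lt h0 h)
        rw [if_neg h.ne, h3, show inner g ⟨F, H⟩ r = inner g ⟨F, H.update 0 h'⟩ r + 2 by omega]
        exact rowDrop_two _
      · subst h
        simp only [lt_irrefl, if_false, add_zero] at h1
        have h4 := halfAt_succ_mul (C := ⟨F, H⟩) (by omega : 0 < r) 0
        rw [zero_add, one_mul] at h4
        rw [if_pos rfl, h1, h4]
        exact rowDrop_pair_top _ _ _ hh'
      · rw [if_neg (by omega), if_neg (by omega)] at h1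
        rw [if_neg (by omega), show inner g ⟨F, H.update 0 h'⟩ r = inner g ⟨F, H⟩ r by omega]
        exact rowDrop_refl _ _
    · intro r hr
      have h1 := e1 r
      rw [if_neg (by omega), if_neg (by omega)] at h1
      rw [e2, if_neg (by omega)]
      exact ⟨by omega, rfl⟩
    · intro r _ hr
      have h1 := e1 r
      rw [if_pos (by omega), if_pos (by omega)] at h1
      omega
    · intro r h0 hr
      have h1 := e1 r
      unfold outer
      rw [e2]
      rcases hr.lt_or_eq with h | rfl
      · rw [if_pos h, if_pos h] at h1
        rw [if_neg h.ne]
        omega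
      · have h4 := halfAt_succ_mul (C := ⟨F, H⟩) (by omega : 0 < r) 0
        rw [zero_add, one_mul] at h4
        rw [if_neg (by omega), if_neg (by omega)] at h1
        rw [if_pos rfl, h4]
        simp only
        omega
  · obtain ⟨k', hk'⟩ : ∃ k', 0 ≤ H i ∧ k' = H i + 2 ∨ H i < 0 ∧ k' = H i - 2 := by
      rcases le_or_gt 0 (H i) with h | h
      · exact ⟨H i + 2, by omega⟩
      · exact ⟨H i - 2, by omega⟩
    have hne : (H.update (i + 1) h') i = H i := by simp
    have f1 := fun r => inner_update (g := g) F (H.update (i + 1) h') i k' r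
    have f2 := fun r => halfAt_update (by omega : 0 < g) F (H.update (i + 1) h') i k' r
    have f3 := halfSize_update F (H.update (i + 1) h') i k'
    have f4 := fun b => sum_oddSign_update b (H.update (i + 1) h') i k'
    have f5 : oddSign k' = oddSign (H i) := by
      rcases eq_or_ne (H i) 0 with h0 | h0
      · have : k' = 2 := by omega
        rw [this, h0]; rfl
      · rcases hk' with ⟨h1, h2⟩ | ⟨h1, h2⟩
        · exact (oddSign_shift (Or.inl ⟨by omega, by omega⟩)).symm
        · exact (oddSign_shift (Or.inr ⟨by omega, by omega⟩)).symm
    have f6 : k'.natAbs = (H i).natAbs + 2 := by omega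
    rw [hne] at f3
    simp only [hne] at f1 f4
    rw [f6] at f3
    have hlt : (i + 1) * g < (i + 1 + 1) * g := Nat.mul_lt_mul_of_pos_right (by omega) (by omega)
    have htop := halfAt_succ_mul (C := ⟨F, H⟩) (by omega : 0 < g) (i + 1)
    have hbot := halfAt_succ_mul (C := ⟨F, H⟩) (by omega : 0 < g) i
    have hdiff : ∀ r, inner g ⟨F, H⟩ r = inner g ⟨F, (H.update (i + 1) h').update i k'⟩ r +
        if (i + 1) * g ≤ r ∧ r < (i + 1 + 1) * g then 2 else 0 := by
      intro r
      have h1 := e1 r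
      have h2 := f1 r
      split_ifs at h1 h2 ⊢ <;> omega
    refine not_isCore_of_rowDrop (C' := ⟨F, (H.update (i + 1) h').update i k'⟩) (by omega) hlt
      ?_ ?_ ?_ ?_ ?_
    · refine labelCount_eq_add_barWeight hg ?_ ?_ ?_
      · intro f _ _
        simp only
        nlinarith
      · have h2 := e4 1
        have h3 := f4 1
        have h4 : 0 < (i + 1) * g := by positivity
        rw [e5] at h2
        rw [f5] at h3
        rw [hdiff 0, if_neg (by omega)]
        simp only
        omega
      · have h2 := e4 0
        have h3 := f4 0
        rw [e5] at h2
        rw [f5] at h3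
        simp only
        omega
    · intro r
      rw [f2, e2, hdiff]
      by_cases hr1 : r = (i + 1) * g
      · rw [if_pos hr1, if_pos (by omega), hr1, hbot]
        exact rowDrop_pair_bottom _ _ _ hk'
      · rw [if_neg hr1]
        by_cases hr2 : r = (i + 1 + 1) * g
        · rw [if_pos hr2, if_neg (by omega), hr2, htop]
          exact rowDrop_pair_top _ _ _ hh'
        · rw [if_neg hr2]
          split_ifs with h
          · rw [halfAt_of_between (k := i + 1) (by omega) h.2]
            exact rowDrop_two _
          · exact rowDrop_refl _ _
    · intro r hr
      rw [f2, e2, hdiff, if_neg (by omega), if_neg (by omega), if_neg (by omega)]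
      exact ⟨rfl, rfl⟩
    · intro r h1 h2
      rw [hdiff, if_pos ⟨h1, h2⟩]
      omega
    · intro r h1 h2
      unfold outer
      rw [f2, e2, hdiff, if_neg (by omega)]
      rcases h2.lt_or_eq with h | h
      · rw [if_neg (by omega), if_pos (by omega)]
        omega
      · rw [if_pos h, if_neg (by omega), h, htop]
        simp only
        omega

/-- A single bead moves down by two places. -/
theorem not_isCore_of_single (hg : 2 ≤ g) (h1 : ∀ i, (C.half i).natAbs ≤ 1) {i : ℕ} {σ : ℤ}
    (hσ : σ = 1 ∨ σ = -1) (hi : C.half (i + 2) = σ) (hi' : C.half i = 0 ∨ C.half i = -σ) :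
    ¬ IsCore (g + 2) (C.toWall g (by omega)) := by
  obtain ⟨F, H⟩ := C
  have hh := natAbs_halfAt_le (g := g) (C := ⟨F, H⟩) h1
  simp only at h1 hi hi'
  have e1 := fun r => inner_update (g := g) F H (i + 2) 0 r
  have e2 := fun r => halfAt_update (by omega : 0 < g) F H (i + 2) 0 r
  have e3 := halfSize_update F H (i + 2) 0
  have e4 := fun b => sum_oddSign_update b H (i + 2) 0
  have hne : (H.update (i + 2) 0) i = H i := by simp
  have f1 := fun r => inner_update (g := g) F (H.update (i + 2) 0) i (σ - H i) r
  have f2 := fun r => halfAt_update (by omega : 0 < g) F (H.update (i + 2) 0) i (σ - H i) r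
  have f3 := halfSize_update F (H.update (i + 2) 0) i (σ - H i)
  have f4 := fun b => sum_oddSign_update b (H.update (i + 2) 0) i (σ - H i)
  -- If the place below holds a bead of the other sign, the new excess is `2 σ`, with the same size
  -- and the same `oddSign` as the two opposite beads taken together.
  have a1 : oddSign (σ - H i) = oddSign (H i) + oddSign σ := by
    rcases hσ with rfl | rfl <;> rcases hi' with h | h <;> rw [h] <;> rfl
  have a2 : (σ - H i).natAbs = (H i).natAbs + 1 := by omega
  have a3 : σ.natAbs = 1 := by omega
  have a4 : oddSign 0 = 0 := rfl
  rw [hne, a2] at f3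
  simp only [hne, a2] at f1
  simp only [hne, a1] at f4
  simp only [hi, a3, Int.natAbs_zero] at e1 e3
  simp only [hi, a4] at e4
  have hlt : (i + 1) * g < (i + 2 + 1) * g := Nat.mul_lt_mul_of_pos_right (by omega) (by omega)
  have htop := halfAt_succ_mul (C := ⟨F, H⟩) (by omega : 0 < g) (i + 2)
  have hbot := halfAt_succ_mul (C := ⟨F, H⟩) (by omega : 0 < g) i
  simp only [hi] at htop
  have hdiff : ∀ r, inner g ⟨F, H⟩ r = inner g ⟨F, (H.update (i + 2) 0).update i (σ - H i)⟩ r +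
      if (i + 1) * g ≤ r ∧ r < (i + 2 + 1) * g then 1 else 0 := by
    intro r
    have h1 := e1 r
    have h2 := f1 r
    split_ifs at h1 h2 ⊢ <;> omega
  have hpar : (i + 2) % 2 = i % 2 := Nat.add_mod_right i 2
  simp only [hpar] at e4
  refine not_isCore_of_rowDrop (C' := ⟨F, (H.update (i + 2) 0).update i (σ - H i)⟩) (by omega) hlt
    ?_ ?_ ?_ ?_ ?_
  · refine labelCount_eq_add_barWeight hg ?_ ?_ ?_
    · intro f _ _
      simp only
      nlinarith
    · have h2 := e4 1
      have h3 := f4 1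
      have h4 : 0 < (i + 1) * g := by positivity
      rw [hdiff 0, if_neg (by omega)]
      simp only
      split_ifs at h2 h3 <;> omega
    · have h2 := e4 0
      have h3 := f4 0
      simp only
      split_ifs at h2 h3 <;> omega
  · intro r
    rw [f2, e2, hdiff]
    by_cases hr1 : r = (i + 1) * g
    · rw [if_pos hr1, if_pos (by omega), hr1, hbot]
      exact rowDrop_merge _ _ _ hσ hi'
    · rw [if_neg hr1]
      by_cases hr2 : r = (i + 2 + 1) * g
      · rw [if_pos hr2, if_neg (by omega), hr2, htop]
        exact rowDrop_single _ _ a3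
      · rw [if_neg hr2]
        split_ifs with h
        · exact rowDrop_one _ _ (hh r)
        · exact rowDrop_refl _ _
  · intro r hr
    rw [f2, e2, hdiff, if_neg (by omega), if_neg (by omega), if_neg (by omega)]
    exact ⟨rfl, rfl⟩
  · intro r h1 h2
    rw [hdiff, if_pos ⟨h1, h2⟩]
    omega
  · intro r h1 h2
    unfold outer
    rw [f2, e2, hdiff, if_neg (by omega)]
    rcases h2.lt_or_eq with h | h
    · rw [if_neg (by omega), if_pos (by omega)]
      omega
    · rw [if_pos h, if_neg (by omega), h, htop]
      omega

/-- A single bead is removed from the second place. -/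
theorem not_isCore_of_second (hg : 2 ≤ g) (h1 : ∀ i, (C.half i).natAbs ≤ 1) {σ : ℤ}
    (hi : C.half 1 = σ) (hσ : σ = 1 ∧ C.size % 2 = 1 ∨ σ = -1 ∧ C.size % 2 = 0) :
    ¬ IsCore (g + 2) (C.toWall g (by omega)) := by
  obtain ⟨F, H⟩ := C
  have hh := natAbs_halfAt_le (g := g) (C := ⟨F, H⟩) h1
  have hsz : inner g ⟨F, H⟩ 0 = size ⟨F, H⟩ := inner_zero (by omega)
  rw [← hsz] at hσ
  simp only at h1 hi
  have e1 := fun r => inner_update (g := g) F H 1 0 r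
  have e2 := fun r => halfAt_update (by omega : 0 < g) F H 1 0 r
  have e3 := halfSize_update F H 1 0
  have e4 := fun b => sum_oddSign_update b H 1 0
  have a3 : σ.natAbs = 1 := by omega
  have a4 : oddSign 0 = 0 := rfl
  have a5 : oddSign σ = σ := by rcases hσ with ⟨rfl, _⟩ | ⟨rfl, _⟩ <;> rfl
  simp only [hi, a3, Int.natAbs_zero] at e1 e3
  simp only [hi, a4, a5] at e4
  have hlt : 0 < (1 + 1) * g := by omega
  have htop := halfAt_succ_mul (C := ⟨F, H⟩) (by omega : 0 < g) 1
  simp only [hi] at htop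
  have hdiff : ∀ r, inner g ⟨F, H⟩ r = inner g ⟨F, H.update 1 0⟩ r +
      if r < (1 + 1) * g then 1 else 0 := by
    intro r
    have h1 := e1 r
    split_ifs at h1 ⊢ <;> omega
  refine not_isCore_of_rowDrop (C' := ⟨F, H.update 1 0⟩) (by omega) hlt ?_ ?_ ?_ ?_ ?_
  · refine labelCount_eq_add_barWeight hg ?_ ?_ ?_
    · intro f _ _
      simp only
      omega
    -- Removing the column flips the parity of `inner g 0`. The hypothesis on `σ` and the parity
    -- makes this change cancel the lost `oddSign`.
    · have h2 := e4 1
      have h3 := hdiff 0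
      rw [if_pos hlt] at h3
      simp only [Nat.one_mod] at h2 ⊢
      simp only [if_true] at h2
      omega
    · have h2 := e4 0
      simp at h2 ⊢
      exact h2.symm
  · intro r
    rw [e2, hdiff]
    by_cases hr2 : r = (1 + 1) * g
    · rw [if_pos hr2, if_neg (by omega), hr2, htop]
      exact rowDrop_single _ _ a3
    · rw [if_neg hr2]
      split_ifs with h
      · exact rowDrop_one _ _ (hh r)
      · exact rowDrop_refl _ _
  · intro r hr
    rw [e2, hdiff, if_neg (by omega), if_neg (by omega)]
    exact ⟨rfl, rfl⟩
  · intro r _ h2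
    rw [hdiff, if_pos h2]
    omega
  · intro r _ h2
    unfold outer
    rw [e2, hdiff]
    rcases h2.lt_or_eq with h | h
    · rw [if_neg (by omega), if_pos (by omega)]
      omega
    · rw [if_pos h, if_neg (by omega), h, htop]
      omega

theorem succ_mem_evenPair_fst {i : ℕ} : i + 1 ∈ C.evenPair.1 ↔ 2 * i + 1 ∈ C.negSet := by
  rw [← mem_residue one_lt_two]
  unfold evenPair
  simp only
  split_ifs <;> simp

theorem zero_mem_evenPair_fst : 0 ∈ C.evenPair.1 ↔ C.size % 2 = 1 := by
  unfold evenPair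
  simp only
  split_ifs with h <;> simp [h]

/-- A configuration of positive excess is not a core. -/
theorem not_isCore_of_totalExcess (hg : 2 ≤ g) (h : C.totalExcess g ≠ 0) :
    ¬ IsCore (g + 2) (C.toWall g (by omega)) := by
  -- Pairs are treated first; the remaining moves rely on every excess being at most one in absolute
  -- value, which keeps the removed set thin.
  by_cases h2 : ∃ i, 2 ≤ (C.half i).natAbs
  · obtain ⟨i, hi⟩ := h2
    exact not_isCore_of_pair hg hi
  push Not at h2
  have h1 : ∀ i, (C.half i).natAbs ≤ 1 := fun i => by have := h2 i; omega
  have hpos : ∀ {i}, i ∈ C.posSet ↔ C.half i = 1 := fun {i} => by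
    have := h1 i
    rw [mem_posSet, HasPos]; omega
  have hneg : ∀ {i}, i ∈ C.negSet ↔ C.half i = -1 := fun {i} => by
    have := h1 i
    rw [mem_negSet, HasNeg]; omega
  have hk : (C.pairNums.sum fun i k => (i + 1) * k) = 0 := by
    have : C.pairNums = 0 := by
      ext i
      have := h1 i
      change pairNum (C.half i) = 0
      unfold pairNum
      split_ifs <;> omega
    rw [this, Finsupp.sum_zero_index]
  have hone : ∀ {i σ}, (σ = 1 ∨ σ = -1) → C.half (i + 2) = σ → C.half i ≠ σ →
      ¬ IsCore (g + 2) (C.toWall g (by omega)) := fun {i σ} hσ h3 h4 => by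
    have := h1 i
    exact not_isCore_of_single hg h1 hσ h3 (by omega)
  rw [totalExcess, hk, add_zero] at h
  by_cases hr : ∃ s : Fin g, excess (C.runnerPair g s) ≠ 0
  · obtain ⟨s, hs⟩ := hr
    have hs2 := s.2
    have m1 : ∀ i, i ∈ (C.runnerPair g s).1 ↔ 2 * g * i + s ∈ C.full :=
      fun i => mem_residue (by omega)
    have m2 : ∀ i, i ∈ (C.runnerPair g s).2 ↔ 2 * g * i + (2 * g - 1 - s) ∈ C.full :=
      fun i => mem_residue (by omega)
    rcases exists_move hs with ⟨i, h3, h4⟩ | ⟨i, h3, h4⟩ | ⟨h3, h4⟩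
    · rw [m1] at h3 h4
      refine not_isCore_of_full hg h1 (x := 2 * g * i + s) ?_ h4
      convert h3 using 1
      ring
    · rw [m2] at h3 h4
      refine not_isCore_of_full hg h1 (x := 2 * g * i + (2 * g - 1 - s)) ?_ h4
      convert h3 using 1
      ring
    · rw [m1, mul_zero, zero_add] at h3
      rw [m2, mul_zero, zero_add] at h4
      exact not_isCore_of_opposite hg h1 hs2 h3 h4
  · push Not at hr
    rw [Finset.sum_eq_zero fun s _ => hr s, zero_add] at h
    by_cases he : excess C.evenPair = 0
    · have ho : excess C.oddPair ≠ 0 := by omega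
      have m1 : ∀ i, i ∈ C.oddPair.1 ↔ C.half (2 * i + 0) = 1 :=
        fun i => (mem_residue Nat.two_pos).trans hpos
      have m2 : ∀ i, i ∈ C.oddPair.2 ↔ C.half (2 * i + 0) = -1 :=
        fun i => (mem_residue Nat.two_pos).trans hneg
      rcases exists_move ho with ⟨i, h3, h4⟩ | ⟨i, h3, h4⟩ | ⟨h3, h4⟩
      · rw [m1] at h3 h4
        exact hone (Or.inl rfl) h3 h4
      · rw [m2] at h3 h4
        exact hone (Or.inr rfl) h3 h4
      · rw [m1] at h3
        rw [m2] at h4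
        omega
    · have m2 : ∀ i, i ∈ C.evenPair.2 ↔ C.half (2 * i + 1) = 1 :=
        fun i => (mem_residue Nat.one_lt_two).trans hpos
      rcases exists_move he with ⟨i, h3, h4⟩ | ⟨i, h3, h4⟩ | ⟨h3, h4⟩
      · rw [succ_mem_evenPair_fst, hneg] at h3
        -- A move to level `0` of `evenPair` has no half-row to go to: the bead is removed and the
        -- parity of the number of columns changes instead.
        rcases i with _ | i
        · rw [zero_mem_evenPair_fst] at h4
          exact not_isCore_of_second hg h1 h3 (Or.inr ⟨rfl, by omega⟩)
        · rw [succ_mem_evenPair_fst, hneg] at h4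
          exact hone (Or.inr rfl) h3 h4
      · rw [m2] at h3 h4
        exact hone (Or.inl rfl) h3 h4
      · rw [zero_mem_evenPair_fst] at h3
        rw [m2] at h4
        exact not_isCore_of_second hg h1 h4 (Or.inl ⟨rfl, h3⟩)

end Config
end TypeD

/-! ### The Cartan form and the lattice of even vectors. -/

namespace TypeD

open MayaPair

section CartanForm

theorem sum_range_typeA (f : ℕ → ℤ) (k : ℕ) :
    ∑ i ∈ Finset.range (k + 1), ∑ j ∈ Finset.range (k + 1),
      f i * ((if i = j then 2 else if i + 1 = j ∨ j + 1 = i then -1 else 0) * f j) =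
    f 0 ^ 2 + ∑ i ∈ Finset.range k, (f i - f (i + 1)) ^ 2 + f k ^ 2 := by
  induction k with
  | zero => simp; ring
  | succ k ih =>
    have h1 : ∑ i ∈ Finset.range (k + 1), f i * ((if i = k + 1 then 2 else
        if i + 1 = k + 1 ∨ k + 1 + 1 = i then -1 else 0) * f (k + 1)) = - (f k * f (k + 1)) := by
      rw [Finset.sum_eq_single k]
      · rw [if_neg (by omega), if_pos (by omega)]; ring
      · intro i hi hik
        rw [Finset.mem_range] at hi
        rw [if_neg (by omega), if_neg (by omega)]; ring
      · simp
    have h2 : ∑ j ∈ Finset.range (k + 1), f (k + 1) * ((if k + 1 = j then 2 else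
        if k + 1 + 1 = j ∨ j + 1 = k + 1 then -1 else 0) * f j) = - (f k * f (k + 1)) := by
      rw [Finset.sum_eq_single k]
      · rw [if_neg (by omega), if_pos (by omega)]; ring
      · intro i hi hik
        rw [Finset.mem_range] at hi
        rw [if_neg (by omega), if_neg (by omega)]; ring
      · simp
    rw [Finset.sum_range_succ]
    simp only [Finset.sum_range_succ _ (k + 1)]
    rw [Finset.sum_add_distrib, ih, h1, h2, Finset.sum_range_succ _ k]
    simp only [if_true]
    ring

/-- The squares are those of the coordinates, up to sign, of `∑ f i • α i` in an orthonormal basis,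
where the simple roots are `e i - e (i + 1)` and, for the last one, the sum of the last two basis
vectors. -/
theorem cartanD_form (f : ℕ → ℤ) (h : ℕ) :
    (fun i : Fin (h + 1 + 2) => f i) ⬝ᵥ
      (CartanMatrix.D (h + 1 + 2)).mulVec (fun i : Fin (h + 1 + 2) => f i) =
    f 0 ^ 2 + ∑ i ∈ Finset.range h, (f i - f (i + 1)) ^ 2 +
      (f h - (f (h + 1) + f (h + 2))) ^ 2 + (f (h + 2) - f (h + 1)) ^ 2 := by
  have hA := sum_range_typeA f h
  have e : ∀ i j : Fin (h + 1 + 2), CartanMatrix.D (h + 1 + 2) i j =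
      if (i : ℕ) = j then 2 else if (i : ℕ) + 1 = j ∧ (j : ℕ) < h + 1 then -1 else
      if (j : ℕ) + 1 = i ∧ (i : ℕ) < h + 1 then -1 else
      if (i : ℕ) = h ∧ h < j ∨ (j : ℕ) = h ∧ h < i then -1 else 0 := by
    intro i j
    simp only [CartanMatrix.D, Matrix.of_apply, Fin.ext_iff]
    split_ifs <;> omega
  have hcol : ∀ t, h < t → ∑ i ∈ Finset.range (h + 1),
      f i * ((if i = h then -1 else 0) * f t) = - (f h * f t) := by
    intro t _
    rw [Finset.sum_eq_single h]
    · simp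
    · intro i _ hi; simp [hi]
    · simp
  have hrow : ∀ t, h < t → ∑ j ∈ Finset.range (h + 1), f t * ((if j = h then -1 else 0) * f j) =
      - (f h * f t) := by
    intro t _
    rw [Finset.sum_eq_single h]
    · simp; ring
    · intro i _ hi; simp [hi]
    · simp
  simp only [dotProduct, Matrix.mulVec, e, Finset.mul_sum]
  rw [Fin.sum_univ_eq_sum_range (fun i => ∑ j : Fin (h + 1 + 2), f i * ((if i = (j : ℕ) then 2 else
    if i + 1 = (j : ℕ) ∧ (j : ℕ) < h + 1 then -1 else if (j : ℕ) + 1 = i ∧ i < h + 1 then -1 else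
    if i = h ∧ h < (j : ℕ) ∨ (j : ℕ) = h ∧ h < i then -1 else 0) * f j))]
  have e2 : ∀ i, ∑ j : Fin (h + 1 + 2), f i * ((if i = (j : ℕ) then 2 else
    if i + 1 = (j : ℕ) ∧ (j : ℕ) < h + 1 then -1 else if (j : ℕ) + 1 = i ∧ i < h + 1 then -1 else
    if i = h ∧ h < (j : ℕ) ∨ (j : ℕ) = h ∧ h < i then -1 else 0) * f j) =
    ∑ j ∈ Finset.range (h + 1 + 2), f i * ((if i = j then 2 else
    if i + 1 = j ∧ j < h + 1 then -1 else if j + 1 = i ∧ i < h + 1 then -1 else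
    if i = h ∧ h < j ∨ j = h ∧ h < i then -1 else 0) * f j) := fun i =>
    Fin.sum_univ_eq_sum_range (fun j => f i * ((if i = j then 2 else
    if i + 1 = j ∧ j < h + 1 then -1 else if j + 1 = i ∧ i < h + 1 then -1 else
    if i = h ∧ h < j ∨ j = h ∧ h < i then -1 else 0) * f j)) _
  simp only [e2]
  have e3 : ∀ i ∈ Finset.range (h + 1), ∑ j ∈ Finset.range (h + 1 + 2), f i * ((if i = j then 2 else
    if i + 1 = j ∧ j < h + 1 then -1 else if j + 1 = i ∧ i < h + 1 then -1 else
    if i = h ∧ h < j ∨ j = h ∧ h < i then -1 else 0) * f j) = ∑ j ∈ Finset.range (h + 1),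
      f i * ((if i = j then 2 else if i + 1 = j ∨ j + 1 = i then -1 else 0) * f j) +
      f i * ((if i = h then -1 else 0) * f (h + 1)) +
      f i * ((if i = h then -1 else 0) * f (h + 2)) := by
    intro i hi
    rw [Finset.mem_range] at hi
    rw [Finset.sum_range_succ, Finset.sum_range_succ]
    refine congrArg₂ _ (congrArg₂ _ ?_ ?_) ?_
    · apply Finset.sum_congr rfl
      intro j hj
      rw [Finset.mem_range] at hj
      congr 2
      split_ifs <;> omega
    · congr 2
      split_ifs <;> omega
    · congr 2
      split_ifs <;> omega
  have e4 : ∀ t, h < t → t < h + 3 → ∑ j ∈ Finset.range (h + 1), f t * ((if t = j then 2 else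
    if t + 1 = j ∧ j < h + 1 then -1 else if j + 1 = t ∧ t < h + 1 then -1 else
    if t = h ∧ h < j ∨ j = h ∧ h < t then -1 else 0) * f j) = - (f h * f t) := by
    intro t h1 h2
    rw [← hrow t h1]
    apply Finset.sum_congr rfl
    intro j hj
    rw [Finset.mem_range] at hj
    congr 2
    split_ifs <;> omega
  rw [Finset.sum_range_succ, Finset.sum_range_succ, Finset.sum_congr rfl e3,
    Finset.sum_add_distrib, Finset.sum_add_distrib, hA, hcol _ (by omega), hcol _ (by omega)]
  simp only [Finset.sum_range_succ _ (h + 1), Finset.sum_range_succ _ (h + 1 + 1)]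
  rw [e4 _ (by omega) (by omega), e4 _ (by omega) (by omega)]
  have h3 : ¬ h + 1 + 1 = h := by omega
  simp [h3]
  ring

end CartanForm

/-- The possible charges of the Maya diagrams of a configuration. -/
abbrev Charges (g : ℕ) :=
  {x : (Fin g → ℤ) × ℤ × ℤ // Even (∑ s, x.1 s + x.2.1 + x.2.2)}

namespace Charges

variable {g : ℕ}

def partialSum (c : Fin g → ℤ) (j : ℕ) : ℤ := ∑ s : Fin g, if (s : ℕ) < j then c s else 0

theorem partialSum_zero (c : Fin g → ℤ) : partialSum c 0 = 0 := by simp [partialSum]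

theorem partialSum_succ (c : Fin g → ℤ) (s : Fin g) :
    partialSum c (s + 1) = partialSum c s + c s := by
  have : c s = ∑ t : Fin g, if t = s then c t else 0 := by simp
  rw [this, partialSum, partialSum, ← Finset.sum_add_distrib]
  apply Finset.sum_congr rfl
  intro t _
  simp only [Fin.ext_iff]
  split_ifs <;> omega

theorem partialSum_self (c : Fin g → ℤ) : partialSum c g = ∑ s, c s := by
  simp [partialSum]

/-- The coordinates `m_{i+1}` with given charges. -/
def weight (x : Charges g) (i : ℕ) : ℤ :=
  if i < g then -x.1.2.1 - partialSum x.1.1 i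
  else if i = g then (-x.1.2.1 - ∑ s, x.1.1 s - x.1.2.2) / 2
  else (-x.1.2.1 - ∑ s, x.1.1 s + x.1.2.2) / 2

theorem weight_of_lt (x : Charges g) {i : ℕ} (h : i < g) :
    x.weight i = -x.1.2.1 - partialSum x.1.1 i := by rw [weight, if_pos h]

/-- Evenness of the total charge makes the two halves in `weight` exact. -/
theorem two_mul_weight (x : Charges g) :
    2 * x.weight g = -x.1.2.1 - ∑ s, x.1.1 s - x.1.2.2 ∧
    2 * x.weight (g + 1) = -x.1.2.1 - ∑ s, x.1.1 s + x.1.2.2 := by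
  have := x.2
  rw [Int.even_iff] at this
  unfold weight
  simp only [lt_irrefl, if_true, if_false, show ¬ g + 1 < g by omega, show g + 1 ≠ g by omega]
  omega

/-- The square norm of the charges. -/
def norm (x : Charges g) : ℤ := ∑ s, x.1.1 s ^ 2 + x.1.2.1 ^ 2 + x.1.2.2 ^ 2

/-- Up to sign the charges are exactly the orthonormal coordinates occurring in `cartanD_form`: the
first coordinate, the successive differences, and the difference of the last two. -/
theorem dotProduct_weight (x : Charges g) (hg : 0 < g) :
    (fun i : Fin (g + 2) => x.weight i) ⬝ᵥ
      (CartanMatrix.D (g + 2)).mulVec (fun i : Fin (g + 2) => x.weight i) = x.norm := by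
  obtain ⟨h, rfl⟩ : ∃ h, g = h + 1 := ⟨g - 1, by omega⟩
  rw [cartanD_form]
  have h1 := x.two_mul_weight
  have h2 := partialSum_succ x.1.1 (Fin.last h)
  rw [Fin.val_last, partialSum_self] at h2
  have h3 : ∀ i ∈ Finset.range h, (x.weight i - x.weight (i + 1)) ^ 2 =
      (if hi : i < h + 1 then x.1.1 ⟨i, hi⟩ else 0) ^ 2 := by
    intro i hi
    rw [Finset.mem_range] at hi
    rw [dif_pos (by omega), weight_of_lt _ (by omega), weight_of_lt _ (by omega),
      partialSum_succ x.1.1 ⟨i, by omega⟩]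
    ring
  rw [Finset.sum_congr rfl h3, weight_of_lt _ (by omega), weight_of_lt _ (by omega),
    partialSum_zero, norm, Fin.sum_univ_castSucc,
    ← Fin.sum_univ_eq_sum_range (fun i => (if hi : i < h + 1 then x.1.1 ⟨i, hi⟩ else 0) ^ 2)]
  have h4 : ∀ i : Fin h, (if hi : (i : ℕ) < h + 1 then x.1.1 ⟨i, hi⟩ else 0) = x.1.1 i.castSucc :=
    fun i => by rw [dif_pos (by omega)]; rfl
  simp only [h4]
  have h5 : x.weight (h + 2) - x.weight (h + 1) = x.1.2.2 := by
    have := h1.2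
    rw [show h + 1 + 1 = h + 2 by rfl] at this
    omega
  have h6 : x.weight (h + 1) + x.weight (h + 2) = -x.1.2.1 - ∑ s, x.1.1 s := by
    have := h1.2
    rw [show h + 1 + 1 = h + 2 by rfl] at this
    omega
  rw [h5, h6, h2]
  ring

theorem sum_weight (x : Charges g) : ∑ i : Fin (g + 2), x.weight i =
    - ((g + 1) * x.1.2.1) - ∑ s : Fin g, ((g : ℤ) - s) * x.1.1 s := by
  rw [Fin.sum_univ_castSucc, Fin.sum_univ_castSucc]
  have h1 : ∑ i : Fin g, x.weight ((i.castSucc.castSucc : Fin (g + 2)) : ℕ) =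
      ∑ i : Fin g, (-x.1.2.1 - partialSum x.1.1 i) :=
    Finset.sum_congr rfl fun i _ => weight_of_lt _ i.2
  -- The charge `c s` enters the partial sums of index greater than `s`, of which there are `g - 1 -
  -- s`.
  have h2 : ∑ i : Fin g, partialSum x.1.1 i = ∑ s : Fin g, ((g : ℤ) - 1 - s) * x.1.1 s := by
    unfold partialSum
    rw [Finset.sum_comm]
    apply Finset.sum_congr rfl
    intro s _
    rw [← Finset.sum_filter, Finset.sum_const]
    have : (Finset.univ.filter fun i : Fin g => (s : ℕ) < i) = Finset.Ioi s := by
      ext i; simp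
    rw [this, Fin.card_Ioi, nsmul_eq_mul]
    congr 1
    omega
  have h3 := x.two_mul_weight
  have h4 : ∑ s : Fin g, ((g : ℤ) - s) * x.1.1 s =
      ∑ s : Fin g, ((g : ℤ) - 1 - s) * x.1.1 s + ∑ s, x.1.1 s := by
    rw [← Finset.sum_add_distrib]
    exact Finset.sum_congr rfl fun _ _ => by ring
  rw [h1, Finset.sum_sub_distrib, h2, h4]
  simp only [Finset.sum_const, Finset.card_univ, Fintype.card_fin, nsmul_eq_mul, Fin.val_castSucc,
    Fin.val_last]
  linarith

theorem weight_bijective (hg : 0 < g) :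
    Function.Bijective fun (x : Charges g) (i : Fin (g + 2)) => x.weight i := by
  constructor
  · intro x y h
    have h0 : ∀ i, i < g + 2 → x.weight i = y.weight i := fun i hi => congrFun h ⟨i, hi⟩
    have h1 := x.two_mul_weight
    have h2 := y.two_mul_weight
    have h3 := h0 g (by omega)
    have h4 := h0 (g + 1) (by omega)
    have hD : x.1.2.1 = y.1.2.1 := by
      have := h0 0 (by omega)
      rw [weight_of_lt _ hg, weight_of_lt _ hg, partialSum_zero, partialSum_zero] at this
      omega
    have hP : ∀ i ≤ g, partialSum x.1.1 i = partialSum y.1.1 i := by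
      intro i hi
      rcases hi.lt_or_eq with hi | rfl
      · have := h0 i (by omega)
        rw [weight_of_lt _ hi, weight_of_lt _ hi] at this
        omega
      · rw [partialSum_self, partialSum_self]
        omega
    apply Subtype.ext
    refine Prod.ext (funext fun s => ?_) (Prod.ext hD (by omega))
    have e1 := partialSum_succ x.1.1 s
    have e2 := partialSum_succ y.1.1 s
    have e3 := hP s s.2.le
    have e4 := hP (s + 1) s.2
    omega
  · intro m
    -- The sequence is continued by the sum of the last two coordinates, so that all runner charges
    -- are its successive differences.
    let f : ℕ → ℤ := fun i => if hi : i < g then m ⟨i, by omega⟩ else m ⟨g, by omega⟩ + m ⟨g + 1, by omega⟩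
    let c : Fin g → ℤ := fun s => f s - f (s + 1)
    have hP : ∀ i ≤ g, partialSum c i = f 0 - f i := by
      intro i hi
      induction i with
      | zero => rw [partialSum_zero]; ring
      | succ i ih =>
        rw [partialSum_succ c ⟨i, hi⟩, ih (by omega)]
        simp only [c]
        ring
    have hf : f g = m ⟨g, by omega⟩ + m ⟨g + 1, by omega⟩ := dif_neg (lt_irrefl g)
    have hs : ∑ s, c s = f 0 - f g := by rw [← partialSum_self]; exact hP g le_rfl
    refine ⟨⟨(c, -f 0, m ⟨g + 1, by omega⟩ - m ⟨g, by omega⟩), ?_⟩, funext fun i => ?_⟩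
    · rw [Int.even_iff]
      simp only [hs, hf]
      omega
    · obtain ⟨i, hi⟩ := i
      simp only
      rcases lt_or_ge i g with h | h
      · rw [weight_of_lt _ h, hP i h.le]
        simp only [f, dif_pos h]
        ring
      · have h3 := two_mul_weight (g := g)
          ⟨(c, -f 0, m ⟨g + 1, by omega⟩ - m ⟨g, by omega⟩), by
            rw [Int.even_iff]
            simp only [hs, hf]
            omega⟩
        simp only [hs, hf] at h3
        rcases h.eq_or_lt with rfl | h
        · omega
        · obtain rfl : i = g + 1 := by omega
          omega

/-- The parity of the sum of the charges. -/
def parity (c : Fin g → ℤ) : ℤ := (∑ s, c s) % 2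

theorem parity_cases (c : Fin g → ℤ) : parity c = 0 ∨ parity c = 1 := by
  unfold parity
  omega

/-- The charges with given abacus coordinates. -/
def ofCoord (z : Fin (g + 2) → ℤ) : Charges g :=
  ⟨(fun s => z s.castSucc.castSucc,
    (2 * parity (fun s : Fin g => z s.castSucc.castSucc) - 1) *
      (z (Fin.last g).castSucc + z (Fin.last (g + 1))) +
      parity (fun s : Fin g => z s.castSucc.castSucc),
    (2 * parity (fun s : Fin g => z s.castSucc.castSucc) - 1) *
      (z (Fin.last g).castSucc - z (Fin.last (g + 1)))), by
    rw [Int.even_iff]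
    have h : parity (fun s : Fin g => z s.castSucc.castSucc) =
      (∑ s : Fin g, z s.castSucc.castSucc) % 2 := rfl
    rcases parity_cases (fun s : Fin g => z s.castSucc.castSucc) with h1 | h1 <;>
    · simp only [h1]
      omega⟩

theorem ofCoord_bijective : Function.Bijective (ofCoord (g := g)) := by
  constructor
  · intro z z' h
    have h0 := congrArg Subtype.val h
    simp only [ofCoord, Prod.mk.injEq] at h0
    obtain ⟨h1, h2, h3⟩ := h0
    rw [← h1] at h2 h3
    have h4 : z (Fin.last g).castSucc = z' (Fin.last g).castSucc ∧
        z (Fin.last (g + 1)) = z' (Fin.last (g + 1)) := by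
      rcases parity_cases (fun s : Fin g => z s.castSucc.castSucc) with e | e <;>
      · rw [e] at h2 h3
        omega
    funext i
    induction i using Fin.lastCases with
    | last => exact h4.2
    | cast i =>
      induction i using Fin.lastCases with
      | last => exact h4.1
      | cast i => exact congrFun h1 i
  · rintro ⟨⟨c, d, b⟩, h⟩
    rw [Int.even_iff] at h
    have hp : parity c = (∑ s, c s) % 2 := rfl
    -- The equations prescribe `u + v` and `u - v` up to a common sign. Their parities agree because
    -- the total charge is even.
    obtain ⟨u, v, hu, hv⟩ : ∃ u v : ℤ, (2 * parity c - 1) * (u + v) + parity c = d ∧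
        (2 * parity c - 1) * (u - v) = b := by
      rcases parity_cases c with e | e
      · exact ⟨(-d - b) / 2, (-d + b) / 2, by rw [e]; simp only at h; omega,
          by rw [e]; simp only at h; omega⟩
      · exact ⟨(d - 1 + b) / 2, (d - 1 - b) / 2, by rw [e]; simp only at h; omega,
          by rw [e]; simp only at h; omega⟩
    refine ⟨Fin.snoc (α := fun _ => ℤ) (Fin.snoc (α := fun _ => ℤ) c u) v, Subtype.ext ?_⟩
    simp only [ofCoord, Fin.snoc_castSucc, Fin.snoc_last]
    rw [hu, hv]

end Charges
end TypeD

/-! ### Charges, excitations and the characterisation of cores. -/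

namespace TypeD

open MayaPair

/-- The part of a configuration which is independent of the charges. -/
abbrev Excitation (g : ℕ) := (Fin g → Neutral) × Neutral × Neutral × (ℕ →₀ ℕ)

namespace Excitation

variable {g : ℕ}

noncomputable def energy (t : Excitation g) : ℕ :=
  ∑ s, neutralEnergy (t.1 s) + neutralEnergy t.2.1 + neutralEnergy t.2.2.1 + multWeight 0 t.2.2.2

def vacuum : Excitation g :=
  (fun _ => ⟨(∅, ∅), rfl⟩, ⟨(∅, ∅), rfl⟩, ⟨(∅, ∅), rfl⟩, 0)

theorem energy_vacuum : (vacuum : Excitation g).energy = 0 := by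
  simp [energy, vacuum, neutralEnergy, MayaPair.energy, multWeight]

theorem eq_vacuum_of_energy_eq_zero {t : Excitation g} (h : t.energy = 0) : t = vacuum := by
  obtain ⟨x, p, q, k⟩ := t
  simp only [energy, Nat.add_eq_zero_iff, Finset.sum_eq_zero_iff, Finset.mem_univ,
    forall_const] at h
  obtain ⟨⟨⟨h1, h2⟩, h3⟩, h4⟩ := h
  have key : ∀ y : Neutral, neutralEnergy y = 0 → y = ⟨(∅, ∅), rfl⟩ := fun y hy =>
    Subtype.ext (eq_empty_of_energy_eq_zero y.2 hy)
  have hk : k = 0 := by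
    ext i
    by_contra hi
    have := le_multWeight (j := 0) (k := k) hi
    rw [h4] at this
    have h5 := Nat.pos_of_ne_zero hi
    have : 0 < (i + 1 + 0) * k i := by positivity
    omega
  rw [key p h2, key q h3, hk, vacuum]
  exact Prod.ext (funext fun s => key _ (h1 s)) rfl

end Excitation

namespace Config

variable {g : ℕ} {C : Config}

/-- The charges of the Maya diagrams of a configuration. -/
def charges (hg : 0 < g) (C : Config) : Charges g :=
  ⟨(fun s => charge (C.runnerPair g s), charge C.evenPair, charge C.oddPair), even_totalCharge hg⟩

noncomputable def excitation (g : ℕ) (C : Config) : Excitation g :=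
  (fun s => (equivCharge (C.runnerPair g s)).2, (equivCharge C.evenPair).2,
    (equivCharge C.oddPair).2, C.pairNums)

theorem energy_excitation : (C.excitation g).energy = C.totalExcess g := by
  unfold totalExcess excitation Excitation.energy multWeight
  rfl

/-- The only constraint on the diagrams concerns the parity of their total charge, so the neutral
parts and the pairs are free. -/
theorem charges_excitation_bijective (hg : 0 < g) :
    Function.Bijective fun C : Config => (C.charges hg, C.excitation g) := by
  constructor
  · intro C C' h
    simp only [excitation, Prod.mk.injEq] at h
    obtain ⟨h0, h4, h5, h6, h7⟩ := h
    have h0 := congrArg Subtype.val h0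
    simp only [charges, Prod.mk.injEq] at h0
    obtain ⟨h1, h2, h3⟩ := h0
    apply toPairs_injective hg
    unfold toPairs
    refine Prod.ext (funext fun s => ?_) (Prod.ext ?_ (Prod.ext ?_ h7))
    · exact equivCharge.injective (Prod.ext (congrFun h1 s) (congrFun h4 s))
    · exact equivCharge.injective (Prod.ext h2 h5)
    · exact equivCharge.injective (Prod.ext h3 h6)
  · rintro ⟨⟨⟨c, d, b⟩, h⟩, x, p, q, k⟩
    have hc : ∀ (c : ℤ) (x : Neutral), charge (equivCharge.symm (c, x)) = c := fun c x =>
      congrArg Prod.fst (equivCharge.apply_symm_apply (c, x))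
    obtain ⟨C, hC⟩ := exists_toPairs hg (fun s => equivCharge.symm (c s, x s))
      (equivCharge.symm (d, p)) (equivCharge.symm (b, q)) k (by simpa only [hc] using h)
    refine ⟨C, ?_⟩
    simp only [toPairs, Prod.mk.injEq] at hC
    obtain ⟨h1, h2, h3, h4⟩ := hC
    have h1 : ∀ s : Fin g, C.runnerPair g s = equivCharge.symm (c s, x s) := fun s => congrFun h1 s
    simp only [charges, excitation, h1, h2, h3, h4, hc, Equiv.apply_symm_apply]

/-- A configuration is given by its charges and its excitation. -/
noncomputable def equivCharges (hg : 0 < g) : Config ≃ Charges g × Excitation g :=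
  Equiv.ofBijective _ (charges_excitation_bijective hg)

/-- Each label count is the total energy, scaled by the bar weight, plus a linear form in the
charges. Replacing the energies by excess plus `c (c - 1) / 2` turns the quadratic part into the
norm, and the linear remainder into `weight`. The weight formula, the factorisation of the series
and the invariance of the charges under removal of bars all come from here. -/
theorem two_mul_labelCount (hg : 2 ≤ g) (j : Fin (g + 2 + 1)) :
    2 * (C.labelCount g (by omega) j : ℤ) =
      2 * (Fin.cases 0 (fun i : Fin (g + 2) => (C.charges (by omega : 0 < g)).weight i) j : ℤ) +
      barWeight (g + 2) j * ((C.charges (by omega : 0 < g)).norm + 2 * C.totalExcess g) := by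
  have h0 := labelCount_zero_add_one_eq (C := C) hg
  have h1 := labelCount_zero_sub_one_eq (C := C) hg
  have h2 := labelCount_last_add_eq (C := C) hg
  have h3 := labelCount_last_sub_eq (C := C) hg
  have hE := two_mul_totalEnergy (g := g) (C := C)
  have hw := (C.charges (by omega : 0 < g)).two_mul_weight
  have hn : (C.charges (by omega : 0 < g)).norm =
      ∑ s : Fin g, charge (C.runnerPair g s) * (charge (C.runnerPair g s) - 1) +
      ∑ s : Fin g, charge (C.runnerPair g s) + charge C.evenPair * (charge C.evenPair - 1) +
      charge C.evenPair + charge C.oddPair * (charge C.oddPair - 1) + charge C.oddPair := by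
    unfold Charges.norm charges
    rw [← Finset.sum_add_distrib]
    have : ∀ s : Fin g, charge (C.runnerPair g s) * (charge (C.runnerPair g s) - 1) +
      charge (C.runnerPair g s) = charge (C.runnerPair g s) ^ 2 := fun s => by ring
    simp only [this]
    ring
  have hc1 : (C.charges (by omega : 0 < g)).1.1 = fun s : Fin g => charge (C.runnerPair g s) := rfl
  have hc2 : (C.charges (by omega : 0 < g)).1.2.1 = charge C.evenPair := rfl
  have hc3 : (C.charges (by omega : 0 < g)).1.2.2 = charge C.oddPair := rfl
  rw [hc1, hc2, hc3] at hw
  rcases j.eq_zero_or_eq_succ with rfl | ⟨⟨i, hi⟩, rfl⟩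
  · have hb : barWeight (g + 2) ((0 : Fin (g + 2 + 1)) : ℕ) = 1 := by simp [barWeight]
    rw [hb, hn, Fin.cases_zero, Fin.val_zero]
    push_cast
    linarith
  · rw [Fin.cases_succ, hn]
    simp only [Fin.val_succ]
    rcases Nat.eq_zero_or_pos i with rfl | hi0
    · have hb : barWeight (g + 2) (0 + 1) = 1 := by simp [barWeight]
      rw [hb, Charges.weight_of_lt _ (by omega), Charges.partialSum_zero, hc2, zero_add]
      push_cast
      linarith
    rcases lt_or_ge i g with h | h
    · have hb : barWeight (g + 2) (i + 1) = 2 := by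
        rw [barWeight, if_neg]
        omega
      rw [hb, Charges.weight_of_lt _ h, hc1, hc2, labelCount_full_eq hg (by omega) (by omega)]
      have hs : ∑ s : Fin g, (if i + 1 - 1 ≤ (s : ℕ) then (1 : ℤ) else 0) *
          charge (C.runnerPair g s) = ∑ s : Fin g, charge (C.runnerPair g s) -
          Charges.partialSum (fun s : Fin g => charge (C.runnerPair g s)) i := by
        unfold Charges.partialSum
        rw [← Finset.sum_sub_distrib]
        apply Finset.sum_congr rfl
        intro s _
        split_ifs <;> first | omega | simp
      rw [hs]
      push_cast
      linarith
    · have hb : barWeight (g + 2) (i + 1) = 1 := by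
        rw [barWeight, if_pos]
        omega
      rw [hb]
      push_cast
      rcases h.eq_or_lt with rfl | h
      · linarith [hw.1]
      · obtain rfl : i = g + 1 := by omega
        linarith [hw.2]

/-- The count of the label `0` gives norm plus twice the excess, and the other counts then give
`weight` and so the charges. A bar changes only the former, by two; so the charges persist and the
excess would have to drop below `0`. -/
theorem isCore_of_totalExcess (hg : 2 ≤ g) (h : C.totalExcess g = 0) :
    IsCore (g + 2) (C.toWall g (by omega)) := by
  rintro ⟨Y', hsub, hfin, hbl, hcard, -⟩
  obtain ⟨C', rfl⟩ := toWall_surjective g (by omega : 0 < g) Y'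
  have hw : ∀ j : Fin (g + 2 + 1), C.labelCount g (by omega) j =
      C'.labelCount g (by omega) j + barWeight (g + 2) j := by
    intro j
    rw [← wt_toWall, ← wt_toWall, ← hcard j (by omega), wt, wt, ← Set.ncard_union_eq ?_
      ((C'.toWall g (by omega)).finite_white.subset fun b hb => ⟨hb.1, hb.2.1⟩)
      (hfin.subset fun b hb => hb.1)]
    · congr 1
      ext b
      simp only [Set.mem_ofPred_eq, Set.mem_union, Set.mem_sdiff]
      constructor
      · rintro ⟨h1, h2, h3⟩
        by_cases h4 : b ∈ (C'.toWall g (by omega)).carrier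
        · exact Or.inl ⟨h4, h2, h3⟩
        · exact Or.inr ⟨⟨h1, h4⟩, h3⟩
      · rintro (⟨h1, h2, h3⟩ | ⟨h1, h3⟩)
        · exact ⟨hsub h1, h2, h3⟩
        · exact ⟨h1.1, (hbl b h1).2, h3⟩
    · rw [Set.disjoint_left]
      rintro b ⟨h1, -⟩ ⟨h2, -⟩
      exact h2.2 h1
  have h0 := two_mul_labelCount (C := C) hg 0
  have h0' := two_mul_labelCount (C := C') hg 0
  have hw0 := hw 0
  have hb : barWeight (g + 2) ((0 : Fin (g + 2 + 1)) : ℕ) = 1 := by simp [barWeight]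
  rw [hb] at h0 h0' hw0
  rw [Fin.cases_zero] at h0 h0'
  have hx : C.charges (by omega : 0 < g) = C'.charges (by omega : 0 < g) := by
    apply (Charges.weight_bijective (by omega : 0 < g)).1
    funext i
    have h1 := two_mul_labelCount (C := C) hg i.succ
    have h1' := two_mul_labelCount (C := C') hg i.succ
    rw [Fin.cases_succ] at h1 h1'
    have h2 := hw i.succ
    have h3 : (C.charges (by omega : 0 < g)).norm + 2 * C.totalExcess g =
        (C'.charges (by omega : 0 < g)).norm + 2 * C'.totalExcess g + 2 := by
      push_cast at h0 h0'
      omega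
    rw [h3] at h1
    have h4 : (C.labelCount g (by omega) i.succ : ℤ) =
      C'.labelCount g (by omega) i.succ + barWeight (g + 2) i.succ := by exact_mod_cast h2
    simp only
    linarith
  rw [hx, h] at h0
  push_cast at h0 h0'
  omega

theorem isCore_iff (hg : 2 ≤ g) : IsCore (g + 2) (C.toWall g (by omega)) ↔ C.totalExcess g = 0 :=
  ⟨fun h => by_contra fun h' => not_isCore_of_totalExcess hg h' h, isCore_of_totalExcess hg⟩

theorem charges_core_bijective (hg : 2 ≤ g) :
    Function.Bijective fun Y : {Y : YoungWall (g + 2) // IsCore (g + 2) Y} =>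
      ((equivWall g (by omega : 0 < g)).symm Y.1).charges (by omega : 0 < g) := by
  have hpos : 0 < g := by omega
  have hexc : ∀ Y : {Y : YoungWall (g + 2) // IsCore (g + 2) Y},
      (((equivWall g hpos).symm Y.1).excitation g) = Excitation.vacuum := by
    intro Y
    apply Excitation.eq_vacuum_of_energy_eq_zero
    rw [energy_excitation, ← isCore_iff hg]
    have := (equivWall g hpos).apply_symm_apply Y.1
    have h2 := Y.2
    rw [← this] at h2
    exact h2
  constructor
  · intro Y Y' h
    apply Subtype.ext
    apply (equivWall g hpos).symm.injective
    apply (charges_excitation_bijective hpos).1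
    exact Prod.ext h ((hexc Y).trans (hexc Y').symm)
  · intro x
    obtain ⟨C, hC⟩ := (charges_excitation_bijective hpos).2 (x, Excitation.vacuum)
    simp only [Prod.mk.injEq] at hC
    refine ⟨⟨equivWall g hpos C, ?_⟩, ?_⟩
    · refine (isCore_iff hg).2 ?_
      rw [← energy_excitation, hC.2, Excitation.energy_vacuum]
    · simp only [Equiv.symm_apply_apply]
      exact hC.1

end Config
end TypeD

/-! ### The identity of generating functions. -/

namespace TypeD

open MvPowerSeries MayaPair

variable {g : ℕ}

namespace Excitation

/-- An excitation consists of `g + 2` neutral diagrams and one sequence of multiplicities, each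
counted by the inverse of the Euler product. This accounts for the exponent `g + 3 = n + 1`. -/
theorem genFun_energy {σ : Type*} {v : σ →₀ ℕ} (hv : v ≠ 0) :
    FiniteFibers (fun t : Excitation g => t.energy • v) ∧
    genFun (fun t : Excitation g => t.energy • v) *
      (∏' k : ℕ, ((1 : MvPowerSeries σ ℤ) - (monomial v 1) ^ (k + 1))) ^ (g + 3) = 1 := by
  classical
  have f1 := finiteFibers_neutralEnergy
  have f2 := finiteFibers_multWeight 0
  have f3 := genFun_pi f1 hv g
  have e : (fun t : Excitation g => t.energy • v) = fun t : Excitation g =>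
      (∑ s, neutralEnergy (t.1 s)) • v + (neutralEnergy t.2.1 • v +
        (neutralEnergy t.2.2.1 • v + multWeight 0 t.2.2.2 • v)) := by
    funext t
    simp only [energy, add_smul, add_assoc]
  have h1 := (f1.smul hv).add (f2.smul hv)
  have h2 := (f1.smul hv).add h1
  have h3 := (f3.1.smul hv).add h2
  rw [e]
  refine ⟨h3, ?_⟩
  rw [genFun_prod (w := fun x : Fin g → Neutral => (∑ i, neutralEnergy (x i)) • v)
      (w' := fun x : Neutral × Neutral × (ℕ →₀ ℕ) => neutralEnergy x.1 • v +
        (neutralEnergy x.2.1 • v + multWeight 0 x.2.2 • v)) (f3.1.smul hv) h2, f3.2,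
    genFun_prod (w := fun x => neutralEnergy x • v)
      (w' := fun x : Neutral × (ℕ →₀ ℕ) => neutralEnergy x.1 • v + multWeight 0 x.2 • v)
      (f1.smul hv) h1,
    genFun_prod (w := fun x => neutralEnergy x • v) (w' := fun x => multWeight 0 x • v)
      (f1.smul hv) (f2.smul hv)]
  have p1 := genFun_neutral_mul_tprod hv
  have p2 := genFun_multWeight_mul_tprod hv
  generalize genFun (fun x => neutralEnergy x • v) = U at *
  generalize genFun (fun x => multWeight 0 x • v) = V at *
  generalize (∏' k : ℕ, ((1 : MvPowerSeries σ ℤ) - (monomial v 1) ^ (k + 1))) = P at *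
  calc U ^ g * (U * (U * V)) * P ^ (g + 3) = (U * P) ^ (g + 2) * (V * P) := by
        rw [mul_pow]; ring
    _ = 1 := by rw [p1, p2, one_pow, one_mul]

end Excitation

namespace Config

/-- The configuration with given charges and without excitation. -/
noncomputable def ofCharges (hg : 0 < g) (x : Charges g) : Config :=
  (equivCharges hg).symm (x, Excitation.vacuum)

theorem charges_ofCharges (hg : 0 < g) (x : Charges g) : (ofCharges hg x).charges hg = x :=
  congrArg Prod.fst ((equivCharges hg).apply_symm_apply (x, Excitation.vacuum))

theorem totalExcess_ofCharges (hg : 0 < g) (x : Charges g) : (ofCharges hg x).totalExcess g = 0 := by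
  rw [← energy_excitation, ← Excitation.energy_vacuum (g := g)]
  exact congrArg Excitation.energy
    (congrArg Prod.snd ((equivCharges hg).apply_symm_apply (x, Excitation.vacuum)))

/-- The multi-weight of a configuration. -/
noncomputable def multiweight (hg : 0 < g) (C : Config) : Fin (g + 2 + 1) →₀ ℕ :=
  Finsupp.equivFunOnFinite.symm fun j => C.labelCount g hg j

end Config

noncomputable def barMultiweight (n : ℕ) : Fin (n + 1) →₀ ℕ :=
  Finsupp.equivFunOnFinite.symm fun j => barWeight n j

theorem barMultiweight_ne_zero (n : ℕ) : barMultiweight n ≠ 0 := by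
  intro h
  have := DFunLike.congr_fun h 0
  simp [barMultiweight, barWeight] at this

namespace Config

theorem multiweight_eq (hg : 2 ≤ g) (C : Config) : C.multiweight (by omega : 0 < g) =
    (ofCharges (by omega : 0 < g) (C.charges (by omega))).multiweight (by omega) +
      C.totalExcess g • barMultiweight (g + 2) := by
  ext j
  have h1 := two_mul_labelCount (C := C) hg j
  have h2 := two_mul_labelCount
    (C := ofCharges (by omega : 0 < g) (C.charges (by omega : 0 < g))) hg j
  rw [charges_ofCharges, totalExcess_ofCharges] at h2
  simp only [multiweight, barMultiweight, Finsupp.add_apply, Finsupp.smul_apply, smul_eq_mul,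
    Finsupp.equivFunOnFinite_symm_apply_apply]
  zify
  push_cast at h2
  linarith

theorem two_mul_multiweight_ofCharges (hg : 2 ≤ g) (x : Charges g) (j : Fin (g + 2 + 1)) :
    2 * ((ofCharges (by omega : 0 < g) x).multiweight (by omega) j : ℤ) =
      2 * (Fin.cases 0 (fun i : Fin (g + 2) => x.weight i) j : ℤ) +
      barWeight (g + 2) j * x.norm := by
  have h2 := two_mul_labelCount (C := ofCharges (by omega : 0 < g) x) hg j
  rw [charges_ofCharges, totalExcess_ofCharges] at h2
  simp only [CharP.cast_eq_zero, mul_zero, add_zero] at h2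
  exact h2

theorem thetaExponent_weight (hg : 2 ≤ g) (x : Charges g) (j : Fin (g + 2 + 1)) :
    thetaExponent (g + 2) (fun i => x.weight i) j =
      (ofCharges (by omega : 0 < g) x).multiweight (by omega) j := by
  have h := two_mul_multiweight_ofCharges hg x j
  rw [thetaExponent, x.dotProduct_weight (by omega)]
  have h2 : (2 * ((ofCharges (by omega : 0 < g) x).multiweight (by omega) j : ℤ) : ℚ) =
      2 * ((Fin.cases 0 (fun i : Fin (g + 2) => x.weight i) j : ℤ) : ℚ) +
      barWeight (g + 2) j * x.norm := by exact_mod_cast h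
  push_cast at h2
  linarith

/-- The exponent of `q_0` is half the norm; knowing it, the other exponents give `weight`. Distinct
terms of the theta series are therefore distinct monomials, which gives its convergence. -/
theorem multiweight_ofCharges_injective (hg : 2 ≤ g) : Function.Injective fun x : Charges g =>
    (ofCharges (by omega : 0 < g) x).multiweight (by omega : 0 < g) := by
  intro x y h
  apply (Charges.weight_bijective (by omega : 0 < g)).1
  funext i
  have h0 := two_mul_multiweight_ofCharges hg x 0
  have h0' := two_mul_multiweight_ofCharges hg y 0
  have h1 := two_mul_multiweight_ofCharges hg x i.succ
  have h1' := two_mul_multiweight_ofCharges hg y i.succ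
  simp only at h
  have hb : barWeight (g + 2) ((0 : Fin (g + 2 + 1)) : ℕ) = 1 := by simp [barWeight]
  rw [h, hb, Fin.cases_zero] at h0
  rw [hb, Fin.cases_zero] at h0'
  rw [h, Fin.cases_succ] at h1
  rw [Fin.cases_succ] at h1'
  have h3 : x.norm = y.norm := by push_cast at h0 h0'; linarith
  rw [h3] at h1
  simp only
  linarith

end Config

theorem summable_and_tsum_qMonomial (hg : 2 ≤ g) :
    (∀ (m : Fin (g + 2) → ℤ) (j : Fin (g + 2 + 1)), ∃ e : ℕ, thetaExponent (g + 2) m j = e) ∧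
    Summable (fun Y : YoungWall (g + 2) => qMonomial (g + 2) (wt (g + 2) Y)) ∧
    Summable (fun m : Fin (g + 2) → ℤ => thetaTerm (g + 2) m) ∧
    Multipliable (fun k : ℕ => (1 - barSeries (g + 2) ^ (k + 1)) ^ (g + 2 + 1)) ∧
    IsUnit (∏' k : ℕ, (1 - barSeries (g + 2) ^ (k + 1)) ^ (g + 2 + 1)) ∧
    ∑' Y : YoungWall (g + 2), qMonomial (g + 2) (wt (g + 2) Y) =
      (∑' m : Fin (g + 2) → ℤ, thetaTerm (g + 2) m) *
        Ring.inverse (∏' k : ℕ, (1 - barSeries (g + 2) ^ (k + 1)) ^ (g + 2 + 1)) := by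
  classical
  have hpos : 0 < g := by omega
  have hv := barMultiweight_ne_zero (g + 2)
  have hbar : barSeries (g + 2) = monomial (barMultiweight (g + 2)) 1 := rfl
  let e := Equiv.ofBijective _ (Charges.weight_bijective hpos)
  let θ : Charges g → Fin (g + 2 + 1) →₀ ℕ := fun x => (Config.ofCharges hpos x).multiweight hpos
  have hθ : FiniteFibers θ := fun d => Set.Subsingleton.finite fun x hx y hy =>
    Config.multiweight_ofCharges_injective hg (hx.trans hy.symm)
  have hterm : ∀ x, thetaTerm (g + 2) (e x) = monomial (θ x) 1 := by
    intro x
    have : (fun j => ⌊thetaExponent (g + 2) (e x) j⌋₊) = fun j => θ x j := by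
      funext j
      have := Config.thetaExponent_weight hg x j
      rw [show (e x) = fun i : Fin (g + 2) => x.weight i from rfl, this, Nat.floor_natCast]
    rw [thetaTerm, this, qMonomial]
    congr 1
  have hexc := Excitation.genFun_energy (g := g) hv
  let E : YoungWall (g + 2) ≃ Charges g × Excitation g :=
    (Config.equivWall g hpos).symm.trans (Config.equivCharges hpos)
  let w : Charges g × Excitation g → Fin (g + 2 + 1) →₀ ℕ := fun x =>
    θ x.1 + x.2.energy • barMultiweight (g + 2)
  have hw : FiniteFibers w := hθ.add hexc.1
  have hwall : ∀ Y, qMonomial (g + 2) (wt (g + 2) Y) = monomial (w (E Y)) 1 := by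
    intro Y
    obtain ⟨C, rfl⟩ := (Config.equivWall g hpos).surjective Y
    have h1 := C.multiweight_eq hg
    simp only [E, Equiv.trans_apply, Equiv.symm_apply_apply]
    rw [← Config.energy_excitation] at h1
    exact congrArg (fun d => monomial d (1 : ℤ)) h1
  have hm : Multipliable fun k : ℕ => 1 - barSeries (g + 2) ^ (k + 1) := multipliable_one_sub hv
  have hP : (∏' k : ℕ, (1 - barSeries (g + 2) ^ (k + 1)) ^ (g + 2 + 1)) =
      (∏' k : ℕ, (1 - barSeries (g + 2) ^ (k + 1))) ^ (g + 2 + 1) := hm.tprod_pow _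
  have hinv : genFun (fun t : Excitation g => t.energy • barMultiweight (g + 2)) *
      (∏' k : ℕ, (1 - barSeries (g + 2) ^ (k + 1)) ^ (g + 2 + 1)) = 1 := by
    rw [hP]
    exact hexc.2
  have hunit := IsUnit.of_mul_eq_one_right _ hinv
  refine ⟨fun m j => ?_, ?_, ?_, hm.pow _, hunit, ?_⟩
  · obtain ⟨x, rfl⟩ := e.surjective m
    exact ⟨_, Config.thetaExponent_weight hg x j⟩
  · simp only [hwall]
    exact (hw.comp_injective E.injective).summable
  · rw [← e.summable_iff]
    exact hθ.summable.congr fun x => (hterm x).symm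
  · rw [Ring.eq_mul_inverse_iff_mul_eq _ _ _ hunit, ← e.tsum_eq]
    simp only [hwall, hterm]
    rw [E.tsum_eq (fun x => monomial (w x) (1 : ℤ))]
    have h1 := genFun_prod hθ hexc.1
    change genFun w * _ = genFun θ
    rw [show genFun w = _ from h1, mul_assoc, hinv, mul_one]

end TypeD

/-! ### Reading the abacus off a configuration. -/

namespace TypeD

namespace Config

variable {g : ℕ} {C : Config}

theorem inner_antitone (hg : 0 < g) {r s : ℕ} (h : r ≤ s) : C.inner g s ≤ C.inner g r := by
  rcases h.eq_or_lt with rfl | h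
  · rfl
  · exact (inner_le_outer s).trans (outer_le_inner_of_lt hg h)

theorem outer_antitone (hg : 0 < g) {r s : ℕ} (h : r ≤ s) : C.outer g s ≤ C.outer g r := by
  rcases h.eq_or_lt with rfl | h
  · rfl
  · exact (outer_le_inner_of_lt hg h).trans (inner_le_outer r)

/-- The first summand counts one block in a filled position. The second adds the other half-block
there, or the only one in a half-filled position; row `0` is exempt because of the grey half-blocks.
-/
theorem rowCount_col (c r : ℕ) : C.rowCount g (fun b => b.col = c) r =
    (if c < C.inner g r then 1 else 0) + if g ∣ r ∧ r ≠ 0 ∧ c < C.outer g r then 1 else 0 := by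
  classical
  have key : ∀ (L : ℕ) (p : ℕ → Prop) (_ : DecidablePred p), (∀ c', p c' ↔ c' = c) →
      ((Finset.range L).filter p).card = if c < L then 1 else 0 := by
    intro L p _ hp
    simp only [hp]
    rw [Finset.filter_eq']
    simp only [Finset.mem_range]
    split_ifs <;> simp
  have h1 := min_len (C := C) (g := g) r
  have h2 := max_len (C := C) (g := g) r
  unfold rowCount
  beta_reduce
  by_cases hr : g ∣ r
  · by_cases h0 : r = 0
    · have h3 : C.nablaLen g r = C.inner g r := by
        subst h0
        exact len_of_halfAt halfAt_zero Side.nabla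
      rw [if_pos hr, if_pos h0,
        key _ (fun c' => (⟨c', r, Side.nabla⟩ : Block).col = c) _ fun _ => Iff.rfl, h3]
      simp [h0]
    · rw [if_pos hr, if_neg h0,
        key _ (fun c' => (⟨c', r, Side.lhd⟩ : Block).col = c) _ fun _ => Iff.rfl,
        key _ (fun c' => (⟨c', r, Side.nabla⟩ : Block).col = c) _ fun _ => Iff.rfl, ← h1, ← h2]
      simp only [hr, h0, ne_eq, not_false_eq_true, true_and, lt_min_iff, lt_max_iff]
      by_cases h3 : c < C.lhdLen g r <;> by_cases h4 : c < C.nablaLen g r <;> simp [h3, h4]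
  · rw [if_neg hr, key _ (fun c' => (⟨c', r, Side.full⟩ : Block).col = c) _ fun _ => Iff.rfl]
    simp [hr]

theorem columnHeight_eq (hg : 0 < g) {c k : ℕ} (h1 : ∀ r < k, c < C.inner g r)
    (h2 : C.inner g k ≤ c) : columnHeight (C.toWall g hg) c =
      k + (k - 1) / g + if g ∣ k ∧ k ≠ 0 ∧ c < C.outer g k then 1 else 0 := by
  obtain ⟨R, -, -, hR⟩ := exists_rowBound g C
  rw [columnHeight, ncard_blocks hg _ (R := R + (k + 1)) fun r hr => hR r (by omega)]
  rw [← Finset.sum_subset (Finset.range_subset_range.2 (by omega : k + 1 ≤ R + (k + 1)))]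
  · rw [Finset.sum_range_succ, rowCount_col, if_neg (by omega), zero_add]
    congr 1
    have h3 : ∀ r ∈ Finset.range k, C.rowCount g (fun b => b.col = c) r =
        1 + if g ∣ r ∧ r ≠ 0 then 1 else 0 := by
      intro r hr
      rw [Finset.mem_range] at hr
      have h4 := h1 r hr
      have h5 := inner_le_outer (C := C) (g := g) r
      rw [rowCount_col, if_pos h4]
      simp only [h4.trans_le h5, and_true]
    rw [Finset.sum_congr rfl h3]
    clear h1 h2 h3
    induction k with
    | zero => simp
    | succ k ih =>
      rw [Finset.sum_range_succ, ih, Nat.add_sub_cancel]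
      rcases k with _ | k
      · simp
      · rw [Nat.add_sub_cancel, Nat.succ_div]
        simp only [ne_eq, Nat.add_eq_zero_iff, one_ne_zero, and_false, not_false_eq_true, and_true]
        omega
  · intro r _ hr
    rw [Finset.mem_range, not_lt] at hr
    have h3 := outer_le_inner_of_lt (C := C) hg (show k < r by omega)
    have h4 := inner_le_outer (C := C) (g := g) r
    rw [rowCount_col, if_neg (by omega), if_neg (by omega), add_zero]

/-- The number of white blocks in a full column with top row `x`. -/
def fullHeight (g x : ℕ) : ℕ := x + 1 + x / g

/-- The column of the full bead with top row `x`. -/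
def fullCol (g : ℕ) (C : Config) (x : ℕ) : ℕ := C.outer g (x + 1)

theorem inner_of_mem_full (hg : 0 < g) {x : ℕ} (hx : x ∈ C.full) :
    C.inner g x = C.fullCol g x + 1 := by
  have h1 := (mem_full_iff hg x).1 hx
  have h2 := inner_le_outer_succ (C := C) hg x
  unfold fullCol
  omega

theorem fullCol_injOn (hg : 0 < g) : Set.InjOn (C.fullCol g) C.full := by
  have key : ∀ x ∈ C.full, ∀ y ∈ C.full, x < y → C.fullCol g y < C.fullCol g x := by
    intro x hx y hy hxy
    have h1 := inner_of_mem_full hg hy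
    have h2 := inner_le_outer (C := C) (g := g) y
    have h3 := outer_antitone (C := C) hg (show x + 1 ≤ y from hxy)
    unfold fullCol at *
    omega
  intro x hx y hy hxy
  rcases lt_trichotomy x y with h | h | h
  · have := key x hx y hy h; omega
  · exact h
  · have := key y hy x hx h; omega

theorem isFullColumn_fullCol (hg : 0 < g) {x : ℕ} (hx : x ∈ C.full) :
    IsFullColumn (C.toWall g hg) (C.fullCol g x) := by
  refine ⟨x, (isFullTop_carrier_iff hg C _ _).2 ⟨le_rfl, ?_⟩⟩
  rw [inner_of_mem_full hg hx]
  omega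

theorem columnHeight_fullCol (hg : 0 < g) {x : ℕ} (hx : x ∈ C.full) :
    columnHeight (C.toWall g hg) (C.fullCol g x) = fullHeight g x := by
  have h1 := inner_of_mem_full hg hx
  rw [columnHeight_eq hg (k := x + 1), if_neg]
  · simp [fullHeight]
  · rintro ⟨-, -, h⟩
    exact lt_irrefl _ h
  · intro r hr
    have := inner_antitone (C := C) hg (show r ≤ x by omega)
    omega
  · exact inner_le_outer _

theorem columnHeight_half (hg : 0 < g) {c t : ℕ} (h1 : C.inner g ((t + 1) * g) ≤ c)
    (h2 : c < C.outer g ((t + 1) * g)) :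
    columnHeight (C.toWall g hg) c = (t + 1) * (g + 1) := by
  have h0 : (t + 1) * g ≠ 0 := by positivity
  rw [columnHeight_eq hg (k := (t + 1) * g) _ h1, if_pos ⟨Dvd.intro_left _ rfl, h0, h2⟩]
  · have : ((t + 1) * g - 1) / g = t := by
      obtain ⟨g, rfl⟩ : ∃ g', g = g' + 1 := ⟨g - 1, by omega⟩
      rw [show (t + 1) * (g + 1) - 1 = (g + 1) * t + g by
        rw [Nat.sub_eq_iff_eq_add (Nat.succ_le_of_lt (by positivity))]; ring, Nat.mul_add_div (by omega),
        Nat.div_eq_of_lt (by omega), add_zero]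
    rw [this]
    ring
  · intro r hr
    exact h2.trans_le (outer_le_inner_of_lt hg hr)

theorem not_isFullColumn_half (hg : 0 < g) {c k : ℕ} (h1 : C.inner g k ≤ c)
    (h2 : c < C.outer g k) : ¬ IsFullColumn (C.toWall g hg) c := by
  rintro ⟨r, hr⟩
  obtain ⟨h3, h4⟩ := (isFullTop_carrier_iff hg C _ _).1 hr
  rcases lt_or_ge r k with h | h
  · have := outer_antitone (C := C) hg (show r + 1 ≤ k from h)
    omega
  · have := inner_antitone (C := C) hg h
    omega

/-- Consider the lowest row in which the column is not filled. If it is row `0` the column is empty;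
otherwise its position there is either empty, and the column is full, or half filled. -/
theorem column_cases (hg : 0 < g) (c : ℕ) : (∃ x ∈ C.full, c = C.fullCol g x) ∨
    (∃ t, C.inner g ((t + 1) * g) ≤ c ∧ c < C.outer g ((t + 1) * g)) ∨
    columnHeight (C.toWall g hg) c = 0 ∧ ¬ IsFullColumn (C.toWall g hg) c := by
  classical
  have hex : ∃ k, C.inner g k ≤ c := by
    obtain ⟨R, hF, hR⟩ := exists_bound g C
    exact ⟨R, by rw [inner_eq_zero hF hR le_rfl]; omega⟩
  have h1 := Nat.find_spec hex
  have h2 : ∀ r < Nat.find hex, c < C.inner g r := fun r hr => not_le.1 (Nat.find_min hex hr)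
  generalize Nat.find hex = k at h1 h2
  rcases k with _ | r
  · refine Or.inr (Or.inr ⟨?_, ?_⟩)
    · rw [columnHeight_eq hg h2 h1]
      simp
    · rintro ⟨r, hr⟩
      have h3 := ((isFullTop_carrier_iff hg C _ _).1 hr).2
      have := inner_antitone (C := C) hg (Nat.zero_le r)
      omega
  · have h3 := h2 r (by omega)
    have h4 := inner_le_outer_succ (C := C) hg r
    rcases le_or_gt (C.outer g (r + 1)) c with h | h
    · exact Or.inl ⟨r, (mem_full_iff hg r).2 (by omega), by unfold fullCol; omega⟩
    · refine Or.inr (Or.inl ?_)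
      have h5 : C.halfAt g (r + 1) ≠ 0 := by
        intro h0
        unfold outer at h
        omega
      have h6 : g ∣ r + 1 := by
        by_contra h6
        exact h5 (halfAt_of_not_dvd h6)
      obtain ⟨m, hm⟩ := h6
      rcases m with _ | t
      · omega
      · exact ⟨t, by rw [mul_comm, ← hm]; exact h1, by rw [mul_comm, ← hm]; exact h⟩

/-- Heights of full columns avoid the multiples of `g + 1 = n - 1`, so they can be compared with
half-columns by rows alone. -/
theorem fullHeight_lt_iff (hg : 0 < g) (x t : ℕ) :
    (fullHeight g x < (t + 1) * (g + 1) ↔ x < (t + 1) * g) ∧ fullHeight g x ≠ (t + 1) * (g + 1) := by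
  have h1 := Nat.div_add_mod x g
  have h2 := Nat.mod_lt x hg
  have h3 : (t + 1) * (g + 1) = g * t + t + g + 1 := by ring
  have h4 : (t + 1) * g = g * t + g := by ring
  rw [fullHeight, h3, h4]
  generalize x / g = q at *
  generalize x % g = y at *
  rcases le_or_gt q t with h | h
  · have := Nat.mul_le_mul_left g h
    omega
  · have := Nat.mul_le_mul_left g (show t + 1 ≤ q from h)
    rw [mul_add, mul_one] at this
    omega

/-- A residue `y < g` of the top row leads to the runner `y + 1` and a residue `y ≥ g` to the runner
`y + 2`. The runners `n - 1` and `2 n - 2` are left to the half-columns, and mirrored residues give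
opposite runners. -/
theorem fullHeight_mod (hg : 0 < g) (x : ℕ) :
    fullHeight g x % (2 * g + 2) = x % (2 * g) + 1 + x % (2 * g) / g := by
  have h1 := Nat.div_add_mod x (2 * g)
  have h2 := Nat.mod_lt x (show 0 < 2 * g by omega)
  rw [fullHeight]
  generalize x / (2 * g) = q at *
  generalize x % (2 * g) = y at *
  subst h1
  have h3 : (2 * g * q + y) / g = 2 * q + y / g := by
    rw [show 2 * g * q + y = g * (2 * q) + y by ring, Nat.mul_add_div hg]
  have h4 : y / g < 2 := by rwa [Nat.div_lt_iff_lt_mul hg]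
  rw [h3, show 2 * g * q + y + 1 + (2 * q + y / g) = (2 * g + 2) * q + (y + 1 + y / g) by ring,
    Nat.mul_add_mod, Nat.mod_eq_of_lt]
  generalize y / g = d at *
  omega

theorem add_div_injective (g : ℕ) : Function.Injective fun w : ℕ => w + 1 + w / g := by
  intro a b h
  simp only at h
  rcases lt_trichotomy a b with h1 | h1 | h1
  · have := Nat.div_le_div_right (c := g) h1.le
    omega
  · exact h1
  · have := Nat.div_le_div_right (c := g) h1.le
    omega

theorem runnerCount_eq (hg : 0 < g) {y : ℕ} (hy : y < 2 * g) :
    runnerCount (C.toWall g hg) (y + 1 + y / g) = (residue (2 * g) y C.full).card := by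
  have hinj : Set.InjOn (fun i => 2 * g * i + y) ↑(residue (2 * g) y C.full) := by
    intro a _ b _ h
    simp only [add_left_inj] at h
    exact Nat.eq_of_mul_eq_mul_left (by omega) h
  have h : {c | columnHeight (C.toWall g hg) c % (2 * (g + 2) - 2) = y + 1 + y / g} =
      (fun i => C.fullCol g (2 * g * i + y)) '' ↑(residue (2 * g) y C.full) := by
    rw [show 2 * (g + 2) - 2 = 2 * g + 2 by omega]
    ext c
    simp only [Set.mem_ofPred_eq, Set.mem_image, Finset.mem_coe, mem_residue hy]
    constructor
    · intro hc
      rcases column_cases (C := C) hg c with ⟨x, hx, rfl⟩ | ⟨t, h1, h2⟩ | ⟨h1, -⟩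
      · rw [columnHeight_fullCol hg hx, fullHeight_mod hg] at hc
        have h3 := add_div_injective g hc
        have h4 := Nat.div_add_mod x (2 * g)
        rw [h3] at h4
        exact ⟨x / (2 * g), by rw [h4]; exact hx, by rw [h4]⟩
      · rw [columnHeight_half hg h1 h2, show 2 * g + 2 = 2 * (g + 1) by ring,
          Nat.mul_mod_mul_right] at hc
        have h3 : y / g = 0 ∧ y < g ∨ y / g ≠ 0 ∧ g ≤ y := by
          rcases lt_or_ge y g with h | h
          · exact Or.inl ⟨Nat.div_eq_of_lt h, h⟩
          · exact Or.inr ⟨(Nat.div_pos h hg).ne', h⟩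
        have h4 : y / g < 2 := by rwa [Nat.div_lt_iff_lt_mul hg]
        generalize y / g = d at *
        rcases Nat.mod_two_eq_zero_or_one (t + 1) with e | e <;> rw [e] at hc <;> omega
      · rw [h1, Nat.zero_mod] at hc
        exact absurd hc (by positivity)
    · rintro ⟨i, hi, rfl⟩
      rw [columnHeight_fullCol hg hi, fullHeight_mod hg, Nat.mul_add_mod, Nat.mod_eq_of_lt hy]
  rw [runnerCount, h, Set.InjOn.ncard_image, Set.ncard_coe_finset]
  exact (fullCol_injOn (C := C) hg).comp hinj fun i hi => (mem_residue hy).1 hi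

theorem isTopSide_lhd_iff (hg : 0 < g) {c t : ℕ} (h1 : C.inner g ((t + 1) * g) ≤ c)
    (h2 : c < C.outer g ((t + 1) * g)) :
    IsTopSide (C.toWall g hg) c Side.lhd ↔
      0 < twist (C.inner g ((t + 1) * g)) (C.half t) := by
  have h0 : 0 < (t + 1) * g := by positivity
  have hh := halfAt_succ_mul (C := C) hg t
  have hdvd : g ∣ (t + 1) * g := Dvd.intro_left _ rfl
  generalize (t + 1) * g = r at *
  have htop : ∀ b ∈ (C.toWall g hg).carrier, b.col = c → b.row ≤ r := by
    rintro ⟨c', r', s⟩ hb rfl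
    by_contra hr
    simp only [not_le] at hr
    rcases hb.2 with h | h
    · exact absurd h.1 (by simp only; omega)
    · have h3 := (len_bounds (C := C) (g := g) r' s).2
      have h4 := outer_le_inner_of_lt (C := C) hg hr
      simp only at h h1 h2
      omega
  have hside : 0 < twist (C.inner g r) (C.half t) ↔ c < C.lhdLen g r := by
    have h3 := twist_natAbs (C.inner g r) (C.half t)
    unfold outer at h2
    unfold lhdLen
    rw [hh] at h2 ⊢
    omega
  rw [hside]
  constructor
  · rintro ⟨r', hr', hmax⟩
    have h3 := htop _ hr' rfl
    have h4 : (⟨c, r, if c < C.lhdLen g r then Side.lhd else Side.nabla⟩ : Block) ∈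
        (C.toWall g hg).carrier := by
      refine ⟨(isBlock_iff g _).2 ?_, Or.inr ?_⟩
      · simp only [hdvd, not_true_eq_false, iff_false]
        split_ifs <;> simp
      · have h5 := max_len (C := C) (g := g) r
        simp only
        split_ifs with h6
        · exact h6
        · simp only [len]
          omega
    have h5 := hmax _ h4 rfl
    simp only at h3 h5
    obtain rfl : r' = r := by omega
    rcases hr'.2 with h | h
    · exact absurd h.1 h0.ne'
    · exact h
  · intro h
    refine ⟨r, ⟨(isBlock_iff g _).2 (by simp [hdvd]), Or.inr h⟩, htop⟩

theorem shorterFull_eq (hg : 0 < g) {c t : ℕ}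
    (h : columnHeight (C.toWall g hg) c = (t + 1) * (g + 1)) :
    shorterFull (C.toWall g hg) c = (C.full.filter (· < (t + 1) * g)).card := by
  have h1 : {c' | IsFullColumn (C.toWall g hg) c' ∧
      columnHeight (C.toWall g hg) c' < columnHeight (C.toWall g hg) c} =
      C.fullCol g '' ↑(C.full.filter (· < (t + 1) * g)) := by
    rw [h]
    ext c'
    simp only [Set.mem_ofPred_eq, Set.mem_image, Finset.mem_coe, Finset.mem_filter]
    constructor
    · rintro ⟨h2, h3⟩
      rcases column_cases (C := C) hg c' with ⟨x, hx, rfl⟩ | ⟨t, h4, h5⟩ | ⟨-, h4⟩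
      · rw [columnHeight_fullCol hg hx, (fullHeight_lt_iff hg x t).1] at h3
        exact ⟨x, ⟨hx, h3⟩, rfl⟩
      · exact absurd h2 (not_isFullColumn_half hg h4 h5)
      · exact absurd h2 h4
    · rintro ⟨x, ⟨hx, h3⟩, rfl⟩
      refine ⟨isFullColumn_fullCol hg hx, ?_⟩
      rwa [columnHeight_fullCol hg hx, (fullHeight_lt_iff hg x t).1]
  rw [shorterFull, h1, Set.InjOn.ncard_image, Set.ncard_coe_finset]
  exact (fullCol_injOn (C := C) hg).mono fun x hx => (Finset.mem_filter.1 hx).1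

/-- The beads in the row `(t + 1) * g` of half-blocks are white. -/
def IsWhite (g : ℕ) (C : Config) (t : ℕ) : Prop :=
  0 < twist (C.inner g ((t + 1) * g)) (C.half t) ↔ Even (C.full.filter (· < (t + 1) * g)).card

open Classical in
/-- The colour of the beads in the row `(t + 1) * g`. -/
noncomputable def colorAt (g : ℕ) (C : Config) (t : ℕ) : BeadColor :=
  if C.IsWhite g t then BeadColor.white else BeadColor.black

open Classical in
theorem beadCount_eq (hg : 0 < g) (t : ℕ) (x : BeadColor) :
    beadCount (C.toWall g hg) ((t + 1) * (g + 1)) x =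
      if x = C.colorAt g t then (C.half t).natAbs
      else 0 := by
  have hcol : ∀ c, columnHeight (C.toWall g hg) c = (t + 1) * (g + 1) ↔
      C.inner g ((t + 1) * g) ≤ c ∧ c < C.outer g ((t + 1) * g) := by
    intro c
    constructor
    · intro hc
      rcases column_cases (C := C) hg c with ⟨x, hx, rfl⟩ | ⟨t', h1, h2⟩ | ⟨h1, -⟩
      · rw [columnHeight_fullCol hg hx] at hc
        exact absurd hc (fullHeight_lt_iff hg x t).2
      · rw [columnHeight_half hg h1 h2] at hc
        have := Nat.eq_of_mul_eq_mul_right (Nat.succ_pos g) hc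
        obtain rfl : t' = t := by omega
        exact ⟨h1, h2⟩
      · rw [h1] at hc
        exact absurd hc.symm (by positivity)
    · rintro ⟨h1, h2⟩
      exact columnHeight_half hg h1 h2
  have hcolor : ∀ c, columnHeight (C.toWall g hg) c = (t + 1) * (g + 1) →
      beadColor (C.toWall g hg) c = C.colorAt g t := by
    intro c hc
    obtain ⟨h1, h2⟩ := (hcol c).1 hc
    rw [beadColor, if_neg (not_isFullColumn_half hg h1 h2), shorterFull_eq hg hc,
      isTopSide_lhd_iff hg h1 h2, colorAt]
    by_cases hW : C.IsWhite g t
    · exact (if_pos hW).trans (if_pos hW).symm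
    · exact (if_neg hW).trans (if_neg hW).symm
  have hset : {c | columnHeight (C.toWall g hg) c = (t + 1) * (g + 1) ∧
      beadColor (C.toWall g hg) c = x} =
      if x = C.colorAt g t then
        ↑(Finset.Ico (C.inner g ((t + 1) * g)) (C.outer g ((t + 1) * g))) else ∅ := by
    ext c
    split_ifs with hx
    · simp only [Set.mem_ofPred_eq, Finset.coe_Ico, Set.mem_Ico, ← hcol, hx, and_iff_left_iff_imp]
      exact hcolor c
    · simp only [Set.mem_ofPred_eq, Set.mem_empty_iff_false, iff_false, not_and]
      intro hc hc'
      exact hx (hc'.symm.trans (hcolor c hc))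
  rw [beadCount, hset]
  split_ifs
  · rw [Set.ncard_coe_finset, Nat.card_Ico, outer, halfAt_succ_mul hg, Nat.add_sub_cancel_left]
  · exact Set.ncard_empty _

end Config
end TypeD

/-! ### Pairs of staircases and parities. -/

namespace TypeD

open MayaPair

section PairBeads

/-- The part of `β` at the unique index where two staircases add up to `T`. -/
def betaPart (a b T : ℕ) : ℕ :=
  if T + b ≤ a then 0 else if T + a ≤ b then T else (T + b - a) / 2

/-- The sum of the `k`-th parts decreases strictly until it vanishes, by two while both parts are
positive and by one afterwards. So `k` is unique, and the ranges correspond to one part being zero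
or both being positive. -/
theorem staircase_unique {a b T k : ℕ} (hT : 1 ≤ T) (h : (a - k) + (b - k) = T) :
    b - k = betaPart a b T ∧ (T + b ≤ a ∨ T + a ≤ b ∨ T ≤ a + b ∧ (a + b + T) % 2 = 0) := by
  unfold betaPart
  split_ifs <;> omega

theorem staircase_exists {a b T : ℕ}
    (h : T + b ≤ a ∨ T + a ≤ b ∨ T ≤ a + b ∧ (a + b + T) % 2 = 0) :
    ∃ k, (a - k) + (b - k) = T := by
  by_cases h1 : T + b ≤ a
  · exact ⟨a - T, by omega⟩
  · by_cases h2 : T + a ≤ b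
    · exact ⟨b - T, by omega⟩
    · exact ⟨(a + b - T) / 2, by omega⟩

theorem ncard_staircase {a b T : ℕ} (hT : 1 ≤ T) (Q : ℕ → Prop) [DecidablePred Q] :
    Set.ncard {k | (a - k) + (b - k) = T ∧ Q (b - k)} =
      if (T + b ≤ a ∨ T + a ≤ b ∨ T ≤ a + b ∧ (a + b + T) % 2 = 0) ∧ Q (betaPart a b T) then 1
      else 0 := by
  split_ifs with h
  · obtain ⟨k, hk⟩ := staircase_exists h.1
    rw [Set.ncard_eq_one]
    refine ⟨k, Set.ext fun k' => ?_⟩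
    simp only [Set.mem_ofPred_eq, Set.mem_singleton_iff]
    constructor
    · rintro ⟨h1, -⟩
      omega
    · rintro rfl
      exact ⟨hk, by rw [(staircase_unique hT hk).1]; exact h.2⟩
  · convert Set.ncard_empty ℕ
    rw [Set.eq_empty_iff_forall_notMem]
    rintro k ⟨h1, h2⟩
    have h3 := staircase_unique hT h1
    rw [h3.1] at h2
    exact h ⟨h3.2, h2⟩

/-- The number of parts of the staircase of charge `u`. -/
def stairLen (u : ℤ) : ℕ := (if 0 ≤ u then 2 * u else - 2 * u - 1).toNat

/-- The excess of the half-row `t` in the configuration with charges `D`, `B` and without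
excitation. -/
def vacuumHalf (D B : ℤ) (t : ℕ) : ℤ :=
  if t % 2 = 0 then (if (t / 2 : ℕ) < B then 1 else 0) - (if (t / 2 : ℕ) < -B then 1 else 0)
  else (if (t / 2 : ℕ) < -D then 1 else 0) - (if (t / 2 : ℕ) + 1 < D then 1 else 0)

/-- The number of beads in the first `t` half-rows. -/
def vacuumSum (D B : ℤ) (t : ℕ) : ℕ :=
  -- For `D ≤ 0` there are `-D` holes; for `D > 0` only `D - 1` particles appear as beads, since the
  -- one at level `0` has no half-row.
  min ((t + 1) / 2) B.natAbs + min (t / 2) (max (-D) (D - 1)).toNat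

theorem sum_vacuumHalf (D B : ℤ) (t : ℕ) :
    ∑ i ∈ Finset.range t, (vacuumHalf D B i).natAbs = vacuumSum D B t := by
  induction t with
  | zero => simp [vacuumSum]
  | succ t ih =>
    rw [Finset.sum_range_succ, ih, vacuumSum, vacuumSum, vacuumHalf]
    split_ifs <;> omega

theorem vacuumHalf_even (D B : ℤ) (j : ℕ) : (vacuumHalf D B (2 * j) ≠ 0 ↔ j < B ∨ j < -B) ∧
    (0 < vacuumHalf D B (2 * j) ↔ j < B) := by
  rw [vacuumHalf, if_pos (by omega), Nat.mul_div_cancel_left _ Nat.two_pos]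
  split_ifs <;> omega

theorem vacuumHalf_odd (D B : ℤ) (j : ℕ) :
    (vacuumHalf D B (2 * j + 1) ≠ 0 ↔ j < -D ∨ j + 1 < D) ∧
    (0 < vacuumHalf D B (2 * j + 1) ↔ j < -D) := by
  rw [vacuumHalf, if_neg (by omega), show (2 * j + 1) / 2 = j by omega]
  split_ifs <;> omega

theorem betaPart_cases (a b T : ℕ) : T + b ≤ a ∧ betaPart a b T = 0 ∨
    a < T + b ∧ T + a ≤ b ∧ betaPart a b T = T ∨
    a < T + b ∧ b < T + a ∧ 2 * betaPart a b T + a ≤ T + b ∧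
      T + b ≤ 2 * betaPart a b T + a + 1 := by
  unfold betaPart
  split_ifs <;> omega

theorem stairLen_cases (u : ℤ) :
    0 ≤ u ∧ (stairLen u : ℤ) = 2 * u ∨ u < 0 ∧ (stairLen u : ℤ) = - 2 * u - 1 := by
  unfold stairLen
  split_ifs <;> omega

/-- Odd positions `2 j + 1` come from the half-rows labelled `n - 1`, `n` and are governed by `u -
v`. The even positions in `staircase_odd` are governed by `u + v`, with the shift by `b`. -/
theorem staircase_even {u v b D B : ℤ} (hb : b = 0 ∨ b = 1) (hD : D = (2 * b - 1) * (u + v) + b)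
    (hB : B = (2 * b - 1) * (u - v)) (j : ℕ) :
    (2 * j + 1 + stairLen v ≤ stairLen u ∨ 2 * j + 1 + stairLen u ≤ stairLen v ∨
      2 * j + 1 ≤ stairLen u + stairLen v ∧ (stairLen u + stairLen v + (2 * j + 1)) % 2 = 0) ↔
      j < B ∨ j < -B := by
  have hu := stairLen_cases u
  have hv := stairLen_cases v
  generalize stairLen u = a at *
  generalize stairLen v = c at *
  rcases hb with rfl | rfl <;> norm_num at hD hB <;> rcases hu with ⟨hu, ha⟩ | ⟨hu, ha⟩ <;>
  rcases hv with ⟨hv, hc⟩ | ⟨hv, hc⟩ <;> omega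

theorem staircase_odd {u v b D B : ℤ} (hb : b = 0 ∨ b = 1) (hD : D = (2 * b - 1) * (u + v) + b)
    (hB : B = (2 * b - 1) * (u - v)) (j : ℕ) :
    (2 * j + 1 + 1 + stairLen v ≤ stairLen u ∨ 2 * j + 1 + 1 + stairLen u ≤ stairLen v ∨
      2 * j + 1 + 1 ≤ stairLen u + stairLen v ∧ (stairLen u + stairLen v + (2 * j + 1 + 1)) % 2 = 0) ↔
      j < -D ∨ j + 1 < D := by
  have hu := stairLen_cases u
  have hv := stairLen_cases v
  generalize stairLen u = a at *
  generalize stairLen v = c at *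
  rcases hb with rfl | rfl <;> norm_num at hD hB <;> rcases hu with ⟨hu, ha⟩ | ⟨hu, ha⟩ <;>
  rcases hv with ⟨hv, hc⟩ | ⟨hv, hc⟩ <;> omega

/-- Replaces minima and truncations by linear alternatives: `e` is the parity of the number of
columns, and `y` the number of beads in the half-rows `1, 3, …, 2 j - 1`. -/
theorem vacuumSum_even (D B : ℤ) (j : ℕ) (h : j < B ∨ j < -B) : ∃ e y : ℕ,
    (if 0 < D then 1 else 0) + vacuumSum D B (2 * j + 1) = e + (j + 1 + y) ∧
    (0 < D ∧ e = 1 ∧ (y = j ∧ j ≤ D - 1 ∨ y = D - 1 ∧ y < j) ∨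
      D ≤ 0 ∧ e = 0 ∧ (y = j ∧ j ≤ -D ∨ y = -D ∧ y < j)) := by
  refine ⟨if 0 < D then 1 else 0, min j (max (-D) (D - 1)).toNat, ?_, ?_⟩
  · rw [vacuumSum, min_eq_left (a := (2 * j + 1 + 1) / 2) (by omega),
      show (2 * j + 1 + 1) / 2 = j + 1 by omega, show (2 * j + 1) / 2 = j by omega]
  · split_ifs <;> omega

theorem beta_even {u v b D B : ℤ} (hb : b = 0 ∨ b = 1) (hD : D = (2 * b - 1) * (u + v) + b)
    (hB : B = (2 * b - 1) * (u - v)) (j : ℕ) (h : j < B ∨ j < -B) :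
    betaPart (stairLen u) (stairLen v) (2 * j + 1) % 2 = 0 ↔
      (j < B ↔ ((if 0 < D then 1 else 0) + vacuumSum D B (2 * j + 1)) % 2 = 0) := by
  generalize hβ : betaPart (stairLen u) (stairLen v) (2 * j + 1) = β
  obtain ⟨e, y, hS, hz⟩ := vacuumSum_even D B j h
  -- The bit `k` records the sign of the excess. The equivalence becomes a single congruence modulo
  -- `2`, checked in regions where the staircase lengths are linear and `β` is confined by linear
  -- bounds.
  obtain ⟨k, h1⟩ : ∃ k : ℕ, j < B ∧ k = 0 ∨ ¬ j < B ∧ j < -B ∧ k = 1 := by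
    rcases h with h | h
    · exact ⟨0, Or.inl ⟨h, rfl⟩⟩
    · exact ⟨1, Or.inr ⟨by clear * - h; omega, h, rfl⟩⟩
  have key : (β + (e + (j + 1 + y)) + k) % 2 = 0 := by
    have hu := stairLen_cases u
    have hv := stairLen_cases v
    have h3 := betaPart_cases (stairLen u) (stairLen v) (2 * j + 1)
    rw [hβ] at h3
    clear hβ hS
    generalize stairLen u = a at *
    generalize stairLen v = c at *
    rcases hb with rfl | rfl <;> norm_num at hD hB <;> subst hD <;> subst hB <;>
    rcases h1 with h1 | h1 <;>
    rcases hu with ⟨hu, ha⟩ | ⟨hu, ha⟩ <;> rcases hv with ⟨hv, hc⟩ | ⟨hv, hc⟩ <;>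
    rcases h3 with ⟨h5, rfl⟩ | ⟨h5, h6, rfl⟩ | ⟨h5, h6, h7, h8⟩ <;> omega
  rw [hS]
  clear hb hD hB hz hS hβ h
  rcases h1 with ⟨h1, rfl⟩ | ⟨h1, h2, rfl⟩
  · simp only [h1, true_iff]
    omega
  · simp only [h1, false_iff]
    omega

theorem vacuumSum_odd (D B : ℤ) (j : ℕ) (h : j < -D ∨ j + 1 < D) : ∃ e x : ℕ,
    (if 0 < D then 1 else 0) + vacuumSum D B (2 * j + 1 + 1) = e + (x + (j + 1)) ∧
    (0 < D ∧ e = 1 ∨ D ≤ 0 ∧ e = 0) ∧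
    (x = j + 1 ∧ (j + 1 ≤ B ∨ j + 1 ≤ -B) ∨ (x = B ∨ x = -B) ∧ x < j + 1) := by
  refine ⟨if 0 < D then 1 else 0, min (j + 1) B.natAbs, ?_, ?_, ?_⟩
  · rw [vacuumSum, min_eq_left (a := (2 * j + 1 + 1) / 2) (by omega),
      show (2 * j + 1 + 1) / 2 = j + 1 by omega, show (2 * j + 1 + 1 + 1) / 2 = j + 1 by omega]
  · split_ifs <;> omega
  · omega

theorem beta_odd {u v b D B : ℤ} (hb : b = 0 ∨ b = 1) (hD : D = (2 * b - 1) * (u + v) + b)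
    (hB : B = (2 * b - 1) * (u - v)) (j : ℕ) (h : j < -D ∨ j + 1 < D) :
    betaPart (stairLen u) (stairLen v) (2 * j + 1 + 1) % 2 = 0 ↔
      (j < -D ↔ ((if 0 < D then 1 else 0) + vacuumSum D B (2 * j + 1 + 1)) % 2 = 0) := by
  generalize hβ : betaPart (stairLen u) (stairLen v) (2 * j + 1 + 1) = β
  obtain ⟨e, x, hS, he, hz⟩ := vacuumSum_odd D B j h
  -- In these half-rows the excess is negative exactly when `D` is positive, so the sign bit equals
  -- the column parity `e`.
  obtain ⟨k, h1, hk⟩ : ∃ k : ℕ, (j < -D ∧ k = 0 ∨ ¬ j < -D ∧ j + 1 < D ∧ k = 1) ∧ k = e := by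
    clear * - h he
    rcases h with h | h
    · exact ⟨0, Or.inl ⟨h, rfl⟩, by omega⟩
    · exact ⟨1, Or.inr ⟨by omega, h, rfl⟩, by omega⟩
  clear he
  obtain rfl : e = k := hk.symm
  have key : (β + (e + (x + (j + 1))) + e) % 2 = 0 := by
    have hu := stairLen_cases u
    have hv := stairLen_cases v
    have h3 := betaPart_cases (stairLen u) (stairLen v) (2 * j + 1 + 1)
    rw [hβ] at h3
    clear hβ hS
    generalize stairLen u = a at *
    generalize stairLen v = c at *
    rcases hb with rfl | rfl <;> norm_num at hD hB <;> subst hD <;> subst hB <;>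
    rcases h1 with h1 | h1 <;>
    rcases hu with ⟨hu, ha⟩ | ⟨hu, ha⟩ <;> rcases hv with ⟨hv, hc⟩ | ⟨hv, hc⟩ <;>
    rcases h3 with ⟨h5, rfl⟩ | ⟨h5, h6, rfl⟩ | ⟨h5, h6, h7, h8⟩ <;> omega
  rw [hS]
  clear hb hD hB hz hS hβ h
  rcases h1 with ⟨h1, rfl⟩ | ⟨h1, h2, rfl⟩
  · simp only [h1, true_iff]
    omega
  · simp only [h1, false_iff]
    omega

end PairBeads

end TypeD

/-! ### Positions and colours of the half-beads of a core. -/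

namespace TypeD

open MayaPair

namespace Config

variable {g : ℕ} {C : Config}

/-- Without excitation there are no pairs, and particles and holes fill initial segments whose
lengths are given by the charges. -/
theorem half_eq_vacuumHalf (h : C.totalExcess g = 0) (t : ℕ) :
    C.half t = vacuumHalf (charge C.evenPair) (charge C.oddPair) t := by
  have hexc := Excitation.eq_vacuum_of_energy_eq_zero (energy_excitation.trans h)
  have hk : C.pairNums = 0 := congrArg (fun t : Excitation g => t.2.2.2) hexc
  unfold totalExcess at h
  have he := eq_of_excess_eq_zero (p := C.evenPair) (by omega)
  have ho := eq_of_excess_eq_zero (p := C.oddPair) (by omega)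
  have hp : pairNum (C.half t) = 0 := DFunLike.congr_fun hk t
  rw [← ofParts_self (C.half t), hp]
  generalize charge C.evenPair = D at *
  generalize charge C.oddPair = B at *
  rcases Nat.even_or_odd' t with ⟨j, rfl | rfl⟩
  · have h1 : HasPos (C.half (2 * j)) ↔ j < B.toNat := by
      rw [← mem_posSet, ← Finset.mem_range, ← add_zero (2 * j), ← mem_residue Nat.two_pos]
      rw [show residue 2 0 C.posSet = C.oddPair.1 from rfl, ho]
    have h2 : HasNeg (C.half (2 * j)) ↔ j < (-B).toNat := by
      rw [← mem_negSet, ← Finset.mem_range, ← add_zero (2 * j), ← mem_residue Nat.two_pos]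
      rw [show residue 2 0 C.negSet = C.oddPair.2 from rfl, ho]
    simp only [ofParts, vacuumHalf, h1, h2]
    split_ifs <;> omega
  · have h1 : HasPos (C.half (2 * j + 1)) ↔ j < (-D).toNat := by
      rw [← mem_posSet, ← Finset.mem_range, ← mem_residue one_lt_two]
      rw [show residue 2 1 C.posSet = C.evenPair.2 from rfl, he]
    have h2 : HasNeg (C.half (2 * j + 1)) ↔ j + 1 < D.toNat := by
      rw [← mem_negSet, ← succ_mem_evenPair_fst, he, Finset.mem_range]
    simp only [ofParts, vacuumHalf, h1, h2]
    split_ifs <;> omega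

/-- Sorts the columns into the full ones that end below the half-row `t`, those still filled in it,
and the half-columns ending in one of the half-rows `0, …, t`. -/
theorem size_eq (hg : 0 < g) (t : ℕ) : C.size = (C.full.filter (· < (t + 1) * g)).card +
    C.inner g ((t + 1) * g) + ∑ i ∈ Finset.range (t + 1), (C.half i).natAbs := by
  have h1 : C.full.card = (C.full.filter (· < (t + 1) * g)).card +
      (C.full.filter ((t + 1) * g ≤ ·)).card := by
    rw [← Finset.card_filter_add_card_filter_not (s := C.full) (· < (t + 1) * g)]
    simp only [not_lt]
  have h2 : (C.half.sum fun _ h => h.natAbs) =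
      (C.half.sum fun i h => if (t + 1) * g < (i + 1) * g then h.natAbs else 0) +
        ∑ i ∈ Finset.range (t + 1), (C.half i).natAbs := by
    have h3 : ∑ i ∈ Finset.range (t + 1), (C.half i).natAbs =
        C.half.sum fun i h => if i < t + 1 then h.natAbs else 0 := by
      rw [Finsupp.sum, ← Finset.sum_filter, ← Finset.sum_filter_ne_zero]
      apply Finset.sum_congr _ fun _ _ => rfl
      ext i
      simp only [Finset.mem_filter, Finset.mem_range, Finsupp.mem_support_iff, ne_eq,
        Int.natAbs_eq_zero]
      tauto
    rw [h3, Finsupp.sum, Finsupp.sum, Finsupp.sum, ← Finset.sum_add_distrib]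
    apply Finset.sum_congr rfl
    intro i _
    simp only [mul_lt_mul_iff_left₀ hg]
    split_ifs <;> omega
  unfold size inner
  omega

/-- By `size_eq` the number of shorter full columns is, modulo `2`, the total number of columns plus
`inner` plus the beads in the half-rows up to `t`. The term `inner` cancels against the twist, so
the colour depends only on the charges. -/
theorem isWhite_iff (hg : 0 < g) (h : C.totalExcess g = 0) {t : ℕ} (ht : C.half t ≠ 0) :
    C.IsWhite g t ↔ (0 < C.half t ↔ ((if 0 < charge C.evenPair then 1 else 0) +
      vacuumSum (charge C.evenPair) (charge C.oddPair) (t + 1)) % 2 = 0) := by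
  have h1 := size_eq (C := C) hg t
  have h2 : ∑ i ∈ Finset.range (t + 1), (C.half i).natAbs =
      vacuumSum (charge C.evenPair) (charge C.oddPair) (t + 1) := by
    rw [← sum_vacuumHalf]
    exact Finset.sum_congr rfl fun i _ => by rw [half_eq_vacuumHalf h]
  have h3 : C.size % 2 = if 0 < charge C.evenPair then 1 else 0 := by
    unfold totalExcess at h
    have he := eq_of_excess_eq_zero (p := C.evenPair) (by omega)
    have h4 := zero_mem_evenPair_fst (C := C)
    rw [he, Finset.mem_range] at h4
    split_ifs <;> omega
  rw [h2] at h1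
  rw [← h3, IsWhite, Nat.even_iff, twist]
  clear h2 h3
  generalize C.half t = x at *
  generalize inner g C ((t + 1) * g) = y at *
  generalize (C.full.filter (· < (t + 1) * g)).card = w at *
  generalize vacuumSum _ _ _ = s at *
  generalize C.size = k at *
  subst h1
  clear h
  rcases lt_or_gt_of_ne ht with h5 | h5
  · simp only [h5.not_gt, false_iff]
    split_ifs with h6
    · simp only [h5.not_gt, false_iff]
      omega
    · simp only [show 0 < -x by omega, true_iff]
      omega
  · simp only [h5, true_iff]
    split_ifs with h6
    · simp only [h5, true_iff]
      omega
    · simp only [show ¬ 0 < -x by omega, false_iff]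
      omega

end Config

open Classical in
theorem pairBeads_eq (u v : ℤ) {T : ℕ} (hT : 1 ≤ T) (x : BeadColor) :
    pairBeads u v T x =
      if (T + stairLen v ≤ stairLen u ∨ T + stairLen u ≤ stairLen v ∨
        T ≤ stairLen u + stairLen v ∧ (stairLen u + stairLen v + T) % 2 = 0) ∧
        x = (if betaPart (stairLen u) (stairLen v) T % 2 = 0 then BeadColor.white
          else BeadColor.black) then 1 else 0 := by
  have h1 := ncard_staircase (a := stairLen u) (b := stairLen v) hT (fun m => Even m)
  have h2 := ncard_staircase (a := stairLen u) (b := stairLen v) hT (fun m => ¬ Even m)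
  cases x
  · rw [if_neg]
    · rfl
    · rintro ⟨-, h⟩
      split_ifs at h
  · refine (show pairBeads u v T BeadColor.white = _ from h1).trans ?_
    simp only [Nat.even_iff]
    by_cases h3 : betaPart (stairLen u) (stairLen v) T % 2 = 0 <;> simp [h3]
  · refine (show pairBeads u v T BeadColor.black = _ from h2).trans ?_
    simp only [Nat.even_iff]
    by_cases h3 : betaPart (stairLen u) (stairLen v) T % 2 = 0 <;> simp [h3]

namespace Config

variable {g : ℕ} {C : Config}

theorem beadCount_eq_pairBeads (hg : 0 < g) (h : C.totalExcess g = 0) {u v b : ℤ}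
    (hb : b = 0 ∨ b = 1) (hD : charge C.evenPair = (2 * b - 1) * (u + v) + b)
    (hB : charge C.oddPair = (2 * b - 1) * (u - v)) (t : ℕ) (x : BeadColor) :
    beadCount (C.toWall g hg) ((t + 1) * (g + 1)) x = pairBeads u v (t + 1) x := by
  classical
  have hh := half_eq_vacuumHalf h t
  have hW : C.half t ≠ 0 → (C.IsWhite g t ↔ _) := fun ht => isWhite_iff hg h ht
  have hone : (C.half t).natAbs = if C.half t ≠ 0 then 1 else 0 := by
    rw [hh]
    unfold vacuumHalf
    split_ifs <;> omega
  have key : ((t + 1 + stairLen v ≤ stairLen u ∨ t + 1 + stairLen u ≤ stairLen v ∨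
      t + 1 ≤ stairLen u + stairLen v ∧ (stairLen u + stairLen v + (t + 1)) % 2 = 0) ↔
      C.half t ≠ 0) ∧ (C.half t ≠ 0 →
        (betaPart (stairLen u) (stairLen v) (t + 1) % 2 = 0 ↔ C.IsWhite g t)) := by
    rcases Nat.even_or_odd' t with ⟨j, rfl | rfl⟩
    · have h1 := vacuumHalf_even (charge C.evenPair) (charge C.oddPair) j
      rw [← hh] at h1
      refine ⟨(staircase_even hb hD hB j).trans h1.1.symm, fun h2 => ?_⟩
      rw [hW h2, h1.2]
      exact beta_even hb hD hB j (h1.1.1 h2)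
    · have h1 := vacuumHalf_odd (charge C.evenPair) (charge C.oddPair) j
      rw [← hh] at h1
      refine ⟨(staircase_odd hb hD hB j).trans h1.1.symm, fun h2 => ?_⟩
      rw [hW h2, h1.2]
      exact beta_odd hb hD hB j (h1.1.1 h2)
  rw [beadCount_eq, pairBeads_eq u v (by omega), hone, colorAt]
  refine Eq.trans ?_ (if_congr (and_congr_left' key.1.symm) rfl rfl)
  by_cases h0 : C.half t ≠ 0
  · simp only [key.2 h0]
    by_cases h1 : C.IsWhite g t <;> simp [h0, h1]
  · simp [h0]

theorem hasAbacusCoords (hg : 2 ≤ g) (h : C.totalExcess g = 0) {z : Fin (g + 2) → ℤ}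
    (hz : Charges.ofCoord z = C.charges (by omega : 0 < g)) :
    HasAbacusCoords (g + 2) (C.toWall g (by omega)) z := by
  have hpos : 0 < g := by omega
  have hz := congrArg Subtype.val hz
  simp only [Charges.ofCoord, charges, Prod.mk.injEq] at hz
  obtain ⟨h1, h2, h3⟩ := hz
  constructor
  · intro i hi
    have hi : (i : ℕ) < g := by omega
    have h4 := congrFun h1 ⟨i, hi⟩
    simp only at h4
    have e1 : (i : ℕ) / g = 0 := Nat.div_eq_of_lt hi
    have e2 : (2 * g - 1 - (i : ℕ)) / g = 1 :=
      Nat.div_eq_of_lt_le (by omega) (by omega)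
    have r1 := runnerCount_eq (C := C) hpos (show (i : ℕ) < 2 * g by omega)
    have r2 := runnerCount_eq (C := C) hpos (show 2 * g - 1 - (i : ℕ) < 2 * g by omega)
    rw [e1, add_zero] at r1
    rw [e2, show 2 * g - 1 - (i : ℕ) + 1 + 1 = 2 * (g + 2) - 2 - (i + 1) by omega] at r2
    rw [r1, r2]
    exact h4
  · intro i j hi hj t ht x
    obtain ⟨t, rfl⟩ : ∃ s, t = s + 1 := ⟨t - 1, by omega⟩
    have ei : i = (Fin.last g).castSucc := Fin.ext (by simp; omega)
    have ej : j = Fin.last (g + 1) := Fin.ext (by simp; omega)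
    rw [ei, ej]
    exact beadCount_eq_pairBeads hpos h (Charges.parity_cases _) h2.symm h3.symm t x

end Config
end TypeD

/-! ### Assembly of the theorem. -/

namespace TypeD

open Config

variable {g : ℕ}

theorem exists_coordinates (hg : 2 ≤ g) :
    ∃ (ψ : {Y : YoungWall (g + 2) // IsCore (g + 2) Y} ≃ (Fin (g + 2) → ℤ))
      (φ : (Fin (g + 2) → ℤ) ≃ (Fin (g + 2) → ℤ)),
      (∀ Y, HasAbacusCoords (g + 2) Y.1 (ψ Y)) ∧
      (∀ Y, ∀ j : Fin (g + 2 + 1),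
        (wt (g + 2) Y.1 j : ℚ) = thetaExponent (g + 2) (φ (ψ Y)) j) ∧
      ∀ z, φ z = fun i : Fin (g + 2) => (Charges.ofCoord z).weight i := by
  have hpos : 0 < g := by omega
  let core := Equiv.ofBijective _ (charges_core_bijective hg)
  let coord := Equiv.ofBijective _ (Charges.ofCoord_bijective (g := g))
  let weight := Equiv.ofBijective _ (Charges.weight_bijective hpos)
  have hwall : ∀ Y : {Y : YoungWall (g + 2) // IsCore (g + 2) Y}, ∃ C : Config,
      C.toWall g hpos = Y.1 ∧ C.totalExcess g = 0 ∧ core Y = C.charges hpos := by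
    intro Y
    have h1 : ((equivWall g hpos).symm Y.1).toWall g hpos = Y.1 :=
      (equivWall g hpos).apply_symm_apply Y.1
    exact ⟨_, h1, (isCore_iff hg).1 (by rw [h1]; exact Y.2), rfl⟩
  refine ⟨core.trans coord.symm, coord.trans weight, fun Y => ?_, fun Y j => ?_, fun z => rfl⟩
  · obtain ⟨C, hC, hexc, hcore⟩ := hwall Y
    rw [← hC]
    exact hasAbacusCoords hg hexc ((coord.apply_symm_apply (core Y)).trans hcore)
  · obtain ⟨C, hC, hexc, hcore⟩ := hwall Y
    have h1 := multiweight_eq hg C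
    rw [hexc, zero_smul, add_zero] at h1
    have h2 := thetaExponent_weight hg (C.charges hpos) j
    rw [← h1] at h2
    rw [Equiv.trans_apply, Equiv.trans_apply, Equiv.apply_symm_apply, hcore, ← hC]
    exact h2.symm

theorem sum_weight_ofCoord (z : Fin (g + 2) → ℤ) (a b : ℤ) (hb : b = 0 ∨ b = 1)
    (h : ∑ i : Fin (g + 2) with i.val + 2 < g + 2, z i = 2 * a - b) :
    ∑ i : Fin (g + 2), (Charges.ofCoord z).weight i =
      - (∑ i : Fin (g + 2) with i.val + 2 < g + 2,
          (((g + 2 : ℕ) : ℤ) - 1 - ((i.val : ℤ) + 1)) * z i)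
        - (((g + 2 : ℕ) : ℤ) - 1) * (2 * b - 1) *
          (z (Fin.last g).castSucc + z (Fin.last (g + 1)))
        - (((g + 2 : ℕ) : ℤ) - 1) * b := by
  have hsum : ∀ f : Fin (g + 2) → ℤ, ∑ i : Fin (g + 2) with i.val + 2 < g + 2, f i =
      ∑ s : Fin g, f s.castSucc.castSucc := by
    intro f
    rw [Finset.sum_filter, Fin.sum_univ_castSucc, Fin.sum_univ_castSucc]
    simp
  rw [hsum] at h
  -- The `b` of the statement is the parity used in `ofCoord`, because `2 a - b` has the parity of
  -- `b`.
  have hp : Charges.parity (fun s : Fin g => z s.castSucc.castSucc) = b := by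
    change (∑ s : Fin g, z s.castSucc.castSucc) % 2 = b
    rcases hb with rfl | rfl <;> omega
  rw [Charges.sum_weight, hsum]
  simp only [Charges.ofCoord, hp, Fin.val_castSucc]
  have e : ∑ s : Fin g, (((g + 2 : ℕ) : ℤ) - 1 - ((s : ℤ) + 1)) * z s.castSucc.castSucc =
      ∑ s : Fin g, ((g : ℤ) - s) * z s.castSucc.castSucc :=
    Finset.sum_congr rfl fun s _ => by push_cast; ring
  rw [e]
  push_cast
  ring

end TypeD

theorem theorem9p3 (n : ℕ) (hn : 4 ≤ n) :
    -- the bijection between core Young walls and `ℤ ^ n` given by the abacus, and the coordinate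
    -- change `φ` from `(z_1, …, z_n)` to `(m_1, …, m_n)`
    (∃ (ψ : {Y : TypeD.YoungWall n // TypeD.IsCore n Y} ≃ (Fin n → ℤ))
        (φ : (Fin n → ℤ) ≃ (Fin n → ℤ)),
      (∀ Y, TypeD.HasAbacusCoords n Y.1 (ψ Y)) ∧
      -- (1)
      (∀ Y, ∀ j : Fin (n + 1),
        (TypeD.wt n Y.1 j : ℚ) = TypeD.thetaExponent n (φ (ψ Y)) j) ∧
      -- (3)
      (∀ (z : Fin n → ℤ) (a b : ℤ), (b = 0 ∨ b = 1) →
        ∑ i : Fin n with i.val + 2 < n, z i = 2 * a - b →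
        ∑ i : Fin n, φ z i =
          - (∑ i : Fin n with i.val + 2 < n, ((n : ℤ) - 1 - ((i.val : ℤ) + 1)) * z i)
          - ((n : ℤ) - 1) * (2 * b - 1) * (z ⟨n - 2, by omega⟩ + z ⟨n - 1, by omega⟩)
          - ((n : ℤ) - 1) * b)) ∧
    -- (2)
    (∀ (m : Fin n → ℤ) (j : Fin (n + 1)), ∃ e : ℕ, TypeD.thetaExponent n m j = e) ∧
    Summable (fun Y : TypeD.YoungWall n => TypeD.qMonomial n (TypeD.wt n Y)) ∧
    Summable (fun m : Fin n → ℤ => TypeD.thetaTerm n m) ∧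
    Multipliable (fun k : ℕ => (1 - TypeD.barSeries n ^ (k + 1)) ^ (n + 1)) ∧
    IsUnit (∏' k : ℕ, (1 - TypeD.barSeries n ^ (k + 1)) ^ (n + 1)) ∧
    ∑' Y : TypeD.YoungWall n, TypeD.qMonomial n (TypeD.wt n Y) =
      (∑' m : Fin n → ℤ, TypeD.thetaTerm n m) *
        Ring.inverse (∏' k : ℕ, (1 - TypeD.barSeries n ^ (k + 1)) ^ (n + 1)) := by
  obtain ⟨g, rfl⟩ : ∃ g, n = g + 2 := ⟨n - 2, by omega⟩
  have hg : 2 ≤ g := by omega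
  refine ⟨?_, TypeD.summable_and_tsum_qMonomial hg⟩
  obtain ⟨ψ, φ, h1, h2, h3⟩ := TypeD.exists_coordinates hg
  refine ⟨ψ, φ, h1, h2, fun z a b hb hz => ?_⟩
  rw [h3]
  exact TypeD.sum_weight_ofCoord z a b hb hz
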